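/- **Setting.** Let $P_X(x,y,z)=\max(x,y,z)$ and let $X\subset\mathbb R^3$ be the tropical surface where this maximum is attained at least twice. It is the union of $\sigma_1=\{x=y\ge z\}$, $\sigma_2=\{x=z\ge y\}$, $\sigma_3=\{y=z\ge x\}$, which meet along $L=\{x=y=z\}$; let $\tilde\sigma_i$ be the plane spanned by $\sigma_i$. *Tropical curves.* An abstract tropical curve $C$ is a finite graph (loops, multiple edges and ends allowed; each end has one adjacent vertex) whose bounded edges $e$ have lengths $l(e)\ge 0$ (the edge is degenerate if $l(e)=0$) and whose vertices have genera $g_V\in\mathbb Z_{\ge0}$. There are no degenerate loops; no non-degenerate edge has its adjacent vertices in the same connected component of the union of the degenerate edges; vertices of genus $0$ have valency at least $3$ and vertices of genus $1$ have valency at least $1$. Its tropical Euler characteristic is $\chi_{\rm trop}(C)=b_0(C)-b_1(C)-\sum_V g_V$. It is explicit if all $g_V=0$. *Tropical morphisms.* A tropical morphism $h:C\to\mathbb R^3$ is a continuous map that is affine with integer direction vector $v(V,e)\in\mathbb Z^3$ (starting at $V\in\partial e$) on each non-degenerate edge $e$ parametrized by length, and constant on each degenerate edge, which is moreover equipped with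 integer vectors $v(V,e)=-v(V',e)$ at its two vertices, such that $\sum_{e\ni V}v(V,e)=0$ at every vertex $V$. Its Newton fan is the multiset of the direction vectors of the ends. Morphisms are considered up to isomorphism. *Tropical morphisms to $X$.* Such an $h$ is a premorphism to $X$ if $h(C)\subset X$, all $v(V,e)$ lie in $\tilde\sigma_1\cup\tilde\sigma_2\cup\tilde\sigma_3$, and $v(V,e)\in\tilde\sigma_i\setminus X$ implies $v(V,e')\in\tilde\sigma_i$ for all edges $e'$ adjacent to $V$. The intersection multiplicity $d_V$ of $C$ with $L$ at $V$ is $0$ if $h(V)\notin L$ or if all direction vectors at $V$ lie in one plane $\tilde\sigma_i$; otherwise $d_V=\sum_{e\ni V,\ v(V,e)\in\sigma_1}|P_X(v(V,e))+P_X(-v(V,e))|$ (any other face gives the same number). The overvalency of $V$ is $\mathrm{ov}_V=k_V-d_V-2+2g_V$, where $k_V$ is the number of edges adjacent to $V$, except those that are mapped into $L$ with direction vector parallel to $(1,1,1)$. Loops count twice in valencies, in $k_V$ and in sums over edges at $V$. A tropical morphism to $X$ is a premorphism with $\mathrm{ov}_V\ge0$ for every vertex $V$ with $d_V>0$. Put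 $C_i=h^{-1}(\sigma_i)$. *The enumerative problem.* Let $\Delta$ be a finite multiset of vectors of $\mathbb Z^3$ with sum $0$, all in $X$ and none in $L$; let $\Delta_i$ be the part of $\Delta$ in $\sigma_i$. Assume $|P_X(v)+P_X(-v)|=1$ for all $v\in\Delta_3$, and let $d=\sum_{v\in\Delta_1}|P_X(v)+P_X(-v)|=\#\Delta_3$. Let $\chi\in\mathbb Z$ be such that $N=\#\Delta-\chi-d\ge 0$. For a configuration $\omega$ of $N$ points in $\sigma_1\cup\sigma_2$ let $\mathbb T\mathcal S(\omega)$ be the set of isomorphism classes of tropical morphisms $h:C\to X$ with Newton fan $\Delta$ and $\chi_{\rm trop}(C)=\chi$ whose image contains all points of $\omega$ and such that every connected component of $C$ has at least one end. **Proposition.** There is a dense open subset $U$ of $(\sigma_1\cup\sigma_2)^N$ such that for all $\omega\in U$ the set $\mathbb T\mathcal S(\omega)$ is finite and every $h:C\to X$ in $\mathbb T\mathcal S(\omega)$ satisfies: 1. no edge $e$ of $C$ satisfies $h(e)\subset L$; 2. every vertex $V$ with $h(V)\notin L$ is $3$-valent, and $h$ is an embedding in a neighborhood of $V$; 3. $C$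 is explicit; 4. for every $p\in\omega$ the set $h^{-1}(p)$ is a single point, which lies in the interior of an edge of $C$; 5. $C_3$ is a union of $d$ ends of $C$; 6. every vertex $V$ with $h(V)\in L$ has $\mathrm{ov}_V=0$ and is adjacent to exactly one edge of $C_1$ and exactly one edge of $C_2$; 7. if $\omega\subset\sigma_1$, then $C_2$ is a disjoint union of $\#\Delta_2$ trees. -/

import Mathlib

noncomputable section

namespace TropicalX

/-! ### The tropical surface `X` in three-space -/

section Surface

variable {R : Type*} [LinearOrder R]

/-- The tropical polynomial `P_X = "x + y + z"`, i.e. `max (x, y, z)`. -/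
def tropPoly (p : Fin 3 → R) : R := max (p 0) (max (p 1) (p 2))

/-- The tropical surface `X`: the points at which the maximum in `P_X` is attained by at least
two of the three monomials. The same formula is used for real points and for integer vectors. -/
def surfaceX : Set (Fin 3 → R) :=
  {p | ∃ i j : Fin 3, i ≠ j ∧ p i = tropPoly p ∧ p j = tropPoly p}

/-- The faces of `X`: `face 0` is `σ₁ = {x = y ≥ z}`, `face 1` is `σ₂ = {x = z ≥ y}` and
`face 2` is `σ₃ = {y = z ≥ x}`. -/
def face : Fin 3 → Set (Fin 3 → R)
  | 0 => {p | p 0 = p 1 ∧ p 2 ≤ p 0}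
  | 1 => {p | p 0 = p 2 ∧ p 1 ≤ p 0}
  | 2 => {p | p 1 = p 2 ∧ p 0 ≤ p 1}

/-- The linear spans of the faces: `{x = y}`, `{x = z}` and `{y = z}`. -/
def plane : Fin 3 → Set (Fin 3 → R)
  | 0 => {p | p 0 = p 1}
  | 1 => {p | p 0 = p 2}
  | 2 => {p | p 1 = p 2}

/-- The line `L = {x = y = z}`, in which the three faces meet. -/
def lineL : Set (Fin 3 → R) := {p | p 0 = p 1 ∧ p 1 = p 2}

theorem surfaceX_eq_iUnion_face : (surfaceX : Set (Fin 3 → R)) = ⋃ i, face i := by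
  ext p
  simp only [surfaceX, tropPoly, face, Set.mem_iUnion, Set.mem_ofPred_eq, Fin.exists_fin_succ]
  constructor
  · rintro h
    rcases le_total (p 0) (p 1) with h1 | h1 <;> rcases le_total (p 1) (p 2) with h2 | h2 <;>
      rcases le_total (p 0) (p 2) with h3 | h3 <;>
      simp_all <;> grind
  · intro h
    simp_all
    grind

/-- The tropical intersection multiplicity with `L` of a vector `v`: `|P_X(v) + P_X(-v)|`. -/
def vecMult (v : Fin 3 → ℤ) : ℤ := |tropPoly v + tropPoly (-v)|

open Classical in
/-- The intersection multiplicity with `L` of a fan, given by the multiset of the direction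
vectors of its rays: it is `0` if the fan lies in one of the planes `plane i`; otherwise it is the
sum of the multiplicities of the vectors in one face of `X`, here `σ₁` (for a balanced fan in `X`
the three faces give the same number). -/
def fanMult (s : Multiset (Fin 3 → ℤ)) : ℤ :=
  if ∃ i, ∀ v ∈ s, v ∈ plane i then 0
  else ((s.filter fun v => v ∈ face 0).map vecMult).sum

end Surface

/-! ### Finite graphs with ends -/

/-- A finite graph (loops and multiple edges are allowed) with vertices `V`, bounded edges `E` and
ends `Λ`. A bounded edge comes with an auxiliary orientation from `src` to `tgt`; an end has one
adjacent vertex, its `root`. -/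
structure PuncturedGraph where
  V : Type
  E : Type
  Λ : Type
  [fintypeV : Fintype V]
  [fintypeE : Fintype E]
  [fintypeΛ : Fintype Λ]
  src : E → V
  tgt : E → V
  root : Λ → V

attribute [instance] PuncturedGraph.fintypeV PuncturedGraph.fintypeE PuncturedGraph.fintypeΛ

namespace PuncturedGraph

variable (G : PuncturedGraph)

/-- The edges of the graph: the bounded edges and the ends. -/
abbrev Edge : Type := G.E ⊕ G.Λ

/-- A flag is an edge together with one of its adjacent vertices: a bounded edge has two flags
(`false` at the source, `true` at the target, also if it is a loop), an end has one. -/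
abbrev Flag : Type := (G.E × Bool) ⊕ G.Λ

/-- The edge of a flag. -/
def edgeOf : G.Flag → G.Edge
  | .inl (e, _) => .inl e
  | .inr l => .inr l

/-- The vertex of a flag. -/
def base : G.Flag → G.V
  | .inl (e, false) => G.src e
  | .inl (e, true) => G.tgt e
  | .inr l => G.root l

/-- Vectors attached to the oriented bounded edges and to the ends give a vector for each flag: the
two flags of a bounded edge have opposite vectors. -/
def flagVec (d : G.E → Fin 3 → ℤ) (d' : G.Λ → Fin 3 → ℤ) : G.Flag → Fin 3 → ℤ
  | .inl (e, false) => d e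
  | .inl (e, true) => -d e
  | .inr l => d' l

open Classical in
/-- The flags at a vertex. -/
def flagsAt (v : G.V) : Finset G.Flag := Finset.univ.filter fun f => G.base f = v

/-- The valency of a vertex. -/
def val (v : G.V) : ℕ := (G.flagsAt v).card

/-- The set of connected components. -/
def Component : Type := Quot fun u v : G.V => ∃ e, G.src e = u ∧ G.tgt e = v

/-- The connected component of a vertex. -/
def component (v : G.V) : G.Component := Quot.mk _ v

open Classical in
/-- The boundary map from `1`-chains to `0`-chains with rational coefficients. -/
def boundary : (G.E → ℚ) →ₗ[ℚ] (G.V → ℚ) :=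
  ∑ e : G.E, (LinearMap.proj e).smulRight (Pi.single (G.tgt e) 1 - Pi.single (G.src e) 1)

/-- The Betti number `b₀`: the number of connected components. -/
def b0 : ℕ := Nat.card G.Component

/-- The Betti number `b₁`: the dimension of the space of cycles. -/
def b1 : ℕ := Module.finrank ℚ (LinearMap.ker G.boundary)

/-- The topological Euler characteristic. -/
def eulerChar : ℤ := (G.b0 : ℤ) - (G.b1 : ℤ)

/-- The graph is a disjoint union of `n` trees: it has `n` connected components and no cycle. -/
def IsUnionOfTrees (n : ℕ) : Prop := G.b0 = n ∧ G.b1 = 0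

/-- The points of the topological space underlying the graph: the vertices, the interior points of
bounded edges (identified with `(0, 1)`) and the interior points of ends (identified with
`(0, ∞)`). -/
inductive Point
  | vertex (v : G.V)
  | inner (e : G.E) (s : Set.Ioo (0 : ℝ) 1)
  | ray (l : G.Λ) (t : Set.Ioi (0 : ℝ))

/-- The closed edge, as a set of points: its interior and its adjacent vertices. -/
def closedEdge : G.Edge → Set G.Point
  | .inl e => {.vertex (G.src e), .vertex (G.tgt e)} ∪ Set.range (Point.inner e)
  | .inr l => {.vertex (G.root l)} ∪ Set.range (Point.ray l)

/-- The open star of radius `ε` around a vertex. -/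
def star (v : G.V) (ε : ℝ) : Set G.Point :=
  {.vertex v} ∪ {x | ∃ e s, x = .inner e s ∧
      ((G.src e = v ∧ (s : ℝ) < ε) ∨ (G.tgt e = v ∧ 1 - (s : ℝ) < ε))} ∪
    {x | ∃ l t, x = .ray l t ∧ G.root l = v ∧ (t : ℝ) < ε}

end PuncturedGraph

/-! ### Abstract tropical curves -/

/-- An abstract tropical curve: a finite graph with ends whose bounded edges have lengths (length
`0` means that the edge is degenerate) and whose vertices have genera. There is no degenerate loop,
the graph is tamely degenerate (no non-degenerate edge has its adjacent vertices in one and the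
same connected component of the union of the degenerate edges), and it is stable. -/
structure TropicalCurve extends PuncturedGraph where
  len : E → ℝ
  len_nonneg : ∀ e, 0 ≤ len e
  genus : V → ℕ
  no_degenerate_loop : ∀ e, len e = 0 → src e ≠ tgt e
  tame : ∀ e, 0 < len e → ¬ Relation.TransGen
    (fun u v => ∃ e', len e' = 0 ∧ ((src e' = u ∧ tgt e' = v) ∨ (src e' = v ∧ tgt e' = u)))
    (src e) (tgt e)
  stable : ∀ v, (genus v = 0 → 3 ≤ toPuncturedGraph.val v) ∧
    (genus v = 1 → 1 ≤ toPuncturedGraph.val v)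

namespace TropicalCurve

variable (C : TropicalCurve)

/-- The tropical Euler characteristic. -/
def tropEulerChar : ℤ := C.eulerChar - ∑ v, (C.genus v : ℤ)

/-- The curve is explicit if all its vertices have genus `0`. -/
def IsExplicit : Prop := ∀ v, C.genus v = 0

end TropicalCurve

/-! ### Tropical morphisms to three-space -/

/-- A tropical morphism `h : C → ℝ³`, together with its source `C`. It is given by the images `pos`
of the vertices and by the direction vectors: `dir e` starts at the source of the bounded edge `e`
(so that `-dir e` starts at its target), `endDir l` starts at the root of the end `l`. -/
structure TropicalMorphism extends TropicalCurve where
  pos : V → Fin 3 → ℝ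
  dir : E → Fin 3 → ℤ
  endDir : Λ → Fin 3 → ℤ
  affine : ∀ e i, pos (tgt e) i = pos (src e) i + len e * (dir e i : ℝ)
  balanced : ∀ v, ∑ f ∈ toPuncturedGraph.flagsAt v, toPuncturedGraph.flagVec dir endDir f = 0

namespace TropicalMorphism

variable (h : TropicalMorphism)

/-- The map `h` on the points of the curve. On a bounded edge the point with parameter `s` has
distance `s * len e` from the source; a degenerate edge is mapped to a point. -/
def eval : h.Point → Fin 3 → ℝ
  | .vertex v => h.pos v
  | .inner e s => fun i => h.pos (h.src e) i + (s : ℝ) * h.len e * (h.dir e i : ℝ)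
  | .ray l t => fun i => h.pos (h.root l) i + (t : ℝ) * (h.endDir l i : ℝ)

/-- The direction vector `v(V, e)` of the flag `(V, e)`. -/
def flagDir (f : h.Flag) : Fin 3 → ℤ := h.flagVec h.dir h.endDir f

/-- The image of a closed edge. -/
def edgeImage (e : h.Edge) : Set (Fin 3 → ℝ) := h.eval '' h.closedEdge e

/-- The Newton fan: the multiset of the direction vectors of the ends. -/
def newtonFan : Multiset (Fin 3 → ℤ) := (Finset.univ : Finset h.Λ).val.map h.endDir

/-- The map is an embedding in a neighbourhood of the vertex `v`. -/
def IsEmbeddingNear (v : h.V) : Prop := ∃ ε > 0, Set.InjOn h.eval (h.star v ε)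

/-- An isomorphism of tropical morphisms: an isomorphism of the graphs that preserves genera,
lengths, the map to `ℝ³` and all direction vectors. It may reverse the auxiliary orientations. -/
structure Iso (h h' : TropicalMorphism) where
  onV : h.V ≃ h'.V
  onE : h.E ≃ h'.E
  onΛ : h.Λ ≃ h'.Λ
  genus_eq : ∀ v, h'.genus (onV v) = h.genus v
  pos_eq : ∀ v, h'.pos (onV v) = h.pos v
  len_eq : ∀ e, h'.len (onE e) = h.len e
  edge_eq : ∀ e,
    (h'.src (onE e) = onV (h.src e) ∧ h'.tgt (onE e) = onV (h.tgt e) ∧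
      h'.dir (onE e) = h.dir e) ∨
    (h'.src (onE e) = onV (h.tgt e) ∧ h'.tgt (onE e) = onV (h.src e) ∧
      h'.dir (onE e) = -h.dir e)
  root_eq : ∀ l, h'.root (onΛ l) = onV (h.root l)
  endDir_eq : ∀ l, h'.endDir (onΛ l) = h.endDir l

/-! ### Tropical morphisms to `X` -/

/-- Tropical premorphisms to `X`. -/
def IsPremorphism : Prop :=
  Set.range h.eval ⊆ surfaceX ∧
  ∀ f : h.Flag, (∃ i, h.flagDir f ∈ plane i) ∧
    ∀ i, h.flagDir f ∈ plane i \ surfaceX →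
      ∀ f' : h.Flag, h.base f' = h.base f → h.flagDir f' ∈ plane i

/-- The edge of the flag `f` is tropically mapped to `L`: its image lies in `L` and its direction
vector is parallel to `(1, 1, 1)`. -/
def TropicallyMappedToL (f : h.Flag) : Prop :=
  h.edgeImage (h.edgeOf f) ⊆ lineL ∧ h.flagDir f ∈ lineL

open Classical in
/-- The intersection multiplicity `d_V` of the curve with `L` at the vertex `v`. A neighbourhood of
a vertex outside of `L` is mapped into one plane, so the multiplicity vanishes there. At a vertex on
`L` it is read off from the direction vectors of all the flags at `v`, degenerate or not. -/
def intMult (v : h.V) : ℤ :=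
  if h.pos v ∈ lineL then fanMult ((h.flagsAt v).val.map h.flagDir) else 0

open Classical in
/-- The overvalency `k_V - d_V - 2 + 2 g_V`, where `k_V` is the number of edges at `v` which are
not tropically mapped to `L`. -/
def overvalency (v : h.V) : ℤ :=
  (((h.flagsAt v).filter fun f => ¬ h.TropicallyMappedToL f).card : ℤ)
    - h.intMult v - 2 + 2 * (h.genus v : ℤ)

/-- Tropical morphisms to `X`: premorphisms that satisfy the Riemann-Hurwitz condition. -/
def IsMorphismToX : Prop :=
  h.IsPremorphism ∧ ∀ v, 0 < h.intMult v → 0 ≤ h.overvalency v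

open Classical in
/-- The subgraph `C_i = h⁻¹(face i)`. (If `h` maps to `X` then every edge is mapped into one
face, and it meets another face at most in vertices unless it is mapped into `L`.) -/
def preimageFace (i : Fin 3) : PuncturedGraph where
  V := {v : h.V // h.pos v ∈ face i}
  E := {e : h.E // h.edgeImage (.inl e) ⊆ face i}
  Λ := {l : h.Λ // h.edgeImage (.inr l) ⊆ face i}
  src e := ⟨h.src e.1, e.2 ⟨.vertex (h.src e.1), by simp [PuncturedGraph.closedEdge], rfl⟩⟩
  tgt e := ⟨h.tgt e.1, e.2 ⟨.vertex (h.tgt e.1), by simp [PuncturedGraph.closedEdge], rfl⟩⟩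
  root l := ⟨h.root l.1, l.2 ⟨.vertex (h.root l.1), by simp [PuncturedGraph.closedEdge], rfl⟩⟩

open Classical in
/-- The number of edges of `C_i = h⁻¹(face i)` adjacent to the vertex `v`. -/
def numEdgesInFace (i : Fin 3) (v : h.V) : ℕ :=
  ((h.flagsAt v).filter fun f => h.edgeImage (h.edgeOf f) ⊆ face i).card

end TropicalMorphism

/-! ### The enumerative problem -/

open Classical in
/-- The multiset of the vectors of the Newton fan `Δ` that lie in `face i`. -/
def fanInFace (Δ : Multiset (Fin 3 → ℤ)) (i : Fin 3) : Multiset (Fin 3 → ℤ) :=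
  Δ.filter fun v => v ∈ face i

/-- The set `TS(ω)` of tropical morphisms to `X` with Newton fan `Δ` and tropical Euler
characteristic `χ` which pass through all points of `ω`. Every connected component of the curve is
required to have an end, which rules out components contracted to a point. -/
def TS (Δ : Multiset (Fin 3 → ℤ)) (χ : ℤ) (ω : Set (Fin 3 → ℝ)) : Set TropicalMorphism :=
  {h | h.IsMorphismToX ∧ h.newtonFan = Δ ∧ h.tropEulerChar = χ ∧ ω ⊆ Set.range h.eval ∧
    ∀ c : h.Component, ∃ l : h.Λ, h.component (h.root l) = c}

/-- A set of tropical morphisms is finite when isomorphic morphisms are identified. -/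
def FiniteUpToIso (S : Set TropicalMorphism) : Prop :=
  ∃ F : Set TropicalMorphism, F.Finite ∧ F ⊆ S ∧
    ∀ h ∈ S, ∃ h' ∈ F, Nonempty (TropicalMorphism.Iso h h')

end TropicalX

end

/-! The proof is a dimension count that turns out to be sharp, and every assertion is read off from
the equality case.

The projection `proj`, p ↦ (x, 2x - y - z), is injective on each face and sends L to the axis of
height 0; σ₁ and σ₂ lie in height ≥ 0, σ₃ in height ≤ 0. A deformation of a curve without degenerate
edges is recorded by the moments (`mom`) of its edges in σ₁ ∪ σ₂, the up edges, and by the positions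
of its vertices on L. These unknowns satisfy `system`: the moments at a vertex off L sum to zero,
and the moment of an up flag at a vertex on L is determined by the position of that vertex. The
equations are independent (`system_surjective`), because a multiplier that annihilates them is a
locally constant potential vanishing on the ends, and the maximum principle for balanced graphs
excludes a nonzero one. If the curve passes through N generic points, the moments of N marked edges
can be prescribed freely, so N is at most the number of unknowns minus the number of equations. With
N = (number of up ends) - χ this becomes (up flags on L - 2 · vertices on L) + (down edges - down
vertices) + (silent edges + genera - inactive vertices) ≤ 0, where all three brackets are
nonnegative (`two_le_upCount`, `card_down_vertex_le`, `card_inactive_le`). Hence nothing is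
contracted or lies in L, all genera vanish, each vertex on L has exactly two up edges, and the
system with the marked moments is bijective (`IsRigid`).

Rigidity means that a functional vanishing on all deformations is a combination of the equations,
that is, a potential on the vertices (`exists_potential`). Applied to the linear relations between
the directions at one vertex, this leaves only the balancing relation, so the vertex is trivalent
with nonparallel edges. Applied to two edges through one marked point, it shows that they coincide.
Applied to a face without marked edges, it gives at least as many vertices as edges and ends there,
hence trees.

Degenerate edges are handled by running the count on the contracted curve `contract`, which has the
same Newton fan and Euler characteristic. The Riemann-Hurwitz condition enters only at L. In the
preimage of a vertex of the contracted curve, the number of down edges is at most the total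
multiplicity, which is at most the sum of val - 2, which is again the number of down edges
(`line_equalities`). So the overvalencies vanish, every edge entering σ₃ is primitive, and no
degenerate edge lies on L; off L trivalence excludes them. Primitivity together with the equality
between down edges and down vertices leaves no vertex inside σ₃ (`ht_nonneg`).

Slopes and sizes of the curves are bounded, so only finitely many combinatorial types occur. Each
type with two families of incidence conditions defines a linear subspace of plane configurations
(`incidenceSpace`), and the generic set consists of the configurations off L that avoid all proper
ones. Two curves of the same type with the same marked flags differ by a deformation with zero
marked moments, hence agree; this is the finiteness. -/

noncomputable section

namespace TropicalX

/-! ### Linear coordinates adapted to the surface -/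

section Coordinates

variable {R : Type*} [CommRing R]

/-- The height: it vanishes on the line `L`, is nonnegative on `face 0` and `face 1` and
nonpositive on `face 2`. -/
def hgt (p : Fin 3 → R) : R := 2 * p 0 - p 1 - p 2

/-- The side: it distinguishes `face 0` from `face 1`. -/
def sid (p : Fin 3 → R) : R := p 1 - p 2

/-- The additive map `hgt` on integer vectors. -/
def hgtHom : (Fin 3 → ℤ) →+ ℤ where
  toFun := hgt
  map_zero' := by simp [hgt]
  map_add' v w := by simp [hgt]; ring

/-- The additive map `sid` on integer vectors. -/
def sidHom : (Fin 3 → ℤ) →+ ℤ where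
  toFun := sid
  map_zero' := by simp [sid]
  map_add' v w := by simp [sid]; ring

@[simp] theorem hgtHom_apply (v : Fin 3 → ℤ) : hgtHom v = hgt v := rfl

@[simp] theorem hgt_zero : hgt (0 : Fin 3 → R) = 0 := by simp [hgt]
@[simp] theorem hgt_neg (v : Fin 3 → R) : hgt (-v) = -hgt v := by simp [hgt]; ring
@[simp] theorem sid_neg (v : Fin 3 → R) : sid (-v) = -sid v := by simp [sid]; ring

theorem hgt_line (p v : Fin 3 → R) (t : R) :
    hgt (fun i => p i + t * v i) = hgt p + t * hgt v := by simp only [hgt]; ring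

theorem sid_line (p v : Fin 3 → R) (t : R) :
    sid (fun i => p i + t * v i) = sid p + t * sid v := by simp only [sid]; ring

theorem hgt_cast (v : Fin 3 → ℤ) : hgt (fun i => (v i : ℝ)) = (hgt v : ℤ) := by
  simp [hgt]

theorem sid_cast (v : Fin 3 → ℤ) : sid (fun i => (v i : ℝ)) = (sid v : ℤ) := by
  simp [sid]

variable [LinearOrder R] [IsStrictOrderedRing R] {p : Fin 3 → R}

theorem mem_face_zero : p ∈ face 0 ↔ sid p = hgt p ∧ 0 ≤ hgt p := by
  simp only [face, hgt, sid, Set.mem_ofPred_eq]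
  constructor <;> rintro ⟨h1, h2⟩ <;> constructor <;> linarith

theorem mem_face_one : p ∈ face 1 ↔ sid p = -hgt p ∧ 0 ≤ hgt p := by
  simp only [face, hgt, sid, Set.mem_ofPred_eq]
  constructor <;> rintro ⟨h1, h2⟩ <;> constructor <;> linarith

theorem mem_face_two : p ∈ face 2 ↔ sid p = 0 ∧ hgt p ≤ 0 := by
  simp only [face, hgt, sid, Set.mem_ofPred_eq]
  constructor <;> rintro ⟨h1, h2⟩ <;> constructor <;> linarith

theorem mem_plane_zero : p ∈ plane 0 ↔ sid p = hgt p := by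
  simp only [plane, hgt, sid, Set.mem_ofPred_eq]
  constructor <;> intro h <;> linarith

theorem mem_plane_one : p ∈ plane 1 ↔ sid p = -hgt p := by
  simp only [plane, hgt, sid, Set.mem_ofPred_eq]
  constructor <;> intro h <;> linarith

theorem mem_plane_two : p ∈ plane 2 ↔ sid p = 0 := by
  simp only [plane, sid, Set.mem_ofPred_eq]
  constructor <;> intro h <;> linarith

theorem mem_lineL : p ∈ lineL ↔ hgt p = 0 ∧ sid p = 0 := by
  simp only [lineL, hgt, sid, Set.mem_ofPred_eq]
  constructor <;> rintro ⟨h1, h2⟩ <;> constructor <;> linarith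

theorem mem_surfaceX : p ∈ surfaceX ↔
    (sid p = hgt p ∧ 0 ≤ hgt p) ∨ (sid p = -hgt p ∧ 0 ≤ hgt p) ∨ (sid p = 0 ∧ hgt p ≤ 0) := by
  rw [surfaceX_eq_iUnion_face, Set.mem_iUnion, ← mem_face_zero, ← mem_face_one, ← mem_face_two]
  simp [Fin.exists_fin_succ]

theorem mem_surfaceX_iff_exists_face : p ∈ surfaceX ↔ ∃ i, p ∈ face i := by
  rw [surfaceX_eq_iUnion_face, Set.mem_iUnion]

theorem mem_lineL_iff_of_mem_surfaceX (hp : p ∈ surfaceX) : p ∈ lineL ↔ hgt p = 0 := by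
  rw [mem_surfaceX] at hp
  rw [mem_lineL]
  refine ⟨fun h => h.1, fun h => ⟨h, ?_⟩⟩
  rcases hp with h1 | h1 | h1 <;> linarith [h1.1]

theorem mem_face_of_mem_lineL (hp : p ∈ lineL) (i : Fin 3) : p ∈ face i := by
  rw [mem_lineL] at hp
  fin_cases i
  · exact mem_face_zero.2 ⟨by linarith [hp.1, hp.2], hp.1.ge⟩
  · exact mem_face_one.2 ⟨by linarith [hp.1, hp.2], hp.1.ge⟩
  · exact mem_face_two.2 ⟨by linarith [hp.1, hp.2], hp.1.le⟩

theorem face_subset_surfaceX (i : Fin 3) (hp : p ∈ face i) : p ∈ surfaceX :=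
  mem_surfaceX_iff_exists_face.2 ⟨i, hp⟩

theorem mem_plane_of_mem_face {i : Fin 3} (hp : p ∈ face i) : p ∈ plane i := by
  fin_cases i
  · exact mem_plane_zero.2 (mem_face_zero.1 hp).1
  · exact mem_plane_one.2 (mem_face_one.1 hp).1
  · exact mem_plane_two.2 (mem_face_two.1 hp).1

/-- Two different faces meet in the line. -/
theorem face_unique {i j : Fin 3} (hi : p ∈ face i) (hj : p ∈ face j) (hL : p ∉ lineL) :
    i = j := by
  rw [mem_lineL] at hL
  have key : ∀ k : Fin 3, p ∈ face k → (k = 0 ∧ sid p = hgt p ∧ 0 ≤ hgt p) ∨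
      (k = 1 ∧ sid p = -hgt p ∧ 0 ≤ hgt p) ∨ (k = 2 ∧ sid p = 0 ∧ hgt p ≤ 0) := by
    intro k hk
    fin_cases k
    · exact Or.inl ⟨rfl, mem_face_zero.1 hk⟩
    · exact Or.inr (Or.inl ⟨rfl, mem_face_one.1 hk⟩)
    · exact Or.inr (Or.inr ⟨rfl, mem_face_two.1 hk⟩)
  by_contra hne
  rcases key i hi with ⟨rfl, h1, h2⟩ | ⟨rfl, h1, h2⟩ | ⟨rfl, h1, h2⟩ <;>
    rcases key j hj with ⟨rfl, h3, h4⟩ | ⟨rfl, h3, h4⟩ | ⟨rfl, h3, h4⟩ <;>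
    first
      | exact hne rfl
      | exact hL ⟨by linarith, by linarith⟩

theorem mem_face_of_mem_plane {i : Fin 3} (hp : p ∈ plane i) (hX : p ∈ surfaceX) :
    p ∈ face i := by
  by_cases hL : p ∈ lineL
  · exact mem_face_of_mem_lineL hL i
  rw [mem_lineL] at hL
  rw [mem_surfaceX] at hX
  fin_cases i
  · have := mem_plane_zero.1 hp
    refine mem_face_zero.2 ⟨this, ?_⟩
    rcases hX with h | h | h
    · exact h.2
    · exact h.2
    · exact absurd ⟨by linarith [h.1], by linarith [h.1]⟩ hL
  · have := mem_plane_one.1 hp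
    refine mem_face_one.2 ⟨this, ?_⟩
    rcases hX with h | h | h
    · exact h.2
    · exact h.2
    · exact absurd ⟨by linarith [h.1], by linarith [h.1]⟩ hL
  · have := mem_plane_two.1 hp
    refine mem_face_two.2 ⟨this, ?_⟩
    rcases hX with h | h | h
    · exact le_of_eq (by linarith [h.1])
    · exact le_of_eq (by linarith [h.1])
    · exact h.2

theorem neg_mem_plane {i : Fin 3} {v : Fin 3 → R} (hv : v ∈ plane i) : -v ∈ plane i := by
  fin_cases i
  · exact mem_plane_zero.2 (by simpa using mem_plane_zero.1 hv)
  · exact mem_plane_one.2 (by rw [hgt_neg, sid_neg, mem_plane_one.1 hv])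
  · exact mem_plane_two.2 (by simpa using mem_plane_two.1 hv)

theorem eq_zero_of_plane {i : Fin 3} {v : Fin 3 → R} (hv : v ∈ plane i) (h0 : v 0 = 0)
    (hh : hgt v = 0) : v = 0 := by
  have hs : sid v = 0 := by
    fin_cases i
    · rw [← hh]; exact mem_plane_zero.1 hv
    · have := mem_plane_one.1 hv
      rw [this, hh, neg_zero]
    · exact mem_plane_two.1 hv
  simp only [hgt, sid] at hh hs
  funext j
  fin_cases j
  · exact h0
  · show v 1 = 0
    linarith
  · show v 2 = 0
    linarith

end Coordinates

/-! ### Segments contained in the surface -/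

section Segments

variable {p v : Fin 3 → ℝ} {T : ℝ}

/-- Near a point off L the surface is a piece of one plane, which fixes the plane of the direction.
The segment then stays in the intersection of that plane with X, which is the face: it may end on L
but cannot pass into another face. -/
theorem mem_face_of_line (hT : 0 < T) {i : Fin 3} (hp : p ∈ face i) (hpL : p ∉ lineL)
    (hX : ∀ t ∈ Set.Icc 0 T, (fun j => p j + t * v j) ∈ surfaceX) :
    v ∈ plane i ∧ ∀ t ∈ Set.Icc 0 T, (fun j => p j + t * v j) ∈ face i := by
  have hv : v ∈ plane i := by
    have hh : hgt p ≠ 0 := fun h => hpL ((mem_lineL_iff_of_mem_surfaceX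
      (face_subset_surfaceX i hp)).2 h)
    set B : ℝ := |hgt v| + |sid v| + 1 with hB
    have hB0 : 0 < B := by positivity
    have hh0 : 0 < |hgt p| := abs_pos.2 hh
    -- A time so short that height and side each change by at most half of `|hgt p|`; the equations
    -- of the other faces then fail at time `t`.
    set t : ℝ := min T (|hgt p| / (2 * B)) with ht
    have ht0 : 0 < t := lt_min hT (by positivity)
    have htT : t ≤ T := min_le_left _ _
    have htB : t * B ≤ |hgt p| / 2 := by
      have : t ≤ |hgt p| / (2 * B) := min_le_right _ _
      calc t * B ≤ |hgt p| / (2 * B) * B := by gcongr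
        _ = |hgt p| / 2 := by field_simp
    have h1 : |t * hgt v| ≤ |hgt p| / 2 := by
      rw [abs_mul, abs_of_pos ht0]
      refine le_trans ?_ htB
      gcongr
      have := abs_nonneg (sid v)
      linarith
    have h2 : |t * sid v| ≤ |hgt p| / 2 := by
      rw [abs_mul, abs_of_pos ht0]
      refine le_trans ?_ htB
      gcongr
      have := abs_nonneg (hgt v)
      linarith
    have hq := hX t ⟨ht0.le, htT⟩
    rw [mem_surfaceX, hgt_line, sid_line] at hq
    rw [abs_le] at h1 h2
    fin_cases i
    · obtain ⟨e1, e2⟩ := mem_face_zero.1 hp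
      have e3 : 0 < hgt p := lt_of_le_of_ne e2 (Ne.symm hh)
      rw [abs_of_pos e3] at h1 h2
      refine mem_plane_zero.2 ?_
      have : t * sid v = t * hgt v := by
        rcases hq with h | h | h
        · linarith [h.1]
        · linarith [h.1]
        · linarith [h.1, h.2]
      exact mul_left_cancel₀ ht0.ne' this
    · obtain ⟨e1, e2⟩ := mem_face_one.1 hp
      have e3 : 0 < hgt p := lt_of_le_of_ne e2 (Ne.symm hh)
      rw [abs_of_pos e3] at h1 h2
      refine mem_plane_one.2 ?_
      have : t * sid v = t * (-hgt v) := by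
        rcases hq with h | h | h
        · linarith [h.1]
        · linarith [h.1]
        · linarith [h.1, h.2]
      exact mul_left_cancel₀ ht0.ne' this
    · obtain ⟨e1, e2⟩ := mem_face_two.1 hp
      have e3 : hgt p < 0 := lt_of_le_of_ne e2 hh
      rw [abs_of_neg e3] at h1 h2
      refine mem_plane_two.2 ?_
      have : t * sid v = t * 0 := by
        rcases hq with h | h | h
        · linarith [h.2]
        · linarith [h.2]
        · linarith [h.1]
      exact mul_left_cancel₀ ht0.ne' this
  refine ⟨hv, fun t ht => mem_face_of_mem_plane ?_ (hX t ht)⟩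
  have hpp := mem_plane_of_mem_face hp
  fin_cases i
  · have := mem_plane_zero.1 hv
    have := mem_plane_zero.1 hpp
    refine mem_plane_zero.2 ?_
    rw [hgt_line, sid_line]
    simp_all
  · have := mem_plane_one.1 hv
    have := mem_plane_one.1 hpp
    refine mem_plane_one.2 ?_
    rw [hgt_line, sid_line]
    simp_all
    ring
  · have := mem_plane_two.1 hv
    have := mem_plane_two.1 hpp
    refine mem_plane_two.2 ?_
    rw [sid_line]
    simp_all

/-- The surface is a cone and is invariant under translation along L. -/
theorem mem_surfaceX_of_line {t : ℝ} (ht : 0 < t) (hp : p ∈ lineL)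
    (hX : (fun j => p j + t * v j) ∈ surfaceX) : v ∈ surfaceX := by
  rw [mem_lineL] at hp
  rw [mem_surfaceX, hgt_line, sid_line, hp.1, hp.2] at hX
  rw [mem_surfaceX]
  simp only [zero_add] at hX
  rcases hX with ⟨h1, h2⟩ | ⟨h1, h2⟩ | ⟨h1, h2⟩
  · exact Or.inl ⟨mul_left_cancel₀ ht.ne' h1, nonneg_of_mul_nonneg_right h2 ht⟩
  · refine Or.inr (Or.inl ⟨mul_left_cancel₀ ht.ne' (by linarith), nonneg_of_mul_nonneg_right h2 ht⟩)
  · refine Or.inr (Or.inr ⟨mul_left_cancel₀ ht.ne' (by linarith), ?_⟩)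
    by_contra hc
    push Not at hc
    have := mul_pos ht hc
    linarith

end Segments

theorem cast_mem_surfaceX {v : Fin 3 → ℤ} :
    (fun j => (v j : ℝ)) ∈ surfaceX ↔ v ∈ surfaceX := by
  rw [mem_surfaceX, mem_surfaceX, hgt_cast, sid_cast]
  norm_cast

theorem cast_mem_plane {i : Fin 3} {v : Fin 3 → ℤ} :
    (fun j => (v j : ℝ)) ∈ plane i ↔ v ∈ plane i := by
  fin_cases i
  · show (fun j => (v j : ℝ)) ∈ plane 0 ↔ v ∈ plane 0
    rw [mem_plane_zero, mem_plane_zero, hgt_cast, sid_cast]; norm_cast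
  · show (fun j => (v j : ℝ)) ∈ plane 1 ↔ v ∈ plane 1
    rw [mem_plane_one, mem_plane_one, hgt_cast, sid_cast]; norm_cast
  · show (fun j => (v j : ℝ)) ∈ plane 2 ↔ v ∈ plane 2
    rw [mem_plane_two, mem_plane_two, sid_cast]; norm_cast

/-! ### Sums over flags and the Euler characteristic -/

namespace PuncturedGraph

variable (G : PuncturedGraph)

theorem sum_flag {M : Type*} [AddCommMonoid M] (g : G.Flag → M) :
    ∑ f, g f = ∑ e : G.E, (g (.inl (e, false)) + g (.inl (e, true))) + ∑ l : G.Λ, g (.inr l) := by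
  rw [Fintype.sum_sum_type, Fintype.sum_prod_type]
  simp [add_comm]

theorem mem_flagsAt {v : G.V} {f : G.Flag} : f ∈ G.flagsAt v ↔ G.base f = v := by
  simp [flagsAt]

open Classical in
theorem sum_sum_flagsAt {M : Type*} [AddCommMonoid M] (P : G.V → Prop) (g : G.Flag → M) :
    ∑ v with P v, ∑ f ∈ G.flagsAt v, g f = ∑ f with P (G.base f), g f := by
  rw [Finset.sum_sigma']
  refine Finset.sum_bij' (fun x _ => x.2) (fun f _ => ⟨G.base f, f⟩) ?_ ?_ ?_ ?_ ?_
  · rintro ⟨v, f⟩ h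
    simp only [Finset.mem_sigma, Finset.mem_filter, Finset.mem_univ, true_and, mem_flagsAt] at h ⊢
    rw [h.2]; exact h.1
  · intro f h
    simp only [Finset.mem_sigma, Finset.mem_filter, Finset.mem_univ, true_and, mem_flagsAt] at h ⊢
    exact ⟨h, trivial⟩
  · rintro ⟨v, f⟩ h
    simp only [Finset.mem_sigma, Finset.mem_filter, Finset.mem_univ, true_and, mem_flagsAt] at h ⊢
    obtain ⟨h1, h2⟩ := h
    subst h2
    rfl
  · intro f h; rfl
  · intro f h; rfl

theorem sum_sum_flagsAt_univ {M : Type*} [AddCommMonoid M] (g : G.Flag → M) :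
    ∑ v, ∑ f ∈ G.flagsAt v, g f = ∑ f, g f := by
  classical
  have := G.sum_sum_flagsAt (fun _ => True) g
  simpa using this

theorem sum_val : ∑ v, (G.val v : ℤ) = 2 * Fintype.card G.E + Fintype.card G.Λ := by
  have := G.sum_sum_flagsAt_univ (fun _ => (1 : ℤ))
  simp only [Finset.sum_const, mul_one, nsmul_eq_mul] at this
  unfold val
  rw [this]
  simp [mul_comm]

open Classical in
/-- The incidence matrix. -/
def incidence : Matrix G.V G.E ℚ := fun v e =>
  (Pi.single (G.tgt e) 1 - Pi.single (G.src e) 1 : G.V → ℚ) v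

theorem boundary_eq_incidence : G.boundary = G.incidence.mulVecLin := by
  refine LinearMap.ext fun x => funext fun v => ?_
  simp [boundary, incidence, Matrix.mulVec, dotProduct, mul_comm]

theorem coboundary_apply (f : G.V → ℚ) (e : G.E) :
    G.incidence.transpose.mulVecLin f e = f (G.tgt e) - f (G.src e) := by
  classical
  rw [Matrix.mulVecLin_apply]
  show ∑ v, G.incidence v e * f v = _
  simp [incidence, Pi.single_apply, sub_mul, Finset.sum_sub_distrib]

/-- Locally constant functions are functions on the set of components. -/
def kerCoboundaryEquiv :
    LinearMap.ker G.incidence.transpose.mulVecLin ≃ₗ[ℚ] (G.Component → ℚ) where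
  toFun f := fun c => Quot.lift (f : G.V → ℚ) (by
    rintro u v ⟨e, rfl, rfl⟩
    have h := congrFun f.2 e
    rw [coboundary_apply] at h
    simp only [Pi.zero_apply] at h
    linarith) c
  invFun g := ⟨fun v => g (G.component v), by
    rw [LinearMap.mem_ker]
    ext e
    have : G.component (G.src e) = G.component (G.tgt e) := Quot.sound ⟨e, rfl, rfl⟩
    rw [coboundary_apply, this, sub_self, Pi.zero_apply]⟩
  left_inv f := by ext v; rfl
  right_inv g := by
    ext c
    induction c using Quot.ind
    rfl
  map_add' f g := by
    ext c
    induction c using Quot.ind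
    rfl
  map_smul' a f := by
    ext c
    induction c using Quot.ind
    rfl

instance : Finite G.Component := inferInstanceAs (Finite (Quot _))

/-- The kernel of the incidence matrix has dimension b₁, the kernel of its transpose consists of the
locally constant functions and has dimension b₀, and the two ranks agree. -/
theorem eulerChar_eq : G.eulerChar = (Fintype.card G.V : ℤ) - Fintype.card G.E := by
  classical
  have h1 := LinearMap.finrank_range_add_finrank_ker G.incidence.mulVecLin
  have h2 := LinearMap.finrank_range_add_finrank_ker G.incidence.transpose.mulVecLin
  have h3 : Module.finrank ℚ (LinearMap.range G.incidence.transpose.mulVecLin) =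
      Module.finrank ℚ (LinearMap.range G.incidence.mulVecLin) :=
    Matrix.rank_transpose G.incidence
  have h4 : Module.finrank ℚ (LinearMap.ker G.incidence.transpose.mulVecLin) = G.b0 := by
    have := Fintype.ofFinite G.Component
    rw [LinearEquiv.finrank_eq G.kerCoboundaryEquiv, Module.finrank_fintype_fun_eq_card, b0,
      Nat.card_eq_fintype_card]
  rw [Module.finrank_fintype_fun_eq_card] at h1 h2
  unfold eulerChar b1
  rw [boundary_eq_incidence]
  omega

end PuncturedGraph

namespace PuncturedGraph

variable (G : PuncturedGraph)

/-- A nonempty set of vertices which is closed under adjacency contains the root of an end. -/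
theorem exists_root_mem_of_closed
    (hend : ∀ c : G.Component, ∃ l : G.Λ, G.component (G.root l) = c) {S : Set G.V}
    (hS : S.Nonempty)
    (hcl : ∀ e b, G.base (.inl (e, b)) ∈ S → G.base (.inl (e, !b)) ∈ S) :
    ∃ l, G.root l ∈ S := by
  obtain ⟨v, hv⟩ := hS
  obtain ⟨l, hl⟩ := hend (G.component v)
  refine ⟨l, ?_⟩
  have := Quot.eqvGen_exact hl
  have key : ∀ u w : G.V, Relation.EqvGen (fun u v : G.V => ∃ e, G.src e = u ∧ G.tgt e = v) u w →
      (u ∈ S ↔ w ∈ S) := by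
    intro u w huw
    induction huw with
    | rel u w h =>
      obtain ⟨e, rfl, rfl⟩ := h
      exact ⟨fun h => hcl e false h, fun h => hcl e true h⟩
    | refl u => exact Iff.rfl
    | symm u w _ ih => exact ih.symm
    | trans u w x _ _ ih1 ih2 => exact ih1.trans ih2
  exact (key _ _ this).2 hv

end PuncturedGraph

/-- The extension of an integral functional to real vectors. -/
def extend (ψ : (Fin 3 → ℤ) →+ ℤ) (p : Fin 3 → ℝ) : ℝ := ∑ j, (ψ (Pi.single j 1) : ℝ) * p j

theorem extend_cast (ψ : (Fin 3 → ℤ) →+ ℤ) (v : Fin 3 → ℤ) :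
    extend ψ (fun j => (v j : ℝ)) = ψ v := by
  have hv : v = ∑ j, v j • (Pi.single j 1 : Fin 3 → ℤ) := by
    funext k
    simp [Finset.sum_apply, Pi.single_apply]
  conv_rhs => rw [hv]
  rw [map_sum]
  simp only [map_zsmul, extend]
  push_cast
  refine Finset.sum_congr rfl fun j _ => ?_
  simp [mul_comm]

theorem extend_line (ψ : (Fin 3 → ℤ) →+ ℤ) (p v : Fin 3 → ℝ) (t : ℝ) :
    extend ψ (fun j => p j + t * v j) = extend ψ p + t * extend ψ v := by
  simp only [extend, Finset.mul_sum, ← Finset.sum_add_distrib]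
  refine Finset.sum_congr rfl fun j _ => ?_
  ring

/-- A coordinate as an additive map. -/
def coordHom (j : Fin 3) : (Fin 3 → ℤ) →+ ℤ := Pi.evalAddMonoidHom (fun _ => ℤ) j

theorem extend_coordHom (j : Fin 3) (p : Fin 3 → ℝ) : extend (coordHom j) p = p j := by
  simp [extend, coordHom, Pi.single_apply]

theorem extend_neg (ψ : (Fin 3 → ℤ) →+ ℤ) (p : Fin 3 → ℝ) :
    extend (-ψ) p = -extend ψ p := by
  simp [extend]

namespace TropicalMorphism

variable (h : TropicalMorphism)

theorem flagDir_opp (e : h.E) (b : Bool) :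
    h.flagDir (.inl (e, !b)) = -h.flagDir (.inl (e, b)) := by
  cases b <;> simp [flagDir, PuncturedGraph.flagVec]

theorem pos_opp (e : h.E) (b : Bool) (i : Fin 3) :
    h.pos (h.base (.inl (e, !b))) i =
      h.pos (h.base (.inl (e, b))) i + h.len e * (h.flagDir (.inl (e, b)) i : ℝ) := by
  cases b
  · exact h.affine e i
  · have := h.affine e i
    simp only [Bool.not_true, PuncturedGraph.base, flagDir, PuncturedGraph.flagVec, Pi.neg_apply,
      Int.cast_neg] at *
    linarith

theorem pos_opp' (e : h.E) (b : Bool) :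
    h.pos (h.base (.inl (e, !b))) =
      fun i => h.pos (h.base (.inl (e, b))) i + h.len e * (h.flagDir (.inl (e, b)) i : ℝ) :=
  funext (h.pos_opp e b)

theorem extend_opp (ψ : (Fin 3 → ℤ) →+ ℤ) (e : h.E) (b : Bool) :
    extend ψ (h.pos (h.base (.inl (e, !b)))) =
      extend ψ (h.pos (h.base (.inl (e, b)))) + h.len e * ψ (h.flagDir (.inl (e, b))) := by
  rw [h.pos_opp' e b, extend_line, extend_cast]

/-! ### Flux through the boundary of a set of vertices -/

open Classical in
/-- The flux of an edge out of a set of vertices. -/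
def edgeFlux (S : Set h.V) (ψ : (Fin 3 → ℤ) →+ ℤ) (e : h.E) : ℤ :=
  (if h.src e ∈ S then ψ (h.dir e) else 0) - (if h.tgt e ∈ S then ψ (h.dir e) else 0)

-- Sum the balancing condition over `S`: the two flags of an edge inside `S` cancel, so only the
-- edges leaving `S` and the ends rooted in `S` survive.
open Classical in
theorem sum_flux (S : Set h.V) (ψ : (Fin 3 → ℤ) →+ ℤ) :
    ∑ e, h.edgeFlux S ψ e + ∑ l, (if h.root l ∈ S then ψ (h.endDir l) else 0) = 0 := by
  have h1 := h.sum_sum_flagsAt (fun v => v ∈ S) (fun f => ψ (h.flagDir f))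
  have h2 : ∀ v, ∑ f ∈ h.flagsAt v, ψ (h.flagDir f) = 0 := by
    intro v
    rw [← map_sum]
    have := h.balanced v
    unfold flagDir
    rw [this, map_zero]
  simp only [h2, Finset.sum_const_zero] at h1
  rw [Finset.sum_filter, PuncturedGraph.sum_flag] at h1
  refine Eq.trans ?_ h1.symm
  congr 1
  refine Finset.sum_congr rfl fun e _ => ?_
  simp only [edgeFlux, PuncturedGraph.base, flagDir, PuncturedGraph.flagVec, map_neg]
  by_cases h3 : h.src e ∈ S <;> by_cases h4 : h.tgt e ∈ S <;> simp [h3, h4]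

theorem edgeFlux_of_mem_of_notMem {S : Set h.V} (ψ : (Fin 3 → ℤ) →+ ℤ) {e : h.E} {b : Bool}
    (h1 : h.base (.inl (e, b)) ∈ S) (h2 : h.base (.inl (e, !b)) ∉ S) :
    h.edgeFlux S ψ e = ψ (h.flagDir (.inl (e, b))) := by
  cases b <;>
    simp_all [edgeFlux, PuncturedGraph.base, flagDir, PuncturedGraph.flagVec]

theorem edgeFlux_eq_zero {S : Set h.V} (ψ : (Fin 3 → ℤ) →+ ℤ) {e : h.E}
    (h1 : h.src e ∈ S ↔ h.tgt e ∈ S) : h.edgeFlux S ψ e = 0 := by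
  unfold edgeFlux
  by_cases h2 : h.src e ∈ S
  · simp [h2, h1.1 h2]
  · simp [h2, mt h1.2 h2]

theorem edgeFlux_nonpos {S : Set h.V} {ψ : (Fin 3 → ℤ) →+ ℤ}
    (hb : ∀ e b, h.base (.inl (e, b)) ∈ S → h.base (.inl (e, !b)) ∉ S →
      ψ (h.flagDir (.inl (e, b))) ≤ 0) (e : h.E) : h.edgeFlux S ψ e ≤ 0 := by
  by_cases h1 : h.src e ∈ S <;> by_cases h2 : h.tgt e ∈ S
  · exact (h.edgeFlux_eq_zero ψ (by tauto)).le
  · rw [h.edgeFlux_of_mem_of_notMem ψ (e := e) (b := false) h1 h2]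
    exact hb e false h1 h2
  · rw [h.edgeFlux_of_mem_of_notMem ψ (e := e) (b := true) h2 h1]
    exact hb e true h2 h1
  · exact (h.edgeFlux_eq_zero ψ (by tauto)).le

/-- Nonpositive terms with sum zero all vanish. The maximum principles below apply this to
superlevel sets, whose boundary edges all descend. -/
theorem flux_eq_zero {S : Set h.V} {ψ : (Fin 3 → ℤ) →+ ℤ}
    (hb : ∀ e b, h.base (.inl (e, b)) ∈ S → h.base (.inl (e, !b)) ∉ S →
      ψ (h.flagDir (.inl (e, b))) ≤ 0)
    (hl : ∀ l, h.root l ∈ S → ψ (h.endDir l) ≤ 0) :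
    (∀ e b, h.base (.inl (e, b)) ∈ S → h.base (.inl (e, !b)) ∉ S →
      ψ (h.flagDir (.inl (e, b))) = 0) ∧ ∀ l, h.root l ∈ S → ψ (h.endDir l) = 0 := by
  classical
  have hsum := h.sum_flux S ψ
  have t1 : ∀ e ∈ Finset.univ, h.edgeFlux S ψ e ≤ 0 := fun e _ => h.edgeFlux_nonpos hb e
  have t2 : ∀ l ∈ Finset.univ, (if h.root l ∈ S then ψ (h.endDir l) else 0) ≤ 0 := by
    intro l _
    split_ifs with hh
    · exact hl l hh
    · exact le_rfl
  have s1 := Finset.sum_nonpos t1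
  have s2 := Finset.sum_nonpos t2
  have e1 := (Finset.sum_eq_zero_iff_of_nonpos t1).1 (by linarith)
  have e2 := (Finset.sum_eq_zero_iff_of_nonpos t2).1 (by linarith)
  refine ⟨fun e b hb1 hb2 => ?_, fun l hl1 => ?_⟩
  · rw [← h.edgeFlux_of_mem_of_notMem ψ hb1 hb2]
    exact e1 e (Finset.mem_univ _)
  · simpa [hl1] using e2 l (Finset.mem_univ _)

/-! ### Maximum principles -/

/-- A discrete Neumann problem: ψ is harmonic on `S` with zero flux through the boundary and the
ends, hence constant along the edges. A descending edge would carry nonzero flux out of the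
superlevel set above its lower endpoint. -/
theorem dir_eq_zero_of_boundary (hlen : ∀ e, 0 < h.len e) {S : Set h.V} (ψ : (Fin 3 → ℤ) →+ ℤ)
    (hb : ∀ e b, h.base (.inl (e, b)) ∈ S → h.base (.inl (e, !b)) ∉ S →
      ψ (h.flagDir (.inl (e, b))) = 0)
    (hl : ∀ l, h.root l ∈ S → ψ (h.endDir l) = 0) {e : h.E} {b : Bool} (he : h.base (.inl (e, b)) ∈ S) :
    ψ (h.flagDir (.inl (e, b))) = 0 := by
  by_contra hne
  have he' : h.base (.inl (e, !b)) ∈ S := by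
    by_contra hc
    exact hne (hb e b he hc)
  wlog hneg : ψ (h.flagDir (.inl (e, b))) < 0 generalizing b
  · refine this (b := !b) he' ?_ ?_ ?_
    · rw [h.flagDir_opp, map_neg]
      exact neg_ne_zero.2 hne
    · rwa [Bool.not_not]
    · rw [h.flagDir_opp, map_neg]
      rcases lt_or_gt_of_ne hne with h1 | h1
      · exact absurd h1 hneg
      · linarith
  set u : h.V → ℝ := fun v => extend ψ (h.pos v) with hu
  set c := u (h.base (.inl (e, !b))) with hc
  have key : ∀ e b, h.base (.inl (e, b)) ∈ {v | v ∈ S ∧ c < u v} →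
      h.base (.inl (e, !b)) ∉ {v | v ∈ S ∧ c < u v} → ψ (h.flagDir (.inl (e, b))) ≤ 0 := by
    rintro e b ⟨h1, h2⟩ h3
    by_cases h4 : h.base (.inl (e, !b)) ∈ S
    · have h5 : ¬ c < u (h.base (.inl (e, !b))) := fun h6 => h3 ⟨h4, h6⟩
      by_contra h6
      push Not at h6
      have h7 := h.extend_opp ψ e b
      have : 0 < h.len e * (ψ (h.flagDir (.inl (e, b))) : ℝ) :=
        mul_pos (hlen e) (by exact_mod_cast h6)
      apply h5
      simp only [hu] at h2 ⊢
      linarith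
    · exact (hb e b h1 h4).le
  have := (h.flux_eq_zero (S := {v | v ∈ S ∧ c < u v}) (ψ := ψ) key
    (fun l hl1 => (hl l hl1.1).le)).1 e b ⟨he, ?_⟩ (fun h1 => lt_irrefl _ h1.2)
  · exact hne this
  · have h7 := h.extend_opp ψ e b
    have : h.len e * (ψ (h.flagDir (.inl (e, b))) : ℝ) < 0 :=
      mul_neg_of_pos_of_neg (hlen e) (by exact_mod_cast hneg)
    simp only [hc, hu]
    linarith

/-- If the bound failed, every boundary edge of the superlevel set above `c` would descend strictly.
The total flux is zero, so that set has no boundary edge; it is then closed under adjacency and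
contains the root of an end. -/
theorem extend_le_of_boundary (hlen : ∀ e, 0 < h.len e)
    (hend : ∀ c : h.Component, ∃ l : h.Λ, h.component (h.root l) = c) {S : Set h.V}
    (ψ : (Fin 3 → ℤ) →+ ℤ) (c : ℝ)
    (hb : ∀ e b, h.base (.inl (e, b)) ∈ S → h.base (.inl (e, !b)) ∉ S →
      extend ψ (h.pos (h.base (.inl (e, !b)))) ≤ c)
    (hl : ∀ l, h.root l ∉ S) {v : h.V} (hv : v ∈ S) : extend ψ (h.pos v) ≤ c := by
  by_contra hc
  push Not at hc
  set S' : Set h.V := {v | v ∈ S ∧ c < extend ψ (h.pos v)} with hS'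
  have key : ∀ e b, h.base (.inl (e, b)) ∈ S' → h.base (.inl (e, !b)) ∉ S' →
      ψ (h.flagDir (.inl (e, b))) < 0 := by
    rintro e b ⟨h1, h2⟩ h3
    have h4 : extend ψ (h.pos (h.base (.inl (e, !b)))) ≤ c := by
      by_cases h4 : h.base (.inl (e, !b)) ∈ S
      · by_contra h5
        push Not at h5
        exact h3 ⟨h4, h5⟩
      · exact hb e b h1 h4
    have h7 := h.extend_opp ψ e b
    have : h.len e * (ψ (h.flagDir (.inl (e, b))) : ℝ) < 0 := by linarith
    by_contra h8
    push Not at h8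
    have : 0 ≤ h.len e * (ψ (h.flagDir (.inl (e, b))) : ℝ) :=
      mul_nonneg (hlen e).le (by exact_mod_cast h8)
    linarith
  have h1 := (h.flux_eq_zero (S := S') (ψ := ψ) (fun e b h1 h2 => (key e b h1 h2).le)
    (fun l hl1 => absurd hl1.1 (hl l))).1
  obtain ⟨l, hl1⟩ := h.exists_root_mem_of_closed hend (S := S') ⟨v, hv, hc⟩ (by
    intro e b h2
    by_contra h3
    exact (key e b h2 h3).ne (h1 e b h2 h3))
  exact hl l hl1.1

/-- The slopes of a curve are bounded by those of its ends. -/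
theorem flagDir_le (hlen : ∀ e, 0 < h.len e) (ψ : (Fin 3 → ℤ) →+ ℤ) (e : h.E) (b : Bool) :
    ψ (h.flagDir (.inl (e, b))) ≤ ∑ l, |ψ (h.endDir l)| := by
  classical
  have hnn : 0 ≤ ∑ l, |ψ (h.endDir l)| := Finset.sum_nonneg fun l _ => abs_nonneg _
  by_contra hlt
  push Not at hlt
  have hpos : 0 < ψ (h.flagDir (.inl (e, b))) := lt_of_le_of_lt hnn hlt
  set u : h.V → ℝ := fun v => extend ψ (h.pos v) with hu
  -- All boundary edges of this superlevel set descend, and `e` is one of them, so the slope of `e`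
  -- is at most what the ends rooted in the set carry.
  set S : Set h.V := {v | u (h.base (.inl (e, b))) < u v} with hS
  have hb : ∀ e b, h.base (.inl (e, b)) ∈ S → h.base (.inl (e, !b)) ∉ S →
      ψ (h.flagDir (.inl (e, b))) ≤ 0 := by
    intro e b h1 h2
    by_contra h6
    push Not at h6
    have h7 := h.extend_opp ψ e b
    have : 0 < h.len e * (ψ (h.flagDir (.inl (e, b))) : ℝ) :=
      mul_pos (hlen e) (by exact_mod_cast h6)
    apply h2
    simp only [hS, hu, Set.mem_ofPred_eq] at h1 ⊢
    linarith
  have hsum := h.sum_flux S ψ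
  have h1 : h.base (.inl (e, !b)) ∈ S := by
    have h7 := h.extend_opp ψ e b
    have : 0 < h.len e * (ψ (h.flagDir (.inl (e, b))) : ℝ) :=
      mul_pos (hlen e) (by exact_mod_cast hpos)
    simp only [hS, hu, Set.mem_ofPred_eq]
    linarith
  have h2 : h.base (.inl (e, !(!b))) ∉ S := by
    rw [Bool.not_not]
    exact lt_irrefl (u _)
  have h3 := h.edgeFlux_of_mem_of_notMem ψ h1 h2
  rw [h.flagDir_opp, map_neg] at h3
  have h4 : ∑ e', h.edgeFlux S ψ e' ≤ h.edgeFlux S ψ e := by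
    rw [← Finset.add_sum_erase _ _ (Finset.mem_univ e)]
    have := Finset.sum_nonpos (s := Finset.univ.erase e)
      (fun e' _ => h.edgeFlux_nonpos hb e')
    linarith
  have h5 : ∑ l, (if h.root l ∈ S then ψ (h.endDir l) else 0) ≤ ∑ l, |ψ (h.endDir l)| := by
    refine Finset.sum_le_sum fun l _ => ?_
    split_ifs
    · exact le_abs_self _
    · exact abs_nonneg _
  linarith

/-! ### Tight curves in the surface -/

/-- A morphism without degenerate edges whose image lies in `X`, whose ends are not parallel to
`L` and such that every component has an end. -/
structure IsTight : Prop where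
  len_pos : ∀ e, 0 < h.len e
  eval_mem : ∀ x, h.eval x ∈ surfaceX
  exists_end : ∀ c : h.Component, ∃ l : h.Λ, h.component (h.root l) = c
  endDir_mem : ∀ l, h.endDir l ∈ surfaceX
  endDir_notMem : ∀ l, h.endDir l ∉ lineL

/-- The height of a vertex. -/
def ht (v : h.V) : ℝ := hgt (h.pos v)

theorem ht_opp (e : h.E) (b : Bool) :
    h.ht (h.base (.inl (e, !b))) =
      h.ht (h.base (.inl (e, b))) + h.len e * (hgt (h.flagDir (.inl (e, b))) : ℤ) := by
  unfold ht
  rw [h.pos_opp' e b, hgt_line, hgt_cast]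

/-- An edge is up if it lies in the first two faces, and is not contracted or contained in `L`. -/
def Up : h.Edge → Prop
  | .inl e => h.dir e ≠ 0 ∧ (0 < h.ht (h.src e) ∨ 0 < h.ht (h.tgt e))
  | .inr l => 0 < hgt (h.endDir l)

/-- An edge is down if it lies in the third face, and is not contracted or contained in `L`. -/
def Down : h.Edge → Prop
  | .inl e => h.dir e ≠ 0 ∧ (h.ht (h.src e) < 0 ∨ h.ht (h.tgt e) < 0)
  | .inr l => hgt (h.endDir l) < 0

/-- An edge is silent if it is contracted or contained in `L`. -/
def Silent : h.Edge → Prop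
  | .inl e => h.dir e = 0 ∨ (h.ht (h.src e) = 0 ∧ h.ht (h.tgt e) = 0)
  | .inr _ => False

theorem flagDir_eq_zero_iff (e : h.E) (b : Bool) :
    h.flagDir (.inl (e, b)) = 0 ↔ h.dir e = 0 := by
  cases b <;> simp [flagDir, PuncturedGraph.flagVec]

theorem up_iff (e : h.E) (b : Bool) : h.Up (.inl e) ↔ h.flagDir (.inl (e, b)) ≠ 0 ∧
    (0 < h.ht (h.base (.inl (e, b))) ∨ 0 < h.ht (h.base (.inl (e, !b)))) := by
  rw [Ne, flagDir_eq_zero_iff]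
  cases b <;> simp [Up, PuncturedGraph.base, or_comm]

theorem down_iff (e : h.E) (b : Bool) : h.Down (.inl e) ↔ h.flagDir (.inl (e, b)) ≠ 0 ∧
    (h.ht (h.base (.inl (e, b))) < 0 ∨ h.ht (h.base (.inl (e, !b))) < 0) := by
  rw [Ne, flagDir_eq_zero_iff]
  cases b <;> simp [Down, PuncturedGraph.base, or_comm]

theorem silent_iff (e : h.E) (b : Bool) : h.Silent (.inl e) ↔ h.flagDir (.inl (e, b)) = 0 ∨
    (h.ht (h.base (.inl (e, b))) = 0 ∧ h.ht (h.base (.inl (e, !b))) = 0) := by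
  rw [flagDir_eq_zero_iff]
  cases b <;> simp [Silent, PuncturedGraph.base, and_comm]

namespace IsTight

variable {h} (ht : h.IsTight)
include ht

theorem pos_mem (v : h.V) : h.pos v ∈ surfaceX := ht.eval_mem (.vertex v)

theorem mem_lineL_iff (v : h.V) : h.pos v ∈ lineL ↔ h.ht v = 0 :=
  mem_lineL_iff_of_mem_surfaceX (ht.pos_mem v)

theorem exists_root_mem_of_closed {S : Set h.V} (hS : S.Nonempty)
    (hcl : ∀ e b, h.base (.inl (e, b)) ∈ S → h.base (.inl (e, !b)) ∈ S) : ∃ l, h.root l ∈ S :=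
  h.toPuncturedGraph.exists_root_mem_of_closed ht.exists_end hS hcl

theorem flag_line_mem (e : h.E) (b : Bool) {t : ℝ} (h0 : 0 ≤ t) (h1 : t ≤ h.len e) :
    (fun j => h.pos (h.base (.inl (e, b))) j + t * (h.flagDir (.inl (e, b)) j : ℝ)) ∈
      surfaceX := by
  rcases h0.eq_or_lt with rfl | h0
  · simpa using ht.pos_mem _
  rcases h1.eq_or_lt with rfl | h1
  · rw [← h.pos_opp' e b]
    exact ht.pos_mem _
  have hl := ht.len_pos e
  cases b
  · have := ht.eval_mem (.inner e ⟨t / h.len e, by positivity, (div_lt_one hl).2 h1⟩)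
    convert this using 1
    funext j
    simp only [eval, flagDir, PuncturedGraph.flagVec, PuncturedGraph.base]
    field_simp
  · have := ht.eval_mem (.inner e ⟨1 - t / h.len e, by linarith [(div_lt_one hl).2 h1],
      by linarith [div_pos h0 hl]⟩)
    convert this using 1
    funext j
    simp only [eval, flagDir, PuncturedGraph.flagVec, PuncturedGraph.base]
    rw [h.affine e j, Pi.neg_apply]
    push_cast
    field_simp
    ring

theorem end_line_mem (l : h.Λ) {t : ℝ} (h0 : 0 ≤ t) :
    (fun j => h.pos (h.root l) j + t * (h.endDir l j : ℝ)) ∈ surfaceX := by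
  rcases h0.eq_or_lt with rfl | h0
  · simpa using ht.pos_mem _
  · exact ht.eval_mem (.ray l ⟨t, h0⟩)

theorem flagDir_mem_plane {e : h.E} {b : Bool} {i : Fin 3}
    (hi : h.pos (h.base (.inl (e, b))) ∈ face i) (hL : h.ht (h.base (.inl (e, b))) ≠ 0) :
    h.flagDir (.inl (e, b)) ∈ plane i :=
  cast_mem_plane.1 (mem_face_of_line (ht.len_pos e) hi
    (fun hc => hL ((ht.mem_lineL_iff _).1 hc))
    (fun _ h1 => ht.flag_line_mem e b h1.1 h1.2)).1

theorem opp_mem_face {e : h.E} {b : Bool} {i : Fin 3}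
    (hi : h.pos (h.base (.inl (e, b))) ∈ face i) (hL : h.ht (h.base (.inl (e, b))) ≠ 0) :
    h.pos (h.base (.inl (e, !b))) ∈ face i := by
  rw [h.pos_opp' e b]
  exact (mem_face_of_line (ht.len_pos e) hi
    (fun hc => hL ((ht.mem_lineL_iff _).1 hc))
    (fun _ h1 => ht.flag_line_mem e b h1.1 h1.2)).2 _ ⟨(ht.len_pos e).le, le_rfl⟩

theorem endDir_mem_face {l : h.Λ} {i : Fin 3}
    (hi : h.pos (h.root l) ∈ face i) (hL : h.ht (h.root l) ≠ 0) : h.endDir l ∈ face i :=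
  mem_face_of_mem_plane (cast_mem_plane.1 (mem_face_of_line one_pos hi
    (fun hc => hL ((ht.mem_lineL_iff _).1 hc))
    (fun _ h1 => ht.end_line_mem l h1.1)).1) (ht.endDir_mem l)

theorem flagDir_mem_surfaceX {f : h.Flag} (h0 : h.ht (h.base f) = 0) :
    h.flagDir f ∈ surfaceX := by
  rcases f with ⟨e, b⟩ | l
  · exact cast_mem_surfaceX.1 (mem_surfaceX_of_line (ht.len_pos e) ((ht.mem_lineL_iff _).2 h0)
      (ht.flag_line_mem e b (ht.len_pos e).le le_rfl))
  · exact ht.endDir_mem l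

theorem exists_face (v : h.V) : ∃ i, h.pos v ∈ face i :=
  mem_surfaceX_iff_exists_face.1 (ht.pos_mem v)

omit ht in
theorem _root_.TropicalX.hgt_nonneg_or {R : Type*} [CommRing R] [LinearOrder R]
    [IsStrictOrderedRing R] (i : Fin 3) :
    (∀ p : Fin 3 → R, p ∈ face i → 0 ≤ hgt p) ∨ (∀ p : Fin 3 → R, p ∈ face i → hgt p ≤ 0) := by
  fin_cases i
  · exact Or.inl fun p hp => (mem_face_zero.1 hp).2
  · exact Or.inl fun p hp => (mem_face_one.1 hp).2
  · exact Or.inr fun p hp => (mem_face_two.1 hp).2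

theorem ht_opp_nonneg {e : h.E} {b : Bool} (h0 : 0 < h.ht (h.base (.inl (e, b)))) :
    0 ≤ h.ht (h.base (.inl (e, !b))) := by
  obtain ⟨i, hi⟩ := ht.exists_face (h.base (.inl (e, b)))
  have hj := ht.opp_mem_face hi h0.ne'
  rcases hgt_nonneg_or (R := ℝ) i with h1 | h1
  · exact h1 _ hj
  · exact absurd (h1 _ hi) (not_le.2 h0)

theorem ht_opp_nonpos {e : h.E} {b : Bool} (h0 : h.ht (h.base (.inl (e, b))) < 0) :
    h.ht (h.base (.inl (e, !b))) ≤ 0 := by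
  obtain ⟨i, hi⟩ := ht.exists_face (h.base (.inl (e, b)))
  have hj := ht.opp_mem_face hi h0.ne
  rcases hgt_nonneg_or (R := ℝ) i with h1 | h1
  · exact absurd (h1 _ hi) (not_le.2 h0)
  · exact h1 _ hj

theorem hgt_endDir_ne (l : h.Λ) : hgt (h.endDir l) ≠ 0 := fun hc =>
  ht.endDir_notMem l ((mem_lineL_iff_of_mem_surfaceX (ht.endDir_mem l)).2 hc)

theorem hgt_endDir_pos {l : h.Λ} (h0 : 0 < h.ht (h.root l)) : 0 < hgt (h.endDir l) := by
  obtain ⟨i, hi⟩ := ht.exists_face (h.root l)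
  have hj := ht.endDir_mem_face hi h0.ne'
  refine lt_of_le_of_ne ?_ (ht.hgt_endDir_ne l).symm
  fin_cases i
  · exact (mem_face_zero.1 hj).2
  · exact (mem_face_one.1 hj).2
  · exact absurd (mem_face_two.1 hi).2 (not_le.2 h0)

theorem hgt_endDir_neg {l : h.Λ} (h0 : h.ht (h.root l) < 0) : hgt (h.endDir l) < 0 := by
  obtain ⟨i, hi⟩ := ht.exists_face (h.root l)
  have hj := ht.endDir_mem_face hi h0.ne
  refine lt_of_le_of_ne ?_ (ht.hgt_endDir_ne l)
  fin_cases i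
  · exact absurd (mem_face_zero.1 hi).2 (not_le.2 h0)
  · exact absurd (mem_face_one.1 hi).2 (not_le.2 h0)
  · exact (mem_face_two.1 hj).2

/-- Every edge is up, down or silent. -/
theorem up_or_down_or_silent (ε : h.Edge) : h.Up ε ∨ h.Down ε ∨ h.Silent ε := by
  rcases ε with e | l
  · by_cases h0 : h.dir e = 0
    · exact Or.inr (Or.inr (Or.inl h0))
    · rcases lt_trichotomy (h.ht (h.src e)) 0 with h1 | h1 | h1 <;>
        rcases lt_trichotomy (h.ht (h.tgt e)) 0 with h2 | h2 | h2 <;>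
        simp_all [Up, Down, Silent]
  · rcases lt_or_gt_of_ne (ht.hgt_endDir_ne l) with h1 | h1
    · exact Or.inr (Or.inl h1)
    · exact Or.inl h1

theorem not_down_of_up {ε : h.Edge} (hu : h.Up ε) : ¬ h.Down ε := by
  rcases ε with e | l
  · rintro ⟨-, h2⟩
    have a1 := fun h0 => ht.ht_opp_nonneg (e := e) (b := false) h0
    have a2 := fun h0 => ht.ht_opp_nonneg (e := e) (b := true) h0
    simp only [PuncturedGraph.base, Bool.not_true, Bool.not_false] at a1 a2
    rcases hu.2 with h1 | h1 <;> rcases h2 with h2 | h2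
    · linarith
    · linarith [a1 h1]
    · linarith [a2 h1]
    · linarith
  · exact not_lt.2 (le_of_lt hu)

omit ht in
theorem not_silent_of_up {ε : h.Edge} (hu : h.Up ε) : ¬ h.Silent ε := by
  rcases ε with e | l
  · rintro (h1 | ⟨h1, h2⟩)
    · exact hu.1 h1
    · rcases hu.2 with h3 | h3
      · exact h3.ne' h1
      · exact h3.ne' h2
  · exact id

omit ht in
theorem not_silent_of_down {ε : h.Edge} (hu : h.Down ε) : ¬ h.Silent ε := by
  rcases ε with e | l
  · rintro (h1 | ⟨h1, h2⟩)
    · exact hu.1 h1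
    · rcases hu.2 with h3 | h3
      · exact h3.ne h1
      · exact h3.ne h2
  · exact id

/-- At a vertex on `L` the kind of an edge is determined by the height of its direction. -/
theorem up_iff_of_ht_eq_zero {f : h.Flag} (h0 : h.ht (h.base f) = 0) :
    h.Up (h.edgeOf f) ↔ 0 < hgt (h.flagDir f) := by
  rcases f with ⟨e, b⟩ | l
  · have h1 := h.ht_opp e b
    have hl := ht.len_pos e
    show h.Up (.inl e) ↔ _
    rw [h.up_iff e b, h0, h1, h0, zero_add]
    simp only [lt_irrefl, false_or, mul_pos_iff_of_pos_left hl, Int.cast_pos]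
    exact ⟨fun h => h.2, fun h2 => ⟨fun h3 => by simp [h3] at h2, h2⟩⟩
  · exact Iff.rfl

theorem down_iff_of_ht_eq_zero {f : h.Flag} (h0 : h.ht (h.base f) = 0) :
    h.Down (h.edgeOf f) ↔ hgt (h.flagDir f) < 0 := by
  rcases f with ⟨e, b⟩ | l
  · have h1 := h.ht_opp e b
    have hl := ht.len_pos e
    show h.Down (.inl e) ↔ _
    rw [h.down_iff e b, h0, h1, h0, zero_add]
    have hiff : ∀ x : ℤ, h.len e * (x : ℝ) < 0 ↔ x < 0 := fun x =>
      ⟨fun h2 => by exact_mod_cast (neg_of_mul_neg_left (by rwa [mul_comm] at h2) hl.le : (x : ℝ) < 0),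
        fun h2 => mul_neg_of_pos_of_neg hl (by exact_mod_cast h2)⟩
    simp only [lt_irrefl, false_or, hiff]
    exact ⟨fun h => h.2, fun h2 => ⟨fun h3 => by simp [h3] at h2, h2⟩⟩
  · exact Iff.rfl

theorem up_of_ht_pos {f : h.Flag} (h0 : 0 < h.ht (h.base f)) (hs : ¬ h.Silent (h.edgeOf f)) :
    h.Up (h.edgeOf f) := by
  rcases f with ⟨e, b⟩ | l
  · exact (h.up_iff e b).2 ⟨fun hc => hs ((h.silent_iff e b).2 (Or.inl hc)), Or.inl h0⟩
  · exact ht.hgt_endDir_pos h0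

omit ht in
theorem flagDir_eq_zero_of_silent {f : h.Flag} (h0 : h.ht (h.base f) ≠ 0)
    (hs : h.Silent (h.edgeOf f)) : h.flagDir f = 0 := by
  rcases f with ⟨e, b⟩ | l
  · rcases (h.silent_iff e b).1 hs with h1 | h1
    · exact h1
    · exact absurd h1.1 h0
  · exact hs.elim

end IsTight

end TropicalMorphism

/-! ### The linear system of moments and its dual -/

/-- A linear map between coordinate spaces is surjective if its transpose is injective. -/
theorem surjective_of_dual {α β : Type*} [Fintype β]
    (Ψ : (α → ℝ) →ₗ[ℝ] (β → ℝ)) (hd : ∀ y : β → ℝ, (∀ x, ∑ b, y b * Ψ x b = 0) → y = 0) :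
    Function.Surjective Ψ := by
  classical
  rw [← LinearMap.range_eq_top]
  by_contra hne
  -- A proper range is annihilated by a nonzero functional, which is the pairing with a vector `y`.
  obtain ⟨f, hf, hle⟩ := Submodule.exists_le_ker_of_lt_top _ (lt_top_iff_ne_top.2 hne)
  have hrep : ∀ z : β → ℝ, f z = ∑ b, f (Pi.single b 1) * z b := by
    intro z
    conv_lhs => rw [← Finset.univ_sum_single z]
    rw [map_sum]
    refine Finset.sum_congr rfl fun b _ => ?_
    have : (Pi.single b (z b) : β → ℝ) = z b • Pi.single b 1 := by
      rw [← Pi.single_smul, smul_eq_mul, mul_one]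
    rw [this, map_smul, smul_eq_mul, mul_comm]
  have h0 := hd (fun b => f (Pi.single b 1)) (fun x => by
    rw [← hrep]
    exact LinearMap.mem_ker.1 (hle (LinearMap.mem_range_self Ψ x)))
  apply hf
  ext b
  simpa using congrFun h0 b

/-- The plane vector of an integral direction. -/
def pdir (v : Fin 3 → ℤ) : ℝ × ℝ := ((v 0 : ℝ), ((hgt v : ℤ) : ℝ))

/-- The moment of a direction at a point of the plane. -/
def mom (v : Fin 3 → ℤ) (P : ℝ × ℝ) : ℝ := (v 0 : ℝ) * P.2 - ((hgt v : ℤ) : ℝ) * P.1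

theorem mom_neg (v : Fin 3 → ℤ) (P : ℝ × ℝ) : mom (-v) P = -mom v P := by
  simp [mom]; ring

@[simp] theorem mom_zero (P : ℝ × ℝ) : mom 0 P = 0 := by simp [mom]

/-- The moment is the determinant of `pdir v` and `P`, so it depends only on the line through `P` in
direction `v`. This is what makes it an invariant of an edge. -/
theorem mom_add_smul_self (v : Fin 3 → ℤ) (P : ℝ × ℝ) (a : ℝ) :
    mom v (P + a • pdir v) = mom v P := by
  simp [mom, pdir]; ring

theorem mom_sub (v : Fin 3 → ℤ) (P Q : ℝ × ℝ) : mom v (P - Q) = mom v P - mom v Q := by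
  simp [mom]; ring

namespace TropicalMorphism

variable (h : TropicalMorphism)

/-- The sign of a flag. -/
def sgn : h.Flag → ℝ
  | .inl (_, false) => 1
  | .inl (_, true) => -1
  | .inr _ => 1

/-- A vertex is active if some edge at it is not silent. -/
def Active (v : h.V) : Prop := ∃ f, h.base f = v ∧ ¬ h.Silent (h.edgeOf f)

/-- The up edges. -/
abbrev UpEdge : Type := {ε : h.Edge // h.Up ε}

/-- The active vertices in the first two faces, off `L`. -/
abbrev InnerVertex : Type := {v : h.V // 0 < h.ht v ∧ h.Active v}

/-- The active vertices on `L`. -/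
abbrev LineVertex : Type := {v : h.V // h.ht v = 0 ∧ h.Active v}

/-- The up flags at vertices on `L`. -/
abbrev LineFlag : Type := {f : h.Flag // h.ht (h.base f) = 0 ∧ h.Up (h.edgeOf f)}

/-- The unknowns: moments of the up edges and positions of the vertices on `L`. -/
abbrev Unknown : Type := h.UpEdge ⊕ h.LineVertex

/-- The equations: balancing at the inner vertices, and compatibility at flags on `L`. -/
abbrev Equation : Type := h.InnerVertex ⊕ h.LineFlag

open Classical in
/-- Extension by zero of the moments. -/
def edgePart (x : h.Unknown → ℝ) (ε : h.Edge) : ℝ := if hu : h.Up ε then x (.inl ⟨ε, hu⟩) else 0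

open Classical in
/-- Extension by zero of the positions on `L`. -/
def linePart (x : h.Unknown → ℝ) (v : h.V) : ℝ :=
  if hv : h.ht v = 0 ∧ h.Active v then x (.inr ⟨v, hv⟩) else 0

theorem edgePart_add (x y : h.Unknown → ℝ) (ε : h.Edge) :
    h.edgePart (x + y) ε = h.edgePart x ε + h.edgePart y ε := by
  unfold edgePart; split_ifs <;> simp

theorem edgePart_smul (a : ℝ) (x : h.Unknown → ℝ) (ε : h.Edge) :
    h.edgePart (a • x) ε = a * h.edgePart x ε := by
  unfold edgePart; split_ifs <;> simp

theorem linePart_add (x y : h.Unknown → ℝ) (v : h.V) :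
    h.linePart (x + y) v = h.linePart x v + h.linePart y v := by
  unfold linePart; split_ifs <;> simp

theorem linePart_smul (a : ℝ) (x : h.Unknown → ℝ) (v : h.V) :
    h.linePart (a • x) v = a * h.linePart x v := by
  unfold linePart; split_ifs <;> simp

/-- The linear system satisfied by the moments of the edges in the first two faces. -/
def system : (h.Unknown → ℝ) →ₗ[ℝ] (h.Equation → ℝ) where
  toFun x := Sum.elim
    (fun v => ∑ f ∈ h.flagsAt v.1, h.sgn f * h.edgePart x (h.edgeOf f))
    -- At a point `(x, 0)` of L a direction `v` has moment `-hgt v * x`, hence the plus sign.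
    (fun f => h.sgn f.1 * h.edgePart x (h.edgeOf f.1) +
      (hgt (h.flagDir f.1) : ℤ) * h.linePart x (h.base f.1))
  map_add' x y := by
    funext b
    rcases b with v | f
    · simp [edgePart_add, mul_add, Finset.sum_add_distrib]
    · simp [edgePart_add, linePart_add]; ring
  map_smul' a x := by
    funext b
    rcases b with v | f
    · simp only [edgePart_smul, Sum.elim_inl, Pi.smul_apply, smul_eq_mul, Finset.mul_sum,
        RingHom.id_apply]
      exact Finset.sum_congr rfl fun f _ => by ring
    · simp [edgePart_smul, linePart_smul]; ring

open Classical in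
/-- Extension by zero of a multiplier on the inner vertices. -/
def innerMult (y : h.Equation → ℝ) (v : h.V) : ℝ :=
  if hv : 0 < h.ht v ∧ h.Active v then y (.inl ⟨v, hv⟩) else 0

open Classical in
/-- Extension by zero of a multiplier on the flags on `L`. -/
def lineMult (y : h.Equation → ℝ) (f : h.Flag) : ℝ :=
  if hf : h.ht (h.base f) = 0 ∧ h.Up (h.edgeOf f) then y (.inr ⟨f, hf⟩) else 0

/-- The potential of a flag defined by multipliers. -/
def pot (y : h.Equation → ℝ) (f : h.Flag) : ℝ := h.innerMult y (h.base f) + h.lineMult y f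

variable {h}

theorem innerMult_of_nonpos (y : h.Equation → ℝ) {v : h.V} (hv : h.ht v ≤ 0) :
    h.innerMult y v = 0 := by
  unfold innerMult
  rw [dif_neg (fun hc => absurd hc.1 (not_lt.2 hv))]

theorem pot_of_pos (y : h.Equation → ℝ) {f : h.Flag} (hf : 0 < h.ht (h.base f)) :
    h.pot y f = h.innerMult y (h.base f) := by
  unfold pot lineMult
  rw [dif_neg (fun hc => hf.ne' hc.1), add_zero]

theorem pot_of_zero (y : h.Equation → ℝ) {f : h.Flag} (hf : h.ht (h.base f) = 0) :
    h.pot y f = h.lineMult y f := by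
  unfold pot
  rw [innerMult_of_nonpos y hf.le, zero_add]

instance : Fintype h.UpEdge := by classical exact inferInstance
instance : Fintype h.InnerVertex := by classical exact inferInstance
instance : Fintype h.LineVertex := by classical exact inferInstance
instance : Fintype h.LineFlag := by classical exact inferInstance

theorem _root_.TropicalX.sum_subtype_eq_sum_dite {ι : Type*} [Fintype ι] (p : ι → Prop)
    [DecidablePred p] [Fintype {i // p i}] (F : {i // p i} → ℝ) :
    ∑ i, F i = ∑ i, if hi : p i then F ⟨i, hi⟩ else 0 := by
  have h1 : ∑ i ∈ Finset.univ.filter p, (if hi : p i then F ⟨i, hi⟩ else 0) =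
      ∑ i, if hi : p i then F ⟨i, hi⟩ else 0 :=
    Finset.sum_filter_of_ne fun i _ hne => by
      by_contra hc
      exact hne (dif_neg hc)
  rw [← h1, Finset.sum_subtype (p := p) _ (by simp)]
  exact Finset.sum_congr rfl fun i _ => by rw [dif_pos i.2]

/-- Summation by parts: regrouped by flags, the coefficient of each unknown in a combination of
equations becomes visible. -/
theorem sum_mul_system (y : h.Equation → ℝ) (x : h.Unknown → ℝ) :
    ∑ b, y b * h.system x b = ∑ f, h.pot y f * (h.sgn f * h.edgePart x (h.edgeOf f)) +
      ∑ f, h.lineMult y f * ((hgt (h.flagDir f) : ℤ) * h.linePart x (h.base f)) := by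
  classical
  rw [Fintype.sum_sum_type]
  have h1 : ∑ v : h.InnerVertex, y (.inl v) * h.system x (.inl v) =
      ∑ f, h.innerMult y (h.base f) * (h.sgn f * h.edgePart x (h.edgeOf f)) := by
    rw [sum_subtype_eq_sum_dite, ← h.sum_sum_flagsAt_univ]
    refine Finset.sum_congr rfl fun v _ => ?_
    rw [Finset.sum_congr rfl (g := fun f => h.innerMult y v *
      (h.sgn f * h.edgePart x (h.edgeOf f))) (fun f hf => by rw [h.mem_flagsAt.1 hf])]
    rw [← Finset.mul_sum]
    unfold innerMult
    split_ifs with hv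
    · rfl
    · simp
  have h2 : ∑ f : h.LineFlag, y (.inr f) * h.system x (.inr f) =
      ∑ f, h.lineMult y f * (h.sgn f * h.edgePart x (h.edgeOf f) +
        (hgt (h.flagDir f) : ℤ) * h.linePart x (h.base f)) := by
    rw [sum_subtype_eq_sum_dite]
    refine Finset.sum_congr rfl fun f _ => ?_
    unfold lineMult
    split_ifs with hv
    · rfl
    · simp
  rw [h1, h2]
  simp only [pot, mul_add, add_mul, Finset.sum_add_distrib]
  ring

/-- An edge enters the equations only through its two flags, with opposite signs; compare the
coefficients of its moment. For `ψ = 0` the potential is constant along up edges. -/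
theorem dual_edge {y : h.Equation → ℝ} {ψ : h.Unknown → ℝ}
    (hy : ∀ x : h.Unknown → ℝ, ∑ a, ψ a * x a = ∑ b, y b * h.system x b) {e : h.E}
    (he : h.Up (.inl e)) :
    h.pot y (.inl (e, false)) - h.pot y (.inl (e, true)) = ψ (.inl ⟨.inl e, he⟩) := by
  classical
  have h1 := hy (Pi.single (.inl ⟨.inl e, he⟩) 1)
  rw [sum_mul_system, h.sum_flag] at h1
  have e1 : ∀ ε, h.edgePart (Pi.single (.inl ⟨.inl e, he⟩) 1) ε =
      if ε = .inl e then 1 else 0 := by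
    intro ε
    unfold edgePart
    by_cases h2 : ε = .inl e
    · subst h2; simp [he]
    · simp [h2]
  have e2 : ∀ v, h.linePart (Pi.single (.inl ⟨.inl e, he⟩) 1) v = 0 := by
    intro v
    unfold linePart
    split_ifs <;> simp
  simp only [e1, e2] at h1
  simp only [Pi.single_apply, mul_ite, mul_one, mul_zero, Finset.sum_ite_eq', Finset.mem_univ,
    if_true, PuncturedGraph.edgeOf, Sum.inl.injEq, reduceCtorEq, if_false, Finset.sum_const_zero,
    add_zero, sgn] at h1
  rw [h1, Finset.sum_eq_single e]
  · simp; ring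
  · intro e' _ hne
    simp [hne]
  · simp

theorem dual_end {y : h.Equation → ℝ} {ψ : h.Unknown → ℝ}
    (hy : ∀ x : h.Unknown → ℝ, ∑ a, ψ a * x a = ∑ b, y b * h.system x b) {l : h.Λ}
    (he : h.Up (.inr l)) : h.pot y (.inr l) = ψ (.inl ⟨.inr l, he⟩) := by
  classical
  have h1 := hy (Pi.single (.inl ⟨.inr l, he⟩) 1)
  rw [sum_mul_system, h.sum_flag] at h1
  have e1 : ∀ ε, h.edgePart (Pi.single (.inl ⟨.inr l, he⟩) 1) ε =
      if ε = .inr l then 1 else 0 := by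
    intro ε
    unfold edgePart
    by_cases h2 : ε = .inr l
    · subst h2; simp [he]
    · simp [h2]
  have e2 : ∀ v, h.linePart (Pi.single (.inl ⟨.inr l, he⟩) 1) v = 0 := by
    intro v
    unfold linePart
    split_ifs <;> simp
  simp only [e1, e2] at h1
  simp only [Pi.single_apply, mul_ite, mul_one, mul_zero, Finset.sum_ite_eq', Finset.mem_univ,
    if_true, PuncturedGraph.edgeOf, Sum.inr.injEq, reduceCtorEq, if_false, Finset.sum_const_zero,
    add_zero, zero_add, sgn] at h1
  rw [h1]

/-- Compares the coefficients of the position of one vertex on L. This is the only relation that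
couples the two upper faces. -/
theorem dual_line {y : h.Equation → ℝ} {ψ : h.Unknown → ℝ}
    (hy : ∀ x : h.Unknown → ℝ, ∑ a, ψ a * x a = ∑ b, y b * h.system x b) (v : h.LineVertex) :
    ∑ f ∈ h.flagsAt v.1, h.lineMult y f * (hgt (h.flagDir f) : ℤ) = ψ (.inr v) := by
  classical
  have h1 := hy (Pi.single (.inr v) 1)
  rw [sum_mul_system] at h1
  have e1 : ∀ ε, h.edgePart (Pi.single (.inr v) 1) ε = 0 := by
    intro ε
    unfold edgePart
    split_ifs <;> simp
  have e2 : ∀ w, h.linePart (Pi.single (.inr v) 1) w = if w = v.1 then 1 else 0 := by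
    intro w
    unfold linePart
    by_cases h2 : w = v.1
    · subst h2
      rw [dif_pos v.2]
      simp
    · have h3 : ∀ hw, (⟨w, hw⟩ : h.LineVertex) ≠ v := fun hw hc => h2 (congrArg Subtype.val hc)
      simp [h2, h3]
  simp only [e1, e2] at h1
  simp only [Pi.single_apply, mul_ite, mul_one, mul_zero, Finset.sum_ite_eq', Finset.mem_univ,
    if_true, Finset.sum_const_zero, zero_add] at h1
  rw [h1, PuncturedGraph.flagsAt, Finset.sum_filter]

/-! ### Deformations -/

variable (h) in
/-- Infinitesimal deformations of a curve, seen through the projection to the plane. -/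
structure IsDeformation (P : h.V → ℝ × ℝ) : Prop where
  line : ∀ v, h.ht v = 0 → (P v).2 = 0
  -- The number `a` is a variation of the length, so it may have any sign.
  edge : ∀ e, ∃ a : ℝ, P (h.tgt e) = P (h.src e) + a • pdir (h.dir e)

variable (h) in
/-- The moment of an edge in a deformation. -/
def edgeMom (P : h.V → ℝ × ℝ) : h.Edge → ℝ
  | .inl e => mom (h.dir e) (P (h.src e))
  | .inr l => mom (h.endDir l) (P (h.root l))

variable (h) in
/-- The vector of moments of a deformation. -/
def moments (P : h.V → ℝ × ℝ) : h.Unknown → ℝ :=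
  Sum.elim (fun ε => h.edgeMom P ε.1) (fun v => (P v.1).1)

theorem IsDeformation.sgn_mul_edgeMom {P : h.V → ℝ × ℝ} (hP : h.IsDeformation P) (f : h.Flag) :
    h.sgn f * h.edgeMom P (h.edgeOf f) = mom (h.flagDir f) (P (h.base f)) := by
  rcases f with ⟨e, b⟩ | l
  · cases b
    · simp [sgn, edgeMom, PuncturedGraph.edgeOf, PuncturedGraph.base, flagDir,
        PuncturedGraph.flagVec]
    · obtain ⟨a, ha⟩ := hP.edge e
      simp only [sgn, edgeMom, PuncturedGraph.edgeOf, PuncturedGraph.base, flagDir,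
        PuncturedGraph.flagVec]
      rw [mom_neg, ha, mom_add_smul_self]
      ring
  · simp [sgn, edgeMom, PuncturedGraph.edgeOf, PuncturedGraph.base, flagDir,
      PuncturedGraph.flagVec]

theorem _root_.TropicalX.sum_mom {ι : Type*} (s : Finset ι) (d : ι → Fin 3 → ℤ) (P : ℝ × ℝ) :
    ∑ f ∈ s, mom (d f) P = mom (∑ f ∈ s, d f) P := by
  simp only [mom]
  have h1 : hgt (∑ f ∈ s, d f) = ∑ f ∈ s, hgt (d f) := map_sum hgtHom d s
  rw [h1, Finset.sum_apply, Finset.sum_sub_distrib, ← Finset.sum_mul, ← Finset.sum_mul]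
  push_cast
  rfl

/-- All flags at an inner vertex share the point `P v`, so their moments sum to the moment of the
balanced sum of directions. On L the second coordinate of `P` vanishes, which gives the other
equations. -/
theorem IsDeformation.system_moments (ht : h.IsTight) {P : h.V → ℝ × ℝ}
    (hP : h.IsDeformation P) : h.system (h.moments P) = 0 := by
  have key : ∀ f : h.Flag, 0 ≤ h.ht (h.base f) → (h.ht (h.base f) = 0 → h.Up (h.edgeOf f)) →
      h.sgn f * h.edgePart (h.moments P) (h.edgeOf f) = mom (h.flagDir f) (P (h.base f)) := by
    intro f h0 h1
    rw [← hP.sgn_mul_edgeMom f]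
    by_cases hu : h.Up (h.edgeOf f)
    · simp [edgePart, hu, moments]
    · have h2 : 0 < h.ht (h.base f) := lt_of_le_of_ne h0 (fun hc => hu (h1 hc.symm))
      have h3 : h.Silent (h.edgeOf f) := by
        by_contra hc
        exact hu (ht.up_of_ht_pos h2 hc)
      rw [hP.sgn_mul_edgeMom f, IsTight.flagDir_eq_zero_of_silent h2.ne' h3]
      simp [edgePart, hu]
  funext b
  rcases b with v | f
  · show ∑ f ∈ h.flagsAt v.1, h.sgn f * h.edgePart (h.moments P) (h.edgeOf f) = 0
    rw [Finset.sum_congr rfl (g := fun f => mom (h.flagDir f) (P v.1)), sum_mom]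
    · have := h.balanced v.1
      unfold flagDir
      rw [this, mom_zero]
    · intro f hf
      have hf := h.mem_flagsAt.1 hf
      rw [key f (by rw [hf]; exact v.2.1.le) (fun hc => by rw [hf] at hc; exact absurd hc v.2.1.ne'),
        hf]
  · show h.sgn f.1 * h.edgePart (h.moments P) (h.edgeOf f.1) +
      (hgt (h.flagDir f.1) : ℤ) * h.linePart (h.moments P) (h.base f.1) = 0
    rw [key f.1 f.2.1.ge (fun _ => f.2.2)]
    have h1 : h.linePart (h.moments P) (h.base f.1) = (P (h.base f.1)).1 := by
      unfold linePart
      rw [dif_pos ⟨f.2.1, f.1, rfl, IsTight.not_silent_of_up f.2.2⟩]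
      rfl
    rw [h1, mom, hP.line _ f.2.1]
    ring

/-! ### Independence of the equations -/

namespace IsTight

variable (ht : h.IsTight)
include ht

theorem coord_eq_zero {v : Fin 3 → ℤ} (hv : ∀ j, coordHom j v = 0) : v = 0 := funext hv

/-- A set of vertices without ends, off `L`, whose edges can leave it only to `L` or if they are
contracted, has only contracted edges. -/
theorem flagDir_eq_zero_of_isolated {S : Set h.V} (hS : ∀ v ∈ S, 0 < h.ht v)
    (hl : ∀ l, h.root l ∉ S)
    (hb : ∀ e b, h.base (.inl (e, b)) ∈ S → h.base (.inl (e, !b)) ∉ S →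
      h.flagDir (.inl (e, b)) = 0 ∨ h.ht (h.base (.inl (e, !b))) = 0)
    (e : h.E) (b : Bool) (he : h.base (.inl (e, b)) ∈ S) : h.flagDir (.inl (e, b)) = 0 := by
  have neg : ∀ e b, h.base (.inl (e, b)) ∈ S → h.ht (h.base (.inl (e, !b))) = 0 →
      hgt (h.flagDir (.inl (e, b))) < 0 := by
    intro e b h1 h2
    have h3 := h.ht_opp e b
    have h4 := hS _ h1
    have h5 := ht.len_pos e
    by_contra hc
    push Not at hc
    have : 0 ≤ h.len e * ((hgt (h.flagDir (.inl (e, b))) : ℤ) : ℝ) :=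
      mul_nonneg h5.le (by exact_mod_cast hc)
    linarith
  -- Edges from `S` to L lose height, so the flux of the height is nonpositive and must vanish: no
  -- edge reaches L. All boundary edges are then contracted, and each coordinate is constant along
  -- the edges at `S`.
  have h1 := (h.flux_eq_zero (S := S) (ψ := hgtHom) (fun e b h1 h2 => by
    rcases hb e b h1 h2 with h3 | h3
    · simp [h3]
    · exact (neg e b h1 h3).le) (fun l hl1 => absurd hl1 (hl l))).1
  have h2 : ∀ e b, h.base (.inl (e, b)) ∈ S → h.base (.inl (e, !b)) ∉ S →
      h.flagDir (.inl (e, b)) = 0 := by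
    intro e b h3 h4
    rcases hb e b h3 h4 with h5 | h5
    · exact h5
    · exact absurd (h1 e b h3 h4) (neg e b h3 h5).ne
  refine ht.coord_eq_zero fun j => ?_
  exact h.dir_eq_zero_of_boundary ht.len_pos (coordHom j)
    (fun e b h3 h4 => by rw [h2 e b h3 h4, map_zero]) (fun l hl1 => absurd hl1 (hl l)) he

/-- The potential is constant along up edges and zero on up ends. A level set of a nonzero value has
no ends and is connected to the rest only through L or contracted edges, so all its edges are
contracted, which contradicts that its vertices are active. -/
theorem system_dual {y : h.Equation → ℝ} (hy : ∀ x, ∑ b, y b * h.system x b = 0) : y = 0 := by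
  have hy' : ∀ x : h.Unknown → ℝ,
      ∑ a, (0 : h.Unknown → ℝ) a * x a = ∑ b, y b * h.system x b := by
    intro x
    rw [hy x]
    simp
  have hE : ∀ e b, h.Up (.inl e) → h.pot y (.inl (e, b)) = h.pot y (.inl (e, !b)) := by
    intro e b he
    have := dual_edge hy' he
    simp only [Pi.zero_apply] at this
    cases b
    · simp only [Bool.not_false]; linarith
    · simp only [Bool.not_true]; linarith
  have hI : ∀ v, h.innerMult y v = 0 := by
    intro v
    by_contra hne
    set S : Set h.V := {w | h.innerMult y w = h.innerMult y v} with hS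
    have hpos : ∀ w ∈ S, 0 < h.ht w := by
      intro w hw
      by_contra hc
      have hw' : h.innerMult y w = h.innerMult y v := hw
      rw [innerMult_of_nonpos y (not_lt.1 hc)] at hw'
      exact hne hw'.symm
    have hact : h.Active v := by
      by_contra hc
      apply hne
      unfold innerMult
      rw [dif_neg (fun h1 => hc h1.2)]
    have hl : ∀ l, h.root l ∉ S := by
      intro l hl
      have h1 := dual_end hy' (l := l) (ht.hgt_endDir_pos (hpos _ hl))
      rw [pot_of_pos y (f := .inr l) (hpos _ hl)] at h1
      exact hne ((show h.innerMult y (h.root l) = _ from hl).symm.trans h1)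
    have key := ht.flagDir_eq_zero_of_isolated (S := S) hpos hl (by
      intro e b h1 h2
      by_cases h3 : h.flagDir (.inl (e, b)) = 0
      · exact Or.inl h3
      right
      have hu : h.Up (.inl e) := (h.up_iff e b).2 ⟨h3, Or.inl (hpos _ h1)⟩
      by_contra h4
      have h5 : 0 < h.ht (h.base (.inl (e, !b))) :=
        lt_of_le_of_ne (ht.ht_opp_nonneg (hpos _ h1)) (Ne.symm h4)
      have h6 := hE e b hu
      rw [pot_of_pos y (hpos _ h1), pot_of_pos y h5] at h6
      exact h2 (h6.symm.trans h1))
    obtain ⟨f, hf, hns⟩ := hact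
    rcases f with ⟨e, b⟩ | l
    · exact hns ((h.silent_iff e b).2 (Or.inl (key e b (by rw [hf]; rfl))))
    · exact hl l (by rw [show h.root l = v from hf]; rfl)
  funext b
  rcases b with v | f
  · have := hI v.1
    unfold innerMult at this
    rwa [dif_pos v.2] at this
  · have hp : h.pot y f.1 = y (.inr f) := by
      rw [pot_of_zero y f.2.1]
      unfold lineMult
      rw [dif_pos f.2]
    -- The flag is either an end, or opposite to a flag off L; the potential vanishes in both cases.
    rw [← hp]
    obtain ⟨f, hf0, hfu⟩ := f
    rcases f with ⟨e, b⟩ | l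
    · rw [hE e b hfu, pot_of_pos, hI]
      · rfl
      · rcases ((h.up_iff e b).1 hfu).2 with h1 | h1
        · exact absurd hf0 h1.ne'
        · exact h1
    · exact dual_end hy' hfu

theorem system_surjective : Function.Surjective h.system :=
  surjective_of_dual _ fun _ hy => ht.system_dual hy

end IsTight

end TropicalMorphism

/-! ### Inequalities between numbers of vertices and edges -/

namespace TropicalMorphism

variable {h : TropicalMorphism}

open Classical in
variable (h) in
/-- The number of up edges at a vertex. -/
def upCount (v : h.V) : ℕ := ((h.flagsAt v).filter fun f => h.Up (h.edgeOf f)).card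

theorem sum_hom_flagDir (ψ : (Fin 3 → ℤ) →+ ℤ) (v : h.V) :
    ∑ f ∈ h.flagsAt v, ψ (h.flagDir f) = 0 := by
  rw [← map_sum]
  have := h.balanced v
  unfold flagDir
  rw [this, map_zero]

/-- Stability as a single inequality, in a form that survives contraction of edges. -/
theorem three_le_val (v : h.V) : 3 ≤ h.val v + 2 * h.genus v := by
  obtain ⟨h0, h1⟩ := h.stable v
  rcases Nat.lt_or_ge (h.genus v) 2 with h2 | h2
  · interval_cases hg : h.genus v
    · have := h0 rfl; omega
    · have := h1 rfl; omega
  · omega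

namespace IsTight

variable (ht : h.IsTight)
include ht

/-- At an active vertex on `L` there are edges in both of the first two faces. -/
theorem exists_sides {v : h.V} (hv : h.ht v = 0) (ha : h.Active v) :
    (∃ f ∈ h.flagsAt v, h.Up (h.edgeOf f) ∧ 0 < sid (h.flagDir f)) ∧
    ∃ f ∈ h.flagsAt v, h.Up (h.edgeOf f) ∧ sid (h.flagDir f) < 0 := by
  have hX : ∀ f ∈ h.flagsAt v, h.flagDir f ∈ surfaceX := fun f hf =>
    ht.flagDir_mem_surfaceX (by rw [h.mem_flagsAt.1 hf, hv])
  have hup : ∀ f ∈ h.flagsAt v, 0 < hgt (h.flagDir f) → h.Up (h.edgeOf f) := fun f hf hpos =>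
    (ht.up_iff_of_ht_eq_zero (by rw [h.mem_flagsAt.1 hf, hv])).2 hpos
  have hsid : ∀ f ∈ h.flagsAt v, sid (h.flagDir f) ≠ 0 → 0 < hgt (h.flagDir f) := by
    intro f hf hne
    rcases mem_surfaceX.1 (hX f hf) with h1 | h1 | h1
    · exact lt_of_le_of_ne h1.2 (fun hc => hne (by rw [h1.1, ← hc]))
    · exact lt_of_le_of_ne h1.2 (fun hc => hne (by rw [h1.1, ← hc, neg_zero]))
    · exact absurd h1.1 hne
  obtain ⟨f, hf, hns⟩ := ha
  have hfm := h.mem_flagsAt.2 hf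
  have hf0 : h.ht (h.base f) = 0 := by rw [hf, hv]
  have hne : hgt (h.flagDir f) ≠ 0 := by
    rcases ht.up_or_down_or_silent (h.edgeOf f) with h1 | h1 | h1
    · exact ((ht.up_iff_of_ht_eq_zero hf0).1 h1).ne'
    · exact ((ht.down_iff_of_ht_eq_zero hf0).1 h1).ne
    · exact absurd h1 hns
  -- Some height is nonzero, so by balancing some height is positive. That flag has nonzero side,
  -- and balancing of the sides gives both signs; a direction in X with nonzero side lies in an
  -- upper face.
  obtain ⟨f₁, hf₁, hpos⟩ := Finset.exists_pos_of_sum_zero_of_exists_nonzero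
    (s := h.flagsAt v) (fun f => hgtHom (h.flagDir f)) (sum_hom_flagDir hgtHom v) ⟨f, hfm, hne⟩
  simp only [hgtHom_apply] at hpos
  have hne₁ : sid (h.flagDir f₁) ≠ 0 := by
    rcases mem_surfaceX.1 (hX f₁ hf₁) with h1 | h1 | h1
    · rw [h1.1]; exact hpos.ne'
    · rw [h1.1]; exact neg_ne_zero.2 hpos.ne'
    · exact absurd hpos (not_lt.2 h1.2)
  constructor
  · obtain ⟨f₂, hf₂, h2⟩ := Finset.exists_pos_of_sum_zero_of_exists_nonzero
      (s := h.flagsAt v) (fun f => sidHom (h.flagDir f)) (sum_hom_flagDir sidHom v)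
      ⟨f₁, hf₁, hne₁⟩
    exact ⟨f₂, hf₂, hup f₂ hf₂ (hsid f₂ hf₂ h2.ne'), h2⟩
  · obtain ⟨f₂, hf₂, h2⟩ := Finset.exists_pos_of_sum_zero_of_exists_nonzero
      (s := h.flagsAt v) (fun f => (-sidHom) (h.flagDir f)) (sum_hom_flagDir (-sidHom) v)
      ⟨f₁, hf₁, neg_ne_zero.2 hne₁⟩
    have h3 : sid (h.flagDir f₂) < 0 := neg_pos.1 h2
    exact ⟨f₂, hf₂, hup f₂ hf₂ (hsid f₂ hf₂ h3.ne), h3⟩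

theorem two_le_upCount {v : h.V} (hv : h.ht v = 0) (ha : h.Active v) : 2 ≤ h.upCount v := by
  classical
  obtain ⟨⟨f, hf, hu, hs⟩, ⟨f', hf', hu', hs'⟩⟩ := ht.exists_sides hv ha
  have hne : f ≠ f' := by
    rintro rfl
    exact lt_asymm hs hs'
  unfold upCount
  rw [← Finset.card_pair hne]
  refine Finset.card_le_card ?_
  intro g hg
  rcases Finset.mem_insert.1 hg with rfl | hg
  · exact Finset.mem_filter.2 ⟨hf, hu⟩
  · rw [Finset.mem_singleton.1 hg]
    exact Finset.mem_filter.2 ⟨hf', hu'⟩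

theorem card_lineFlag :
    ∑ v : h.LineVertex, h.upCount v.1 = Fintype.card h.LineFlag := by
  classical
  have h1 := h.sum_sum_flagsAt (fun v => h.ht v = 0) (fun f => if h.Up (h.edgeOf f) then 1 else 0)
  have h2 : Fintype.card h.LineFlag =
      ∑ f with h.ht (h.base f) = 0, if h.Up (h.edgeOf f) then 1 else 0 := by
    rw [← Finset.sum_filter, Finset.filter_filter, ← Finset.card_eq_sum_ones]
    exact Fintype.card_of_subtype _ (by simp)
  rw [h2, ← h1]
  have h3 : ∀ v, ∑ f ∈ h.flagsAt v, (if h.Up (h.edgeOf f) then 1 else 0) = h.upCount v := by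
    intro v
    rw [upCount, Finset.card_filter]
  simp only [h3]
  have h4 : ∑ v with h.ht v = 0 ∧ h.Active v, h.upCount v = ∑ v with h.ht v = 0, h.upCount v := by
    rw [← Finset.filter_filter]
    refine Finset.sum_filter_of_ne fun v hv hne => ?_
    by_contra hc
    apply hne
    rw [upCount, Finset.card_eq_zero, Finset.filter_eq_empty_iff]
    intro f hf hu
    exact hc ⟨f, h.mem_flagsAt.1 hf, not_silent_of_up hu⟩
  rw [← h4]
  exact (Finset.sum_subtype _ (by simp) _).symm

/-- There are at least as many bounded edges as vertices in the third face, off `L`. -/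
theorem card_down_vertex_le [Fintype {v : h.V // h.ht v < 0 ∧ h.Active v}]
    [Fintype {e : h.E // h.Down (.inl e)}] :
    Fintype.card {v : h.V // h.ht v < 0 ∧ h.Active v} ≤
      Fintype.card {e : h.E // h.Down (.inl e)} := by
  classical
  set ext : ({v : h.V // h.ht v < 0 ∧ h.Active v} → ℝ) → h.V → ℝ := fun x v => if hv : h.ht v < 0 ∧ h.Active v then x ⟨v, hv⟩ else 0
    with hext
  -- The coboundary of functions extended by zero to L. On a level set of a nonzero value the height
  -- flux comes only from down ends and has one sign, so there are no ends; then all edges there are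
  -- contracted, contrary to activity. Hence this map is injective.
  let Φ : ({v : h.V // h.ht v < 0 ∧ h.Active v} → ℝ) →ₗ[ℝ] ({e : h.E // h.Down (.inl e)} → ℝ) :=
    { toFun := fun x e => ext x (h.src e.1) - ext x (h.tgt e.1)
      map_add' := fun x y => by
        funext e
        simp only [hext, Pi.add_apply]
        split_ifs <;> ring
      map_smul' := fun a x => by
        funext e
        simp only [hext, Pi.smul_apply, smul_eq_mul, RingHom.id_apply]
        split_ifs <;> ring }
  have hinj : Function.Injective Φ := by
    rw [← LinearMap.ker_eq_bot, LinearMap.ker_eq_bot']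
    intro x hx
    have hE : ∀ e b, h.Down (.inl e) →
        ext x (h.base (.inl (e, b))) = ext x (h.base (.inl (e, !b))) := by
      intro e b he
      have : ext x (h.src e) - ext x (h.tgt e) = 0 := congrFun hx ⟨e, he⟩
      cases b
      · exact sub_eq_zero.1 this
      · exact (sub_eq_zero.1 this).symm
    funext v
    by_contra hne
    set S : Set h.V := {w | ext x w = x v} with hS
    have hneg : ∀ w ∈ S, h.ht w < 0 := by
      intro w hw
      by_contra hc
      have hw' : ext x w = x v := hw
      simp only [hext] at hw'
      rw [dif_neg (fun h1 => hc h1.1)] at hw'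
      exact hne hw'.symm
    have hb : ∀ e b, h.base (.inl (e, b)) ∈ S → h.base (.inl (e, !b)) ∉ S →
        h.flagDir (.inl (e, b)) = 0 := by
      intro e b h1 h2
      by_contra h3
      have := hE e b ((h.down_iff e b).2 ⟨h3, Or.inl (hneg _ h1)⟩)
      exact h2 (this.symm.trans h1)
    have hl : ∀ l, h.root l ∉ S := by
      intro l hl
      have h1 := ht.hgt_endDir_neg (hneg _ hl)
      have h2 := (h.flux_eq_zero (S := S) (ψ := hgtHom)
        (fun e b h1 h2 => by rw [hb e b h1 h2, map_zero])
        (fun l hl => (ht.hgt_endDir_neg (hneg _ hl)).le)).2 l hl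
      exact h1.ne h2
    have hvS : v.1 ∈ S := by
      simp only [hS, hext, Set.mem_ofPred_eq]
      rw [dif_pos v.2]
    obtain ⟨f, hf, hns⟩ := v.2.2
    rcases f with ⟨e, b⟩ | l
    · refine hns ((h.silent_iff e b).2 (Or.inl (ht.coord_eq_zero fun j => ?_)))
      exact h.dir_eq_zero_of_boundary ht.len_pos (coordHom j)
        (fun e b h3 h4 => by rw [hb e b h3 h4, map_zero])
        (fun l hl1 => absurd hl1 (hl l)) (by rw [hf]; exact hvS)
    · exact hl l (by rw [show h.root l = v.1 from hf]; exact hvS)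
  have := LinearMap.finrank_le_finrank_of_injective hinj
  rwa [Module.finrank_fintype_fun_eq_card, Module.finrank_fintype_fun_eq_card] at this

-- All flags at an inactive vertex belong to silent edges, each of which has two flags; stability
-- asks for three flags up to genus.
omit ht in
open Classical in
theorem card_inactive_le :
    3 * (Finset.univ.filter fun v => ¬ h.Active v).card ≤
      2 * (Finset.univ.filter fun e : h.E => h.Silent (.inl e)).card + 2 * ∑ v, h.genus v := by
  have h1 := h.sum_sum_flagsAt (fun v => ¬ h.Active v) (fun _ => 1)
  simp only [Finset.sum_const, smul_eq_mul, mul_one] at h1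
  have h1' : ∑ v with ¬ h.Active v, (h.flagsAt v).card =
      (Finset.univ.filter fun f : h.Flag => ¬ h.Active (h.base f)).card := by
    convert h1
  have h2 : (Finset.univ.filter fun f : h.Flag => ¬ h.Active (h.base f)).card ≤
      2 * (Finset.univ.filter fun e : h.E => h.Silent (.inl e)).card := by
    have h3 : (Finset.univ.filter fun f : h.Flag => ¬ h.Active (h.base f)) ⊆
        Finset.univ.filter fun f : h.Flag => h.Silent (h.edgeOf f) := by
      intro f hf
      simp only [Finset.mem_filter, Finset.mem_univ, true_and] at hf ⊢
      by_contra hc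
      exact hf ⟨f, rfl, hc⟩
    refine (Finset.card_le_card h3).trans ?_
    rw [Finset.card_filter, h.sum_flag, Finset.card_filter, Finset.mul_sum]
    have h5 : ∑ l : h.Λ, (if h.Silent (h.edgeOf (.inr l)) then 1 else 0) = 0 :=
      Finset.sum_eq_zero fun l _ => if_neg id
    rw [h5, add_zero]
    refine Finset.sum_le_sum fun e _ => ?_
    show (if h.Silent (.inl e) then 1 else 0) + (if h.Silent (.inl e) then 1 else 0) ≤ _
    split_ifs <;> simp
  have h3 : 3 * (Finset.univ.filter fun v => ¬ h.Active v).card ≤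
      ∑ v with ¬ h.Active v, ((h.flagsAt v).card + 2 * h.genus v) := by
    rw [mul_comm, ← smul_eq_mul, ← Finset.sum_const]
    exact Finset.sum_le_sum fun v _ => three_le_val v
  rw [Finset.sum_add_distrib, h1', ← Finset.mul_sum] at h3
  have h4 : ∑ v with ¬ h.Active v, h.genus v ≤ ∑ v, h.genus v :=
    Finset.sum_le_sum_of_subset (Finset.filter_subset _ _)
  omega

/-! ### The dimension count -/

variable (h) in
omit ht in
/-- The linear system together with the moments of some marked edges. -/
def markedSystem {N : ℕ} (mk : Fin N → h.UpEdge) :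
    (h.Unknown → ℝ) →ₗ[ℝ] (h.Equation → ℝ) × (Fin N → ℝ) :=
  h.system.prod (LinearMap.pi fun i => LinearMap.proj (.inl (mk i)))

variable {N : ℕ} {mk : Fin N → h.UpEdge}
  (hmk : ∀ r : Fin N → ℝ, ∃ P, h.IsDeformation P ∧ ∀ i, h.edgeMom P (mk i).1 = r i)
include hmk

/-- Correct the marked moments of a solution by a deformation, which does not change the equations.
-/
theorem markedSystem_surjective : Function.Surjective (markedSystem h mk) := by
  rintro ⟨y, r⟩
  obtain ⟨x, hx⟩ := ht.system_surjective y
  obtain ⟨P, hP, hr⟩ := hmk (fun i => r i - x (.inl (mk i)))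
  refine ⟨x + h.moments P, ?_⟩
  refine Prod.ext ?_ ?_
  · show h.system (x + h.moments P) = y
    rw [map_add, hP.system_moments ht, hx, add_zero]
  · funext i
    show x (.inl (mk i)) + h.edgeMom P (mk i).1 = r i
    rw [hr]
    ring

theorem card_equation_add_le : Fintype.card h.Equation + N ≤ Fintype.card h.Unknown := by
  have := LinearMap.finrank_le_finrank_of_surjective (ht.markedSystem_surjective hmk)
  rwa [Module.finrank_prod, Module.finrank_fintype_fun_eq_card, Module.finrank_fintype_fun_eq_card,
    Module.finrank_fintype_fun_eq_card, Fintype.card_fin] at this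

/-- Insert V - E - genera for χ in the inequality between equations, marks and unknowns. What
remains is that three nonnegative defects, one for L, one for the third face and one for silent
edges, have sum at most zero. -/
theorem rigid_aux [Fintype {l : h.Λ // h.Up (.inr l)}]
    (hN : (N : ℤ) = Fintype.card {l : h.Λ // h.Up (.inr l)} - h.tropEulerChar) :
    (∀ ε, ¬ h.Silent ε) ∧ (∀ v, h.genus v = 0) ∧ (∀ v, h.ht v = 0 → h.upCount v = 2) ∧
    Nat.card {v : h.V // h.ht v < 0} = Nat.card {e : h.E // h.Down (.inl e)} ∧
    Fintype.card h.Equation + N = Fintype.card h.Unknown := by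
  classical
  have hc := ht.card_equation_add_le hmk
  have hD := ht.card_down_vertex_le
  have hQ := card_inactive_le (h := h)
  have hK := ht.card_lineFlag
  have hK2 : 2 * Fintype.card h.LineVertex ≤ ∑ v : h.LineVertex, h.upCount v.1 := by
    rw [mul_comm, ← smul_eq_mul, ← Finset.card_univ, ← Finset.sum_const]
    exact Finset.sum_le_sum fun v _ => ht.two_le_upCount v.2.1 v.2.2
  rw [Fintype.card_sum, Fintype.card_sum] at hc
  have hU : Fintype.card h.UpEdge = (Finset.univ.filter fun e : h.E => h.Up (.inl e)).card +
      Fintype.card {l : h.Λ // h.Up (.inr l)} := by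
    rw [Fintype.card_of_subtype (Finset.univ.filter fun ε : h.Edge => h.Up ε) (by simp),
      Fintype.card_of_subtype (Finset.univ.filter fun l : h.Λ => h.Up (.inr l)) (by simp),
      Finset.card_filter, Finset.card_filter, Finset.card_filter, Fintype.sum_sum_type]
  have hE : Fintype.card h.E = (Finset.univ.filter fun e : h.E => h.Up (.inl e)).card +
      Fintype.card {e : h.E // h.Down (.inl e)} +
      (Finset.univ.filter fun e : h.E => h.Silent (.inl e)).card := by
    rw [Fintype.card_of_subtype (Finset.univ.filter fun e : h.E => h.Down (.inl e)) (by simp),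
      Finset.card_filter, Finset.card_filter, Finset.card_filter, ← Finset.sum_add_distrib,
      ← Finset.sum_add_distrib, ← Finset.card_univ, Finset.card_eq_sum_ones]
    refine Finset.sum_congr rfl fun e _ => ?_
    rcases ht.up_or_down_or_silent (.inl e) with h1 | h1 | h1
    · simp [h1, ht.not_down_of_up h1, not_silent_of_up h1]
    · have h2 : ¬ h.Up (.inl e) := fun h2 => ht.not_down_of_up h2 h1
      simp [h1, not_silent_of_down h1, h2]
    · have h2 : ¬ h.Up (.inl e) := fun h2 => not_silent_of_up h2 h1
      have h3 : ¬ h.Down (.inl e) := fun h2 => not_silent_of_down h2 h1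
      simp [h1, h2, h3]
  have hV : Fintype.card h.V = Fintype.card h.InnerVertex + Fintype.card h.LineVertex +
      Fintype.card {v : h.V // h.ht v < 0 ∧ h.Active v} +
      (Finset.univ.filter fun v => ¬ h.Active v).card := by
    rw [Fintype.card_of_subtype (Finset.univ.filter fun v => 0 < h.ht v ∧ h.Active v) (by simp),
      Fintype.card_of_subtype (Finset.univ.filter fun v => h.ht v = 0 ∧ h.Active v) (by simp),
      Fintype.card_of_subtype (Finset.univ.filter fun v => h.ht v < 0 ∧ h.Active v) (by simp),
      Finset.card_filter, Finset.card_filter, Finset.card_filter, Finset.card_filter,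
      ← Finset.sum_add_distrib, ← Finset.sum_add_distrib, ← Finset.sum_add_distrib,
      ← Finset.card_univ, Finset.card_eq_sum_ones]
    refine Finset.sum_congr rfl fun v _ => ?_
    by_cases ha : h.Active v
    · rcases lt_trichotomy (h.ht v) 0 with h1 | h1 | h1
      · simp [ha, h1, h1.ne, not_lt.2 h1.le]
      · simp [ha, h1]
      · simp [ha, h1, h1.ne', not_lt.2 h1.le]
    · simp [ha]
  have hχ : h.tropEulerChar =
      (Fintype.card h.V : ℤ) - Fintype.card h.E - ((∑ v, h.genus v : ℕ) : ℤ) := by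
    unfold TropicalCurve.tropEulerChar
    rw [PuncturedGraph.eulerChar_eq]
    push_cast
    rfl
  generalize hg : ∑ v, h.genus v = g at *
  -- With q inactive vertices, s silent edges and total genus g, the count gives s + g ≤ q while 3q
  -- ≤ 2(s + g); hence all three vanish.
  have hq0 : (Finset.univ.filter fun v => ¬ h.Active v).card = 0 := by omega
  have hs0 : (Finset.univ.filter fun e : h.E => h.Silent (.inl e)).card = 0 := by omega
  have hg0 : g = 0 := by omega
  have hKeq : ∑ v : h.LineVertex, h.upCount v.1 = 2 * Fintype.card h.LineVertex := by omega
  have hDeq : Fintype.card {v : h.V // h.ht v < 0 ∧ h.Active v} =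
    Fintype.card {e : h.E // h.Down (.inl e)} := by omega
  have hact : ∀ v, h.Active v := by
    intro v
    by_contra hc
    rw [Finset.card_eq_zero, Finset.filter_eq_empty_iff] at hq0
    exact hq0 (Finset.mem_univ v) hc
  refine ⟨?_, ?_, ?_, ?_, ?_⟩
  · rintro (e | l) hs
    · rw [Finset.card_eq_zero, Finset.filter_eq_empty_iff] at hs0
      exact hs0 (Finset.mem_univ e) hs
    · exact hs
  · intro v
    rw [hg0] at hg
    exact (Finset.sum_eq_zero_iff.1 hg) v (Finset.mem_univ v)
  · intro v hv
    have h1 : ∑ _v : h.LineVertex, 2 = ∑ v : h.LineVertex, h.upCount v.1 := by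
      rw [hKeq, Finset.sum_const, Finset.card_univ, smul_eq_mul, mul_comm]
    exact ((Finset.sum_eq_sum_iff_of_le
      (fun v _ => ht.two_le_upCount v.2.1 v.2.2)).1 h1 ⟨v, hv, hact v⟩ (Finset.mem_univ _)).symm
  · rw [Nat.card_eq_fintype_card, Nat.card_eq_fintype_card, ← hDeq]
    exact Fintype.card_congr (Equiv.subtypeEquivRight fun v => ⟨fun h1 => ⟨h1, hact v⟩, And.left⟩)
  · rw [Fintype.card_sum, Fintype.card_sum]
    omega

end IsTight

end TropicalMorphism

/-! ### Rigid curves -/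

namespace TropicalMorphism

variable {h : TropicalMorphism}

variable (h) in
/-- A tight curve is rigid with respect to some marked edges if the dimension count is sharp. -/
structure IsRigid {N : ℕ} (mk : Fin N → h.UpEdge) : Prop where
  tight : h.IsTight
  not_silent : ∀ ε, ¬ h.Silent ε
  genus_eq : ∀ v, h.genus v = 0
  upCount_eq : ∀ v, h.ht v = 0 → h.upCount v = 2
  card_down : Nat.card {v : h.V // h.ht v < 0} = Nat.card {e : h.E // h.Down (.inl e)}
  bij : Function.Bijective (IsTight.markedSystem h mk)

theorem IsTight.isRigid (ht : h.IsTight) {N : ℕ} {mk : Fin N → h.UpEdge}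
    (hmk : ∀ r : Fin N → ℝ, ∃ P, h.IsDeformation P ∧ ∀ i, h.edgeMom P (mk i).1 = r i)
    [Fintype {l : h.Λ // h.Up (.inr l)}]
    (hN : (N : ℤ) = Fintype.card {l : h.Λ // h.Up (.inr l)} - h.tropEulerChar) :
    h.IsRigid mk := by
  obtain ⟨h1, h2, h3, h4, h5⟩ := ht.rigid_aux hmk hN
  have hs := ht.markedSystem_surjective hmk
  refine ⟨ht, h1, h2, h3, h4, ?_, hs⟩
  refine (LinearMap.injective_iff_surjective_of_finrank_eq_finrank ?_).2 hs
  rw [Module.finrank_prod, Module.finrank_fintype_fun_eq_card, Module.finrank_fintype_fun_eq_card,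
    Module.finrank_fintype_fun_eq_card, Fintype.card_fin, h5]

namespace IsRigid

variable {N : ℕ} {mk : Fin N → h.UpEdge} (hr : h.IsRigid mk)
include hr

theorem eq_zero {x : h.Unknown → ℝ} (hx : h.system x = 0) (hm : ∀ i, x (.inl (mk i)) = 0) :
    x = 0 := by
  refine hr.bij.1 ?_
  rw [map_zero]
  exact Prod.ext hx (funext hm)

theorem flagDir_ne_zero (f : h.Flag) : h.flagDir f ≠ 0 := by
  intro hf
  rcases f with ⟨e, b⟩ | l
  · exact hr.not_silent (.inl e) ((h.silent_iff e b).2 (Or.inl hf))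
  · refine hr.tight.hgt_endDir_ne l ?_
    have : h.endDir l = 0 := hf
    rw [this, hgt_zero]

theorem three_le_val (v : h.V) : 3 ≤ h.val v := by
  have := TropicalMorphism.three_le_val v
  rw [hr.genus_eq] at this
  exact this

theorem exists_flag (v : h.V) : ∃ f, h.base f = v := by
  have h1 := hr.three_le_val v
  have h2 : 0 < (h.flagsAt v).card := by
    unfold PuncturedGraph.val at h1
    omega
  obtain ⟨f, hf⟩ := Finset.card_pos.1 h2
  exact ⟨f, h.mem_flagsAt.1 hf⟩

theorem active (v : h.V) : h.Active v := by
  obtain ⟨f, hf⟩ := hr.exists_flag v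
  exact ⟨f, hf, hr.not_silent _⟩

theorem up_of_pos {f : h.Flag} (hf : 0 < h.ht (h.base f)) : h.Up (h.edgeOf f) :=
  hr.tight.up_of_ht_pos hf (hr.not_silent _)

theorem pos_ne_opp (e : h.E) (b : Bool) :
    h.pos (h.base (.inl (e, !b))) ≠ h.pos (h.base (.inl (e, b))) := by
  intro hc
  apply hr.flagDir_ne_zero (.inl (e, b))
  funext j
  have h1 := h.pos_opp e b j
  rw [hc] at h1
  have h2 : h.len e * (h.flagDir (.inl (e, b)) j : ℝ) = 0 := by linarith
  rcases mul_eq_zero.1 h2 with h3 | h3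
  · exact absurd h3 (hr.tight.len_pos e).ne'
  · exact_mod_cast h3

theorem opp_ne (e : h.E) (b : Bool) : h.base (.inl (e, !b)) ≠ h.base (.inl (e, b)) :=
  fun hc => hr.pos_ne_opp e b (by rw [hc])

theorem up_iff_of_face {f : h.Flag} (h0 : h.ht (h.base f) = 0) {i : Fin 3}
    (hf : h.flagDir f ∈ face i) : h.Up (h.edgeOf f) ↔ i ≠ 2 := by
  rw [hr.tight.up_iff_of_ht_eq_zero h0]
  have hL : hgt (h.flagDir f) ≠ 0 := by
    intro hc
    rcases hr.tight.up_or_down_or_silent (h.edgeOf f) with h1 | h1 | h1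
    · exact ((hr.tight.up_iff_of_ht_eq_zero h0).1 h1).ne' hc
    · exact ((hr.tight.down_iff_of_ht_eq_zero h0).1 h1).ne hc
    · exact hr.not_silent _ h1
  fin_cases i
  · exact iff_of_true (lt_of_le_of_ne (mem_face_zero.1 hf).2 hL.symm) (by decide)
  · exact iff_of_true (lt_of_le_of_ne (mem_face_one.1 hf).2 hL.symm) (by decide)
  · exact iff_of_false (not_lt.2 (mem_face_two.1 hf).2) (by simp)

theorem flagDir_notMem_lineL {f : h.Flag} (h0 : h.ht (h.base f) = 0) :
    h.flagDir f ∉ lineL := by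
  intro hL
  have h1 := (hr.up_iff_of_face h0 (mem_face_of_mem_lineL hL 0)).2 (by decide)
  exact (hr.up_iff_of_face h0 (mem_face_of_mem_lineL hL 2)).1 h1 rfl

/-- At a vertex on `L` there is an edge in each of the first two faces. -/
theorem exists_up_flag {v : h.V} (hv : h.ht v = 0) {i : Fin 3} (hi : i ≠ 2) :
    ∃ f, h.base f = v ∧ h.flagDir f ∈ face i := by
  obtain ⟨⟨f, hf, hu, hs⟩, ⟨f', hf', hu', hs'⟩⟩ := hr.tight.exists_sides hv (hr.active v)
  have hf := h.mem_flagsAt.1 hf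
  have hf' := h.mem_flagsAt.1 hf'
  fin_cases i
  · refine ⟨f, hf, mem_face_zero.2 ?_⟩
    have h0 : h.ht (h.base f) = 0 := by rw [hf, hv]
    rcases mem_surfaceX.1 (hr.tight.flagDir_mem_surfaceX h0) with h1 | h1 | h1
    · exact h1
    · linarith [h1.1, h1.2]
    · linarith [h1.1, h1.2]
  · refine ⟨f', hf', mem_face_one.2 ?_⟩
    have h0 : h.ht (h.base f') = 0 := by rw [hf', hv]
    rcases mem_surfaceX.1 (hr.tight.flagDir_mem_surfaceX h0) with h1 | h1 | h1
    · linarith [h1.1, h1.2]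
    · exact h1
    · linarith [h1.1, h1.2]
  · exact absurd rfl hi

/-- At a vertex on `L` there is only one edge in each of the first two faces. -/
theorem up_flag_unique {i : Fin 3} (hi : i ≠ 2) {f g : h.Flag} (h0 : h.ht (h.base f) = 0)
    (hg : h.base g = h.base f) (hfi : h.flagDir f ∈ face i) (hgi : h.flagDir g ∈ face i) :
    f = g := by
  classical
  by_contra hne
  have hg0 : h.ht (h.base g) = 0 := by rw [hg, h0]
  -- The other upper face supplies a third up flag, whereas `upCount` is 2.
  obtain ⟨j, hj2, hji⟩ : ∃ j : Fin 3, j ≠ 2 ∧ j ≠ i := by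
    fin_cases i
    · exact ⟨1, by decide, by decide⟩
    · exact ⟨0, by decide, by decide⟩
    · exact absurd rfl hi
  obtain ⟨k, hk, hkj⟩ := hr.exists_up_flag h0 hj2
  have hk0 : h.ht (h.base k) = 0 := by rw [hk, h0]
  have hkf : k ≠ f := fun hc => hji (face_unique hkj (hc ▸ hfi) (hr.flagDir_notMem_lineL hk0))
  have hkg : k ≠ g := fun hc => hji (face_unique hkj (hc ▸ hgi) (hr.flagDir_notMem_lineL hk0))
  have hc := hr.upCount_eq _ h0
  have : ({f, g, k} : Finset h.Flag) ⊆
      (h.flagsAt (h.base f)).filter fun f => h.Up (h.edgeOf f) := by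
    intro x hx
    simp only [Finset.mem_insert, Finset.mem_singleton] at hx
    rw [Finset.mem_filter, h.mem_flagsAt]
    rcases hx with rfl | rfl | rfl
    · exact ⟨rfl, (hr.up_iff_of_face h0 hfi).2 hi⟩
    · exact ⟨hg, (hr.up_iff_of_face hg0 hgi).2 hi⟩
    · exact ⟨hk, (hr.up_iff_of_face hk0 hkj).2 hj2⟩
  have h3 := Finset.card_le_card this
  rw [Finset.card_insert_of_notMem, Finset.card_pair hkg.symm] at h3
  · unfold upCount at hc
    omega
  · simp [hne, hkf.symm]

/-! ### Functionals that vanish on deformations -/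

omit hr in
/-- The difference of the values of a function on the flags of an edge. -/
def _root_.TropicalX.TropicalMorphism.edgeDiff (γ : h.Flag → ℝ) : h.Edge → ℝ
  | .inl e => γ (.inl (e, false)) - γ (.inl (e, true))
  | .inr l => γ (.inr l)

/-- In a deformation the two flags of an edge have opposite moments, so a combination over flags is
a functional of the unknowns. -/
theorem sum_edgeDiff_mul_moments {γ : h.Flag → ℝ} (hγ : ∀ f, γ f ≠ 0 → h.Up (h.edgeOf f))
    {P : h.V → ℝ × ℝ} (hP : h.IsDeformation P) :
    ∑ a, (Sum.elim (fun ε => edgeDiff γ ε.1) 0 : h.Unknown → ℝ) a * h.moments P a =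
      ∑ f, γ f * mom (h.flagDir f) (P (h.base f)) := by
  classical
  rw [Fintype.sum_sum_type]
  simp only [Sum.elim_inl, Sum.elim_inr, Pi.zero_apply, zero_mul, Finset.sum_const_zero, add_zero,
    moments]
  rw [sum_subtype_eq_sum_dite (F := fun ε : h.UpEdge => edgeDiff γ ε.1 * h.edgeMom P ε.1)]
  have h1 : ∀ ε : h.Edge, (if _hu : h.Up ε then edgeDiff γ ε * h.edgeMom P ε else 0) =
      edgeDiff γ ε * h.edgeMom P ε := by
    intro ε
    split_ifs with hu
    · rfl
    · rcases ε with e | l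
      · have a1 : γ (.inl (e, false)) = 0 := by
          by_contra hc
          exact hu (hγ _ hc)
        have a2 : γ (.inl (e, true)) = 0 := by
          by_contra hc
          exact hu (hγ _ hc)
        simp [edgeDiff, a1, a2]
      · have a1 : γ (.inr l) = 0 := by
          by_contra hc
          exact hu (hγ _ hc)
        simp [edgeDiff, a1]
  simp only [h1]
  rw [Fintype.sum_sum_type, h.sum_flag]
  refine congrArg₂ (· + ·) (Finset.sum_congr rfl fun e _ => ?_)
    (Finset.sum_congr rfl fun l _ => ?_)
  · rw [← hP.sgn_mul_edgeMom, ← hP.sgn_mul_edgeMom]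
    simp only [edgeDiff, sgn, PuncturedGraph.edgeOf]
    ring
  · rw [← hP.sgn_mul_edgeMom]
    simp only [edgeDiff, sgn, PuncturedGraph.edgeOf, one_mul]

/-- Every solution of the linear system comes from a deformation. -/
theorem exists_moments_eq {D : Set (h.V → ℝ × ℝ)} (hD : ∀ P ∈ D, h.IsDeformation P)
    (hmk : ∀ r : Fin N → ℝ, ∃ P ∈ D, ∀ i, h.edgeMom P (mk i).1 = r i)
    {x : h.Unknown → ℝ} (hx : h.system x = 0) : ∃ P ∈ D, h.moments P = x := by
  obtain ⟨P, hPD, hP⟩ := hmk fun i => x (.inl (mk i))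
  refine ⟨P, hPD, sub_eq_zero.1 (hr.eq_zero ?_ ?_)⟩
  · rw [map_sub, hx, (hD P hPD).system_moments hr.tight, sub_zero]
  · intro i
    show h.edgeMom P (mk i).1 - x (.inl (mk i)) = 0
    rw [hP, sub_self]

/-- The marked moments determine a solution and `D` realises all their values, so the moments of `D`
fill the kernel of the system; a functional that vanishes there factors through it. Allowing a
smaller `D` makes room for additional incidence conditions. -/
theorem exists_multiplier {D : Set (h.V → ℝ × ℝ)} (hD : ∀ P ∈ D, h.IsDeformation P)
    (hmk : ∀ r : Fin N → ℝ, ∃ P ∈ D, ∀ i, h.edgeMom P (mk i).1 = r i)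
    (ψ : h.Unknown → ℝ) (hψ : ∀ P ∈ D, ∑ a, ψ a * h.moments P a = 0) :
    ∃ y : h.Equation → ℝ, ∀ x, ∑ a, ψ a * x a = ∑ b, y b * h.system x b := by
  classical
  let Ψ : (h.Unknown → ℝ) →ₗ[ℝ] ℝ :=
    { toFun := fun x => ∑ a, ψ a * x a
      map_add' := fun x y => by simp [mul_add, Finset.sum_add_distrib]
      map_smul' := fun c x => by
        simp only [Pi.smul_apply, smul_eq_mul, RingHom.id_apply, Finset.mul_sum]
        exact Finset.sum_congr rfl fun _ _ => by ring }
  let L := LinearEquiv.ofBijective _ hr.bij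
  have hker : ∀ r : Fin N → ℝ, Ψ (L.symm (0, r)) = 0 := by
    intro r
    have h1 : L (L.symm (0, r)) = (0, r) := L.apply_symm_apply _
    obtain ⟨P, hPD, hP⟩ := hr.exists_moments_eq hD hmk (x := L.symm (0, r))
      (congrArg Prod.fst h1)
    rw [← hP]
    exact hψ P hPD
  -- The multiplier of an equation is the value of the functional at the vector with zero marks that
  -- violates only this equation, by 1.
  refine ⟨fun b => Ψ (L.symm (Pi.single b 1, 0)), fun x => ?_⟩
  have h1 : x = L.symm (h.system x, 0) + L.symm (0, fun i => x (.inl (mk i))) := by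
    rw [← map_add, Prod.mk_add_mk, add_zero, zero_add]
    exact (L.symm_apply_apply x).symm
  have h2 : Ψ x = Ψ (L.symm (h.system x, 0)) := by
    conv_lhs => rw [h1]
    rw [map_add, hker, add_zero]
  show Ψ x = _
  rw [h2]
  have h3 : ∀ z : h.Equation → ℝ, Ψ (L.symm (z, 0)) =
      ∑ b, Ψ (L.symm (Pi.single b 1, 0)) * z b := by
    intro z
    have h4 : ((z, 0) : (h.Equation → ℝ) × (Fin N → ℝ)) =
        ∑ b, z b • ((Pi.single b 1, 0) : (h.Equation → ℝ) × (Fin N → ℝ)) := by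
      refine Prod.ext ?_ ?_
      · rw [Prod.fst_sum]
        funext b
        simp [Finset.sum_apply, Pi.single_apply]
      · rw [Prod.snd_sum]
        simp
    rw [h4, map_sum, map_sum]
    refine Finset.sum_congr rfl fun b _ => ?_
    rw [map_smul, map_smul, smul_eq_mul, mul_comm]
  exact h3 _

/-- A relation between moments in one face is given by a potential which vanishes on `L` and on
the other face. -/
theorem exists_potential {D : Set (h.V → ℝ × ℝ)} (hD : ∀ P ∈ D, h.IsDeformation P)
    (hmk : ∀ r : Fin N → ℝ, ∃ P ∈ D, ∀ i, h.edgeMom P (mk i).1 = r i)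
    {i : Fin 3} {γ : h.Flag → ℝ}
    (hγu : ∀ f, γ f ≠ 0 → h.Up (h.edgeOf f))
    (hγ : ∀ e b, γ (.inl (e, b)) ≠ 0 →
      h.pos (h.base (.inl (e, b))) ∈ face i ∧ h.pos (h.base (.inl (e, !b))) ∈ face i)
    (hγl : ∀ l, γ (.inr l) ≠ 0 → h.endDir l ∈ face i)
    (h0 : ∀ P ∈ D, ∑ f, γ f * mom (h.flagDir f) (P (h.base f)) = 0) :
    ∃ pt : h.V → ℝ, (∀ v, h.ht v ≤ 0 → pt v = 0) ∧
      (∀ e b, h.Up (.inl e) → pt (h.base (.inl (e, b))) - pt (h.base (.inl (e, !b))) =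
        γ (.inl (e, b)) - γ (.inl (e, !b))) ∧
      (∀ l, h.Up (.inr l) → pt (h.root l) = γ (.inr l)) := by
  classical
  obtain ⟨y, hy⟩ := hr.exists_multiplier hD hmk (Sum.elim (fun ε => edgeDiff γ ε.1) 0)
    (fun P hP => by rw [hr.sum_edgeDiff_mul_moments hγu (hD P hP)]; exact h0 P hP)
  have hE : ∀ e b, h.Up (.inl e) → h.pot y (.inl (e, b)) - h.pot y (.inl (e, !b)) =
      γ (.inl (e, b)) - γ (.inl (e, !b)) := by
    intro e b he
    have := dual_edge hy he
    simp only [Sum.elim_inl, edgeDiff] at this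
    cases b
    · exact this
    · simp only [Bool.not_true]
      linarith
  have hΛ : ∀ l, h.Up (.inr l) → h.pot y (.inr l) = γ (.inr l) := fun l hl => dual_end hy hl
  have hT : ∀ v, h.ht v = 0 →
      ∑ f ∈ h.flagsAt v, h.lineMult y f * (hgt (h.flagDir f) : ℤ) = 0 := fun v hv =>
    dual_line hy ⟨v, hv, hr.active v⟩
  -- Away from the face `γ` vanishes, so the argument with isolated level sets applies there as in
  -- `system_dual`.
  have step1 : ∀ v, 0 < h.ht v → h.pos v ∉ face i → h.innerMult y v = 0 := by
    intro v hv hvi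
    by_contra hne
    set S : Set h.V := {w | (0 < h.ht w ∧ h.pos w ∉ face i) ∧ h.innerMult y w = h.innerMult y v}
      with hS
    have hl : ∀ l, h.root l ∉ S := by
      rintro l ⟨⟨h1, h2⟩, h3⟩
      have h4 := hΛ l (hr.tight.hgt_endDir_pos h1)
      rw [pot_of_pos y (f := .inr l) h1] at h4
      have h5 : γ (.inr l) = 0 := by
        by_contra hc
        obtain ⟨j, hj⟩ := hr.tight.exists_face (h.root l)
        have h6 := hr.tight.endDir_mem_face hj h1.ne'
        have h7 := face_unique h6 (hγl l hc) (hr.tight.endDir_notMem l)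
        exact h2 (h7 ▸ hj)
      exact hne ((h3.symm.trans h4).trans h5)
    have key := hr.tight.flagDir_eq_zero_of_isolated (S := S) (fun w hw => hw.1.1) hl (by
      rintro e b ⟨⟨h1, h2⟩, h3⟩ h4
      right
      by_contra h5
      have h6 : 0 < h.ht (h.base (.inl (e, !b))) :=
        lt_of_le_of_ne (hr.tight.ht_opp_nonneg h1) (Ne.symm h5)
      obtain ⟨j, hj⟩ := hr.tight.exists_face (h.base (.inl (e, b)))
      have hj' := hr.tight.opp_mem_face hj h1.ne'
      have h7 : h.pos (h.base (.inl (e, !b))) ∉ face i := by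
        intro hc
        have := face_unique hj' hc (fun hc => h5 ((hr.tight.mem_lineL_iff _).1 hc))
        exact h2 (this ▸ hj)
      have g1 : γ (.inl (e, b)) = 0 := by
        by_contra hc
        exact h2 (hγ e b hc).1
      have g2 : γ (.inl (e, !b)) = 0 := by
        by_contra hc
        exact h7 (hγ e (!b) hc).1
      have h8 := hE e b (hr.up_of_pos (f := .inl (e, b)) h1)
      rw [g1, g2, pot_of_pos y h1, pot_of_pos y h6, sub_zero, sub_eq_zero] at h8
      exact h4 ⟨⟨h6, h7⟩, h8.symm.trans h3⟩)
    obtain ⟨f, hf⟩ := hr.exists_flag v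
    have hvS : v ∈ S := ⟨⟨hv, hvi⟩, rfl⟩
    rcases f with ⟨e, b⟩ | l
    · exact hr.flagDir_ne_zero _ (key e b (by rw [hf]; exact hvS))
    · exact hl l (by rw [show h.root l = v from hf]; exact hvS)
  have step2 : ∀ f, h.ht (h.base f) = 0 → h.Up (h.edgeOf f) → h.flagDir f ∉ face i →
      h.lineMult y f = 0 := by
    intro f hf0 hfu hfi
    rw [← pot_of_zero y hf0]
    rcases f with ⟨e, b⟩ | l
    · have h6 : 0 < h.ht (h.base (.inl (e, !b))) := by
        rcases ((h.up_iff e b).1 hfu).2 with h1 | h1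
        · exact absurd hf0 h1.ne'
        · exact h1
      have h7 : h.pos (h.base (.inl (e, !b))) ∉ face i := by
        intro hc
        have h8 := hr.tight.flagDir_mem_plane hc h6.ne'
        rw [h.flagDir_opp] at h8
        have h9 := neg_mem_plane h8
        rw [neg_neg] at h9
        exact hfi (mem_face_of_mem_plane h9 (hr.tight.flagDir_mem_surfaceX hf0))
      have g1 : γ (.inl (e, b)) = 0 := by
        by_contra hc
        exact h7 (hγ e b hc).2
      have g2 : γ (.inl (e, !b)) = 0 := by
        by_contra hc
        exact h7 (hγ e (!b) hc).1
      have h8 := hE e b hfu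
      rw [g1, g2, pot_of_pos y h6, step1 _ h6 h7] at h8
      linarith
    · rw [hΛ l hfu]
      by_contra hc
      exact hfi (hγl l hc)
  -- A vertex on L has only one up flag in the face and the others have multiplier zero, so the
  -- relation `hT` has a single term, with nonzero coefficient.
  have step3 : ∀ f, h.ht (h.base f) = 0 → h.lineMult y f = 0 := by
    intro f hf0
    by_cases hfu : h.Up (h.edgeOf f)
    swap
    · unfold lineMult
      rw [dif_neg (fun hc => hfu hc.2)]
    by_cases hfi : h.flagDir f ∈ face i
    swap
    · exact step2 f hf0 hfu hfi
    have hi : i ≠ 2 := (hr.up_iff_of_face hf0 hfi).1 hfu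
    have h1 := hT _ hf0
    rw [Finset.sum_eq_single f] at h1
    · rcases mul_eq_zero.1 h1 with h2 | h2
      · exact h2
      · have h3 := (hr.tight.up_iff_of_ht_eq_zero hf0).1 hfu
        have h4 : hgt (h.flagDir f) = 0 := by exact_mod_cast h2
        omega
    · intro g hg hgf
      have hgb := h.mem_flagsAt.1 hg
      have hg0 : h.ht (h.base g) = 0 := by rw [hgb, hf0]
      by_cases hgu : h.Up (h.edgeOf g)
      · rw [step2 g hg0 hgu, zero_mul]
        intro hgi
        exact hgf (hr.up_flag_unique hi hf0 hgb hfi hgi).symm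
      · unfold lineMult
        rw [dif_neg (fun hc => hgu hc.2), zero_mul]
    · intro hc
      exact absurd (h.mem_flagsAt.2 rfl) hc
  have hpot : ∀ f, 0 ≤ h.ht (h.base f) → h.pot y f = h.innerMult y (h.base f) := by
    intro f hf
    rcases hf.eq_or_lt with h1 | h1
    · rw [pot_of_zero y h1.symm, step3 f h1.symm, innerMult_of_nonpos y h1.symm.le]
    · exact pot_of_pos y h1
  have hnn : ∀ e b, h.Up (.inl e) → 0 ≤ h.ht (h.base (.inl (e, b))) := by
    intro e b hu
    rcases ((h.up_iff e b).1 hu).2 with h1 | h1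
    · exact h1.le
    · have := hr.tight.ht_opp_nonneg h1
      rwa [Bool.not_not] at this
  refine ⟨h.innerMult y, fun v hv => innerMult_of_nonpos y hv, ?_, ?_⟩
  · intro e b hu
    rw [← hE e b hu, hpot _ (hnn e b hu), hpot _ (hnn e (!b) hu)]
  · intro l hu
    rw [← hΛ l hu]
    refine (hpot (.inr l) ?_).symm
    by_contra hc
    push Not at hc
    have h1 := hr.tight.hgt_endDir_neg (l := l) hc
    exact absurd hu (not_lt.2 h1.le)

/-! ### Local shape of rigid curves -/

/-- A relation between the directions at `v` annihilates the moments at `v` of every deformation, so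
it comes from a potential. This potential is supported at `v`, and its value there is the common
coefficient: balancing is the only relation up to scaling. -/
theorem relation_const {D : Set (h.V → ℝ × ℝ)} (hD : ∀ P ∈ D, h.IsDeformation P)
    (hmk : ∀ r : Fin N → ℝ, ∃ P ∈ D, ∀ i, h.edgeMom P (mk i).1 = r i)
    {v : h.V} (hv : 0 < h.ht v) (β : h.Flag → ℝ)
    (h1 : ∑ f ∈ h.flagsAt v, β f * (h.flagDir f 0 : ℝ) = 0)
    (h2 : ∑ f ∈ h.flagsAt v, β f * ((hgt (h.flagDir f) : ℤ) : ℝ) = 0)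
    {f f' : h.Flag} (hf : h.base f = v) (hf' : h.base f' = v) : β f = β f' := by
  classical
  obtain ⟨i, hi⟩ := hr.tight.exists_face v
  set γ : h.Flag → ℝ := fun f => if h.base f = v then β f else 0 with hγdef
  have hγb : ∀ f, γ f ≠ 0 → h.base f = v := by
    intro f hf
    by_contra hc
    exact hf (if_neg hc)
  obtain ⟨pt, p1, p2, p3⟩ := hr.exists_potential hD hmk (i := i) (γ := γ)
    (fun f hf => hr.up_of_pos (by rw [hγb f hf]; exact hv))
    (fun e b hf => by
      have hb := hγb _ hf
      refine ⟨by rw [hb]; exact hi, hr.tight.opp_mem_face (by rw [hb]; exact hi) ?_⟩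
      rw [hb]
      exact hv.ne')
    (fun l hf => by
      have hb : h.root l = v := hγb _ hf
      exact hr.tight.endDir_mem_face (by rw [hb]; exact hi) (by rw [hb]; exact hv.ne'))
    (fun P _ => by
      have h3 : ∑ f, γ f * mom (h.flagDir f) (P (h.base f)) =
          ∑ f ∈ h.flagsAt v, β f * mom (h.flagDir f) (P v) := by
        rw [PuncturedGraph.flagsAt, Finset.sum_filter]
        refine Finset.sum_congr rfl fun f _ => ?_
        by_cases hb : h.base f = v
        · simp [hγdef, hb]
        · simp [hγdef, hb]
      rw [h3]
      have h4 : ∀ f, β f * mom (h.flagDir f) (P v) = β f * (h.flagDir f 0 : ℝ) * (P v).2 -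
          β f * ((hgt (h.flagDir f) : ℤ) : ℝ) * (P v).1 := fun f => by
        rw [mom]; ring
      simp only [h4]
      rw [Finset.sum_sub_distrib, ← Finset.sum_mul, ← Finset.sum_mul, h1, h2]
      ring)
  -- A nonzero level set away from `v` has no ends and borders only on `v`. By the maximum principle
  -- for both signs of each coordinate it is mapped to the point `h.pos v`, but no edge is
  -- contracted.
  have hzero : ∀ w, w ≠ v → pt w = 0 := by
    intro w hwv
    by_contra hne
    set S : Set h.V := {u | u ≠ v ∧ pt u = pt w} with hS
    have hpos : ∀ u ∈ S, 0 < h.ht u := by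
      rintro u ⟨-, hu⟩
      by_contra hc
      rw [p1 u (not_lt.1 hc)] at hu
      exact hne hu.symm
    have hγ0 : ∀ f, h.base f ≠ v → γ f = 0 := fun f hf => if_neg hf
    have hl : ∀ l, h.root l ∉ S := by
      intro l hl
      have := p3 l (hr.tight.hgt_endDir_pos (hpos _ hl))
      rw [hγ0 (.inr l) hl.1, hl.2] at this
      exact hne this
    have hb : ∀ e b, h.base (.inl (e, b)) ∈ S → h.base (.inl (e, !b)) ∉ S →
        h.base (.inl (e, !b)) = v := by
      intro e b hb1 hb2
      by_contra hc
      have := p2 e b (hr.up_of_pos (f := .inl (e, b)) (hpos _ hb1))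
      rw [hγ0 _ hb1.1, hγ0 _ hc, sub_zero, sub_eq_zero, hb1.2] at this
      exact hb2 ⟨hc, this.symm⟩
    have hle : ∀ (ψ : (Fin 3 → ℤ) →+ ℤ), ∀ u ∈ S,
        extend ψ (h.pos u) ≤ extend ψ (h.pos v) := fun ψ u hu =>
      h.extend_le_of_boundary hr.tight.len_pos hr.tight.exists_end ψ _
        (fun e b hb1 hb2 => by rw [hb e b hb1 hb2]) hl hu
    have heq : ∀ u ∈ S, h.pos u = h.pos v := by
      intro u hu
      funext j
      have a1 := hle (coordHom j) u hu
      have a2 := hle (-coordHom j) u hu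
      rw [extend_neg, extend_neg] at a2
      rw [extend_coordHom, extend_coordHom] at a1 a2
      linarith
    obtain ⟨f, hf⟩ := hr.exists_flag w
    have hwS : w ∈ S := ⟨hwv, rfl⟩
    rcases f with ⟨e, b⟩ | l
    · have hbS : h.base (.inl (e, b)) ∈ S := by rw [hf]; exact hwS
      refine hr.pos_ne_opp e b ?_
      rw [heq _ hbS]
      by_cases hoS : h.base (.inl (e, !b)) ∈ S
      · exact heq _ hoS
      · rw [hb e b hbS hoS]
    · exact hl l (by rw [show h.root l = w from hf]; exact hwS)
  have key : ∀ f, h.base f = v → β f = pt v := by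
    intro f hf
    have hu := hr.up_of_pos (f := f) (by rw [hf]; exact hv)
    have hγf : γ f = β f := if_pos hf
    rcases f with ⟨e, b⟩ | l
    · have h3 := p2 e b hu
      have hne : h.base (.inl (e, !b)) ≠ v := fun hc => hr.opp_ne e b (hc.trans hf.symm)
      rw [hγf, hf, hzero _ hne, show γ (.inl (e, !b)) = 0 from if_neg hne] at h3
      linarith
    · have h3 := p3 l hu
      rw [hγf, show h.root l = v from hf] at h3
      exact h3.symm
  rw [key f hf, key f' hf']

end IsRigid

end TropicalMorphism

/-! ### Parallel directions in the plane -/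

/-- The projection of three-space to the plane. -/
def proj (p : Fin 3 → ℝ) : ℝ × ℝ := (p 0, hgt p)

theorem proj_line (p : Fin 3 → ℝ) (v : Fin 3 → ℤ) (t : ℝ) :
    proj (fun j => p j + t * (v j : ℝ)) = proj p + t • pdir v := by
  have h1 := hgt_line p (fun j => (v j : ℝ)) t
  rw [hgt_cast] at h1
  simp only [proj, h1]
  simp [pdir]

theorem mom_pdir_comm (v w : Fin 3 → ℤ) : mom v (pdir w) = -mom w (pdir v) := by
  simp only [mom, pdir]; ring

theorem mom_smul (v : Fin 3 → ℤ) (P : ℝ × ℝ) (a : ℝ) : mom v (a • P) = a * mom v P := by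
  simp only [mom, Prod.smul_fst, Prod.smul_snd, smul_eq_mul]; ring

theorem mom_pdir_self (v : Fin 3 → ℤ) : mom v (pdir v) = 0 := by
  simp only [mom, pdir]; ring

/-- Two directions that are parallel to a third one are parallel. -/
theorem mom_eq_zero_of_parallel {v w : Fin 3 → ℤ} {Q : ℝ × ℝ} (hQ : Q ≠ 0) (hv : mom v Q = 0)
    (hw : mom w Q = 0) : mom v (pdir w) = 0 := by
  simp only [mom, pdir] at *
  by_cases h1 : Q.1 = 0
  · have h2 : Q.2 ≠ 0 := fun h2 => hQ (Prod.ext h1 h2)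
    refine mul_left_cancel₀ h2 ?_
    rw [h1] at hv hw
    have a1 : ((v 0 : ℤ) : ℝ) = 0 := by
      rcases mul_eq_zero.1 (by linarith : ((v 0 : ℤ) : ℝ) * Q.2 = 0) with h | h
      · exact h
      · exact absurd h h2
    have a2 : ((w 0 : ℤ) : ℝ) = 0 := by
      rcases mul_eq_zero.1 (by linarith : ((w 0 : ℤ) : ℝ) * Q.2 = 0) with h | h
      · exact h
      · exact absurd h h2
    rw [a1, a2]; ring
  · refine mul_left_cancel₀ h1 ?_
    linear_combination (w 0 : ℝ) * hv - (v 0 : ℝ) * hw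

theorem exists_mom_eq {v : Fin 3 → ℤ} (hv : pdir v ≠ 0) (r : ℝ) : ∃ q : ℝ × ℝ, mom v q = r := by
  set A : ℝ := (v 0 : ℝ) with hA
  set M : ℝ := ((hgt v : ℤ) : ℝ) with hM
  have hpos : A ^ 2 + M ^ 2 ≠ 0 := by
    intro hc
    apply hv
    have h1 : A = 0 := by nlinarith [sq_nonneg A, sq_nonneg M]
    have h2 : M = 0 := by nlinarith [sq_nonneg A, sq_nonneg M]
    exact Prod.ext h1 h2
  refine ⟨(-M * (r / (A ^ 2 + M ^ 2)), A * (r / (A ^ 2 + M ^ 2))), ?_⟩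
  simp only [mom]
  rw [← hA, ← hM]
  field_simp
  ring

/-- The moment with a fixed direction as an integral functional. -/
def momHom (v : Fin 3 → ℤ) : (Fin 3 → ℤ) →+ ℤ where
  toFun w := v 0 * hgt w - hgt v * w 0
  map_zero' := by simp
  map_add' w w' := by
    have : hgt (w + w') = hgt w + hgt w' := map_add hgtHom w w'
    rw [this, Pi.add_apply]
    ring

theorem momHom_cast (v w : Fin 3 → ℤ) : ((momHom v w : ℤ) : ℝ) = mom v (pdir w) := by
  simp [momHom, mom, pdir]

theorem momHom_eq_zero {v w : Fin 3 → ℤ} : momHom v w = 0 ↔ mom v (pdir w) = 0 := by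
  rw [← momHom_cast, Int.cast_eq_zero]

namespace TropicalMorphism

variable {h : TropicalMorphism}

theorem IsTight.pdir_ne_zero (ht : h.IsTight) {f : h.Flag} (hf : h.Up (h.edgeOf f)) :
    pdir (h.flagDir f) ≠ 0 := by
  intro hc
  have h1 : h.flagDir f 0 = 0 := by
    have := congrArg Prod.fst hc
    simpa [pdir] using this
  have h2 : hgt (h.flagDir f) = 0 := by
    have := congrArg Prod.snd hc
    simpa [pdir] using this
  rcases f with ⟨e, b⟩ | l
  · have hu := (h.up_iff e b).1 hf
    rcases hu.2 with h3 | h3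
    · obtain ⟨i, hi⟩ := ht.exists_face (h.base (.inl (e, b)))
      exact hu.1 (eq_zero_of_plane (ht.flagDir_mem_plane hi h3.ne') h1 h2)
    · obtain ⟨i, hi⟩ := ht.exists_face (h.base (.inl (e, !b)))
      have h4 := neg_mem_plane (ht.flagDir_mem_plane hi h3.ne')
      rw [h.flagDir_opp, neg_neg] at h4
      exact hu.1 (eq_zero_of_plane h4 h1 h2)
  · exact ht.hgt_endDir_ne l h2

namespace IsRigid

variable {N : ℕ} {mk : Fin N → h.UpEdge} (hr : h.IsRigid mk)
  (hmk : ∀ r : Fin N → ℝ, ∃ P, h.IsDeformation P ∧ ∀ i, h.edgeMom P (mk i).1 = r i)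
include hr hmk

/-- Different edges at a vertex off `L` are not parallel. -/
theorem mom_ne_zero {v : h.V} (hv : 0 < h.ht v) {f g : h.Flag} (hf : h.base f = v)
    (hg : h.base g = v) (hfg : f ≠ g) : mom (h.flagDir f) (pdir (h.flagDir g)) ≠ 0 := by
  classical
  intro h0
  -- A relation supported on `f` and `g` has coefficient zero at a third flag `k`, hence is trivial
  -- by `relation_const`.
  obtain ⟨k, hk, hkf, hkg⟩ : ∃ k, h.base k = v ∧ k ≠ f ∧ k ≠ g := by
    by_contra hc
    push Not at hc
    have h1 : h.flagsAt v ⊆ {f, g} := by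
      intro k hk
      by_cases hkf : k = f
      · simp [hkf]
      · simp [hc k (h.mem_flagsAt.1 hk) hkf]
    have h2 := Finset.card_le_card h1
    have h3 := hr.three_le_val v
    have h4 : ({f, g} : Finset h.Flag).card ≤ 2 := Finset.card_le_two
    unfold PuncturedGraph.val at h3
    omega
  have key : ∀ a b : ℝ,
      a * (h.flagDir f 0 : ℝ) + b * (h.flagDir g 0 : ℝ) = 0 →
      a * ((hgt (h.flagDir f) : ℤ) : ℝ) + b * ((hgt (h.flagDir g) : ℤ) : ℝ) = 0 →
      a = 0 ∧ b = 0 := by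
    intro a b h1 h2
    set β : h.Flag → ℝ := fun x => if x = f then a else if x = g then b else 0 with hβ
    have hsum : ∀ F : h.Flag → ℝ, ∑ x ∈ h.flagsAt v, β x * F x = a * F f + b * F g := by
      intro F
      rw [← Finset.sum_subset (s₁ := {f, g})]
      · rw [Finset.sum_pair hfg]
        simp [hβ, hfg.symm]
      · intro x hx
        simp only [Finset.mem_insert, Finset.mem_singleton] at hx
        rcases hx with rfl | rfl
        · exact h.mem_flagsAt.2 hf
        · exact h.mem_flagsAt.2 hg
      · intro x _ hx
        simp only [Finset.mem_insert, Finset.mem_singleton, not_or] at hx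
        simp [hβ, hx.1, hx.2]
    have hc : ∀ {x y : h.Flag}, h.base x = v → h.base y = v → β x = β y := fun hx hy =>
      hr.relation_const (D := {P | h.IsDeformation P}) (fun P hP => hP) hmk hv β
        (by rw [hsum]; exact h1) (by rw [hsum]; exact h2) hx hy
    have c1 := hc hf hk
    have c2 := hc hg hk
    simp only [hβ, if_true, hkf, hkg, if_false, hfg.symm] at c1 c2
    exact ⟨c1, c2⟩
  have hu := hr.up_of_pos (f := f) (by rw [hf]; exact hv)
  apply hr.tight.pdir_ne_zero hu
  simp only [mom, pdir] at h0
  have k1 := key (h.flagDir g 0) (-(h.flagDir f 0)) (by ring) (by linarith)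
  have k2 := key ((hgt (h.flagDir g) : ℤ) : ℝ) (-((hgt (h.flagDir f) : ℤ) : ℝ))
    (by linarith) (by ring)
  refine Prod.ext ?_ ?_
  · exact neg_eq_zero.1 k1.2
  · exact neg_eq_zero.1 k2.2

/-- Any three directions in the plane satisfy Cramer's relation, whose coefficients are 2 × 2
determinants. A fourth flag has coefficient zero in it, so the determinants would vanish, against
`mom_ne_zero`. -/
theorem val_eq_three {v : h.V} (hv : 0 < h.ht v) : h.val v = 3 := by
  classical
  refine le_antisymm ?_ (hr.three_le_val v)
  by_contra hc
  push Not at hc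
  obtain ⟨s, hs, hcard⟩ := Finset.exists_subset_card_eq (Nat.succ_le_of_lt hc)
  obtain ⟨f, g, k, m, hfg, hfk, hfm, hgk, hgm, hkm, rfl⟩ := Finset.card_eq_four.1 hcard
  have hb : ∀ x ∈ ({f, g, k, m} : Finset h.Flag), h.base x = v := fun x hx =>
    h.mem_flagsAt.1 (hs hx)
  set β : h.Flag → ℝ := fun x =>
    if x = f then mom (h.flagDir g) (pdir (h.flagDir k)) else
    if x = g then mom (h.flagDir k) (pdir (h.flagDir f)) else
    if x = k then mom (h.flagDir f) (pdir (h.flagDir g)) else 0 with hβ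
  have hsum : ∀ F : h.Flag → ℝ, ∑ x ∈ h.flagsAt v, β x * F x =
      mom (h.flagDir g) (pdir (h.flagDir k)) * F f + (mom (h.flagDir k) (pdir (h.flagDir f)) * F g +
        mom (h.flagDir f) (pdir (h.flagDir g)) * F k) := by
    intro F
    rw [← Finset.sum_subset (s₁ := {f, g, k})]
    · rw [Finset.sum_insert (by simp [hfg, hfk]), Finset.sum_pair hgk]
      simp [hβ, hfg.symm, hfk.symm, hgk.symm]
    · intro x hx
      refine hs ?_
      simp only [Finset.mem_insert, Finset.mem_singleton] at hx ⊢
      tauto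
    · intro x _ hx
      simp only [Finset.mem_insert, Finset.mem_singleton, not_or] at hx
      simp [hβ, hx.1, hx.2.1, hx.2.2]
  have hc := hr.relation_const (D := {P | h.IsDeformation P}) (fun P hP => hP) hmk hv β
    (by rw [hsum]; simp only [mom, pdir]; ring) (by rw [hsum]; simp only [mom, pdir]; ring)
    (hb k (by simp)) (hb m (by simp))
  simp only [hβ, hfk.symm, hgk.symm, if_false, if_true, hfm.symm, hgm.symm, hkm.symm] at hc
  exact hr.mom_ne_zero hmk hv (hb f (by simp)) (hb g (by simp)) hfg hc

end IsRigid

/-! ### Points on the curve -/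

namespace IsTight

variable (ht : h.IsTight)
include ht

/-- The face of an interior point of an edge contains the edge. -/
theorem inner_face {e : h.E} {s : Set.Ioo (0 : ℝ) 1} {i : Fin 3}
    (hi : h.eval (.inner e s) ∈ face i) (hL : h.eval (.inner e s) ∉ lineL) (b : Bool) :
    h.pos (h.base (.inl (e, b))) ∈ face i := by
  have hl := ht.len_pos e
  have hs0 := s.2.1
  have hs1 := s.2.2
  have hex : ∃ b, h.ht (h.base (.inl (e, b))) ≠ 0 := by
    by_contra hc
    push Not at hc
    have e1 := (ht.mem_lineL_iff _).2 (hc false)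
    have e2 := (ht.mem_lineL_iff _).2 (hc true)
    apply hL
    have hev : h.eval (.inner e s) = fun j => h.pos (h.src e) j + (s : ℝ) *
        (h.pos (h.tgt e) j - h.pos (h.src e) j) := by
      funext j
      simp only [eval]
      rw [h.affine e j]
      ring
    rw [hev]
    simp only [PuncturedGraph.base, lineL, Set.mem_ofPred_eq] at e1 e2 ⊢
    rw [e1.1, e1.2, e2.1, e2.2]
    exact ⟨rfl, rfl⟩
  obtain ⟨c, hc⟩ := hex
  obtain ⟨k, hk⟩ := ht.exists_face (h.base (.inl (e, c)))
  have h1 := mem_face_of_line hl hk (fun h0 => hc ((ht.mem_lineL_iff _).1 h0))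
    (fun _ h1 => ht.flag_line_mem e c h1.1 h1.2)
  have h2 : h.eval (.inner e s) ∈ face k := by
    cases c
    · exact h1.2 (s * h.len e) ⟨by positivity, by nlinarith⟩
    · have := h1.2 ((1 - s) * h.len e) ⟨mul_nonneg (by linarith) hl.le, by nlinarith⟩
      convert this using 1
      funext j
      simp only [eval, PuncturedGraph.base, flagDir, PuncturedGraph.flagVec, Pi.neg_apply]
      rw [h.affine e j]
      push_cast
      ring
  have hik := face_unique h2 hi hL
  subst hik
  have h3 := ht.opp_mem_face hk hc
  cases b <;> cases c
  · exact hk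
  · exact h3
  · exact h3
  · exact hk

theorem ray_face {l : h.Λ} {t : Set.Ioi (0 : ℝ)} {i : Fin 3}
    (hi : h.eval (.ray l t) ∈ face i) (hL : h.eval (.ray l t) ∉ lineL) :
    h.endDir l ∈ face i ∧ h.pos (h.root l) ∈ face i := by
  have t0 : (0 : ℝ) < t := t.2
  by_cases h0 : h.ht (h.root l) = 0
  · have e1 := (ht.mem_lineL_iff _).2 h0
    obtain ⟨k, hk⟩ := mem_surfaceX_iff_exists_face.1 (ht.endDir_mem l)
    have h2 : h.eval (.ray l t) ∈ face k := by
      have hX := ht.eval_mem (.ray l t)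
      refine mem_face_of_mem_plane ?_ hX
      have hp := mem_plane_of_mem_face (mem_face_of_mem_lineL e1 k)
      have hd := cast_mem_plane.2 (mem_plane_of_mem_face hk)
      simp only [eval]
      have a1 := hgt_line (h.pos (h.root l)) (fun j => (h.endDir l j : ℝ)) t
      have a2 := sid_line (h.pos (h.root l)) (fun j => (h.endDir l j : ℝ)) t
      fin_cases k
      · refine mem_plane_zero.2 ?_
        rw [a1, a2, mem_plane_zero.1 hp, mem_plane_zero.1 hd]
      · refine mem_plane_one.2 ?_
        rw [a1, a2, mem_plane_one.1 hp, mem_plane_one.1 hd]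
        ring
      · refine mem_plane_two.2 ?_
        rw [a2, mem_plane_two.1 hp, mem_plane_two.1 hd]
        ring
    have hik := face_unique h2 hi hL
    subst hik
    exact ⟨hk, mem_face_of_mem_lineL e1 k⟩
  · obtain ⟨k, hk⟩ := ht.exists_face (h.root l)
    have h1 := mem_face_of_line (T := t) t0 hk (fun hc => h0 ((ht.mem_lineL_iff _).1 hc))
      (fun _ h1 => ht.end_line_mem l h1.1)
    have h2 : h.eval (.ray l t) ∈ face k := h1.2 t ⟨t0.le, le_rfl⟩
    have hik := face_unique h2 hi hL
    subst hik
    exact ⟨ht.endDir_mem_face hk h0, hk⟩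

/-- The edge of a point in one of the first two faces, off `L`, is up unless it is contracted. -/
theorem inner_up {e : h.E} {s : Set.Ioo (0 : ℝ) 1} (hp : 0 < hgt (h.eval (.inner e s)))
    (hd : h.dir e ≠ 0) : h.Up (.inl e) := by
  refine ⟨hd, ?_⟩
  by_contra hc
  push Not at hc
  have hev : h.eval (.inner e s) = fun j => h.pos (h.src e) j + (s : ℝ) *
      (h.pos (h.tgt e) j - h.pos (h.src e) j) := by
    funext j
    simp only [eval]
    rw [h.affine e j]
    ring
  rw [hev] at hp
  have h1 : hgt (fun j => h.pos (h.src e) j + (s : ℝ) *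
      (h.pos (h.tgt e) j - h.pos (h.src e) j)) = (1 - s) * h.ht (h.src e) +
      s * h.ht (h.tgt e) := by
    simp only [TropicalMorphism.ht, hgt]
    ring
  rw [h1] at hp
  have a1 : (1 - (s : ℝ)) * h.ht (h.src e) ≤ 0 :=
    mul_nonpos_of_nonneg_of_nonpos (by linarith [s.2.2]) hc.1
  have a2 : (s : ℝ) * h.ht (h.tgt e) ≤ 0 :=
    mul_nonpos_of_nonneg_of_nonpos s.2.1.le hc.2
  linarith

theorem ray_up {l : h.Λ} {t : Set.Ioi (0 : ℝ)} (hp : 0 < hgt (h.eval (.ray l t))) :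
    h.Up (.inr l) := by
  have t0 : (0 : ℝ) < t := t.2
  by_contra hc
  have h1 : hgt (h.endDir l) < 0 := lt_of_le_of_ne (not_lt.1 hc) (ht.hgt_endDir_ne l)
  have h2 : h.ht (h.root l) ≤ 0 := by
    by_contra h2
    push Not at h2
    exact hc (ht.hgt_endDir_pos h2)
  have h3 := hgt_line (h.pos (h.root l)) (fun j => (h.endDir l j : ℝ)) t
  rw [hgt_cast] at h3
  have h4 : hgt (h.eval (.ray l t)) = h.ht (h.root l) + t * ((hgt (h.endDir l) : ℤ) : ℝ) := h3
  have h5 : (t : ℝ) * ((hgt (h.endDir l) : ℤ) : ℝ) < 0 :=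
    mul_neg_of_pos_of_neg t0 (by exact_mod_cast h1)
  linarith

/-- The doubtful case is a vertex over `q` with contracted edges only. If all vertices over `q` were
of this kind, they would form a set closed under adjacency, and an end rooted there would have
direction zero. -/
theorem exists_up_flag_through {q : Fin 3 → ℝ} (hq : q ∈ Set.range h.eval) (hp : 0 < hgt q) :
    ∃ f : h.Flag, h.Up (h.edgeOf f) ∧
      ∃ a : ℝ, q = fun j => h.pos (h.base f) j + a * (h.flagDir f j : ℝ) := by
  have vcase : ∀ v, h.pos v = q → ∃ f : h.Flag, h.Up (h.edgeOf f) ∧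
      ∃ a : ℝ, q = fun j => h.pos (h.base f) j + a * (h.flagDir f j : ℝ) := by
    intro v hv
    by_contra hc
    push Not at hc
    have h0 : ∀ f : h.Flag, h.pos (h.base f) = q → h.flagDir f = 0 := by
      intro f hf
      by_contra hne
      have hpos : 0 < h.ht (h.base f) := by
        unfold TropicalMorphism.ht
        rwa [hf]
      refine hc f (ht.up_of_ht_pos hpos fun hs => hne (flagDir_eq_zero_of_silent hpos.ne' hs)) 0 ?_
      rw [hf]
      funext j
      ring
    obtain ⟨l, hl⟩ := ht.exists_root_mem_of_closed (S := {w | h.pos w = q}) ⟨v, hv⟩ (by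
      intro e b hb
      have hb' : h.pos (h.base (.inl (e, b))) = q := hb
      show h.pos (h.base (.inl (e, !b))) = q
      rw [h.pos_opp' e b, h0 _ hb', hb']
      simp)
    have h1 : h.endDir l = 0 := h0 (.inr l) hl
    exact ht.hgt_endDir_ne l (by rw [h1, hgt_zero])
  obtain ⟨x, hx⟩ := hq
  rcases x with v | ⟨e, s⟩ | ⟨l, t⟩
  · exact vcase v hx
  · by_cases hd : h.dir e = 0
    · refine vcase (h.src e) ?_
      rw [← hx]
      funext j
      simp [eval, hd]
    · refine ⟨.inl (e, false), ht.inner_up (e := e) (s := s) (by rw [hx]; exact hp) hd,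
        s * h.len e, ?_⟩
      rw [← hx]
      rfl
  · refine ⟨.inr l, ht.ray_up (l := l) (t := t) (by rw [hx]; exact hp), t, ?_⟩
    rw [← hx]
    rfl

end IsTight

end TropicalMorphism

namespace TropicalMorphism

variable {h : TropicalMorphism}

/-! ### Generic configurations -/

variable (h) in
/-- A configuration is generic for a curve if every pair of incidence conditions satisfied by the
curve can be deformed in all directions. -/
def IsGenericFor {N : ℕ} (p : Fin N → Fin 3 → ℝ) : Prop :=
  -- Direction 0 means incidence with a vertex, the direction of a flag means incidence with a line.
  -- Two families are used so that one point can be required to meet the curve twice.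
  ∀ (b b' : Fin N → h.V) (w w' : Fin N → Fin 3 → ℤ),
    (∀ i, w i = 0 ∨ ∃ f, w i = h.flagDir f) → (∀ i, w' i = 0 ∨ ∃ f, w' i = h.flagDir f) →
    (∀ i, ∃ a : ℝ, proj (p i) = proj (h.pos (b i)) + a • pdir (w i)) →
    (∀ i, ∃ a : ℝ, proj (p i) = proj (h.pos (b' i)) + a • pdir (w' i)) →
    ∀ q : Fin N → ℝ × ℝ, ∃ P, h.IsDeformation P ∧ ∀ i,
      (∃ a : ℝ, q i = P (b i) + a • pdir (w i)) ∧ ∃ a : ℝ, q i = P (b' i) + a • pdir (w' i)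

variable (h) in
/-- The line spanned by a flag contains a point. -/
def Through (f : h.Flag) (q : Fin 3 → ℝ) : Prop :=
  ∃ a : ℝ, proj q = proj (h.pos (h.base f)) + a • pdir (h.flagDir f)

theorem sgn_mul_sgn (f : h.Flag) : h.sgn f * h.sgn f = 1 := by
  rcases f with ⟨e, _ | _⟩ | l <;> simp [sgn]

theorem IsDeformation.edgeMom_eq {P : h.V → ℝ × ℝ} (hP : h.IsDeformation P) (f : h.Flag) :
    h.edgeMom P (h.edgeOf f) = h.sgn f * mom (h.flagDir f) (P (h.base f)) := by
  rw [← hP.sgn_mul_edgeMom, ← mul_assoc, sgn_mul_sgn, one_mul]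

/-! ### Marked edges through a generic configuration -/

section Marked

variable {N : ℕ} {p : Fin N → Fin 3 → ℝ} {f : Fin N → h.Flag}

/-- The marked edges given by a choice of flags. -/
def flagMark (hf : ∀ i, h.Up (h.edgeOf (f i))) (i : Fin N) : h.UpEdge := ⟨h.edgeOf (f i), hf i⟩

/-- Moving the points prescribes the marked moments. The deformations found also preserve the second
family of incidences, and this set of deformations serves as `D` in `exists_potential`. -/
theorem IsGenericFor.exists_deformation (hg : h.IsGenericFor p) (ht : h.IsTight)
    (hf : ∀ i, h.Up (h.edgeOf (f i))) (hp : ∀ i, h.Through (f i) (p i))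
    {b' : Fin N → h.V} {w' : Fin N → Fin 3 → ℤ} (hw' : ∀ i, w' i = 0 ∨ ∃ f, w' i = h.flagDir f)
    (hp' : ∀ i, ∃ a : ℝ, proj (p i) = proj (h.pos (b' i)) + a • pdir (w' i))
    (r : Fin N → ℝ) :
    ∃ P ∈ {P : h.V → ℝ × ℝ | h.IsDeformation P ∧ ∀ i, ∃ q : ℝ × ℝ,
      (∃ a : ℝ, q = P (h.base (f i)) + a • pdir (h.flagDir (f i))) ∧
      ∃ a : ℝ, q = P (b' i) + a • pdir (w' i)}, ∀ i, h.edgeMom P (flagMark hf i).1 = r i := by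
  choose q hq using fun i => exists_mom_eq (ht.pdir_ne_zero (hf i)) (h.sgn (f i) * r i)
  obtain ⟨P, hP, hPq⟩ := hg (fun i => h.base (f i)) b' (fun i => h.flagDir (f i)) w'
    (fun i => Or.inr ⟨_, rfl⟩) hw' hp hp' q
  refine ⟨P, ⟨hP, fun i => ⟨q i, hPq i⟩⟩, fun i => ?_⟩
  obtain ⟨a, ha⟩ := (hPq i).1
  show h.edgeMom P (h.edgeOf (f i)) = r i
  rw [hP.edgeMom_eq, ← mom_add_smul_self _ _ a, ← ha, hq, ← mul_assoc, sgn_mul_sgn, one_mul]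

theorem IsGenericFor.exists_deformation' (hg : h.IsGenericFor p) (ht : h.IsTight)
    (hf : ∀ i, h.Up (h.edgeOf (f i))) (hp : ∀ i, h.Through (f i) (p i)) (r : Fin N → ℝ) :
    ∃ P, h.IsDeformation P ∧ ∀ i, h.edgeMom P (flagMark hf i).1 = r i := by
  obtain ⟨P, hP, h1⟩ := hg.exists_deformation ht hf hp (b' := fun i => h.base (f i))
    (w' := fun i => h.flagDir (f i)) (fun i => Or.inr ⟨_, rfl⟩) hp r
  exact ⟨P, hP.1, h1⟩

namespace IsRigid

variable {hf : ∀ i, h.Up (h.edgeOf (f i))} (hr : h.IsRigid (flagMark hf))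
  (hg : h.IsGenericFor p) (hp : ∀ i, h.Through (f i) (p i))
include hr

theorem mom_eq_zero {P : h.V → ℝ × ℝ} (hP : h.IsDeformation P)
    (hm : ∀ i, mom (h.flagDir (f i)) (P (h.base (f i))) = 0) {g : h.Flag}
    (hgu : h.Up (h.edgeOf g)) : mom (h.flagDir g) (P (h.base g)) = 0 := by
  have h1 := hr.eq_zero (hP.system_moments hr.tight) (fun i => by
    show h.edgeMom P (h.edgeOf (f i)) = 0
    rw [hP.edgeMom_eq, hm, mul_zero])
  have h2 : h.edgeMom P (h.edgeOf g) = 0 := congrFun h1 (.inl ⟨h.edgeOf g, hgu⟩)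
  rw [← hP.sgn_mul_edgeMom, h2, mul_zero]

include hg hp

theorem not_parallel {v : h.V} (hv : 0 < h.ht v) {Q : ℝ × ℝ} (hQ : Q ≠ 0)
    (hall : ∀ g, h.base g = v → mom (h.flagDir g) Q = 0) : False := by
  have h1 : 1 < (h.flagsAt v).card := by
    have := hr.three_le_val v
    unfold PuncturedGraph.val at this
    omega
  obtain ⟨g, hg1, g', hg2, hne⟩ := Finset.one_lt_card.1 h1
  have e1 := h.mem_flagsAt.1 hg1
  have e2 := h.mem_flagsAt.1 hg2
  exact hr.mom_ne_zero (hg.exists_deformation' hr.tight hf hp) hv e1 e2 hne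
    (mom_eq_zero_of_parallel hQ (hall g e1) (hall g' e2))

/-- If `p i` were a vertex, move it along its marked edge and keep the other points. All marked
moments stay zero, so by rigidity all up moments are zero, and every edge at `v` is parallel to the
displacement of `v`. -/
theorem pos_ne {i : Fin N} (hpi : 0 < hgt (p i)) (v : h.V) : h.pos v ≠ p i := by
  classical
  intro hv
  obtain ⟨P, hP, hPq⟩ := hg (fun j => h.base (f j)) (fun j => if j = i then v else h.base (f j))
    (fun j => h.flagDir (f j)) (fun j => if j = i then 0 else h.flagDir (f j))
    (fun j => Or.inr ⟨_, rfl⟩) (fun j => by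
      by_cases hj : j = i
      · exact Or.inl (if_pos hj)
      · exact Or.inr ⟨f j, if_neg hj⟩) hp (fun j => by
      by_cases hj : j = i
      · subst hj
        exact ⟨0, by simp [hv]⟩
      · simp only [hj, if_false]
        exact hp j)
    (Pi.single i (pdir (h.flagDir (f i))))
  have hm : ∀ j, mom (h.flagDir (f j)) (P (h.base (f j))) = 0 := by
    intro j
    obtain ⟨a, ha⟩ := (hPq j).1
    rw [← mom_add_smul_self _ _ a, ← ha]
    by_cases hj : j = i
    · subst hj
      rw [Pi.single_eq_same, mom_pdir_self]
    · rw [Pi.single_eq_of_ne hj]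
      simp [mom]
  have hPv : P v = pdir (h.flagDir (f i)) := by
    obtain ⟨a, ha⟩ := (hPq i).2
    rw [Pi.single_eq_same, if_pos rfl, if_pos rfl] at ha
    rw [ha]
    simp [pdir]
  have hv0 : 0 < h.ht v := by
    unfold ht
    rwa [hv]
  refine hr.not_parallel hg hp hv0 (hr.tight.pdir_ne_zero (hf i)) fun g hgv => ?_
  rw [← hPv, ← hgv]
  exact hr.mom_eq_zero hP hm (hr.up_of_pos (by rw [hgv]; exact hv0))

omit hr hg hp in
variable (h) in
/-- The edge of a flag lies in a face. -/
def _root_.TropicalX.TropicalMorphism.FlagInFace (i : Fin 3) : h.Flag → Prop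
  | .inl (e, b) => h.pos (h.base (.inl (e, b))) ∈ face i ∧ h.pos (h.base (.inl (e, !b))) ∈ face i
  | .inr l => h.endDir l ∈ face i

/-- Moving `p i` along its marked edge shows that a second edge through it is parallel to the first.
The two moments are then proportional on all deformations that keep both incidences, so
`exists_potential`, which needs both edges in one face, yields a potential jumping only across these
two edges. A nonzero level set has boundary and ends parallel to one direction, so all its edges are
parallel to it, which is impossible; the zero potential does not jump at all. -/
theorem edgeOf_eq {i : Fin N} {k : Fin 3} (hk : h.FlagInFace k (f i)) {g : h.Flag}
    (hgu : h.Up (h.edgeOf g)) (hgk : h.FlagInFace k g) (hgp : h.Through g (p i)) :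
    h.edgeOf g = h.edgeOf (f i) := by
  classical
  by_contra hne
  set b' : Fin N → h.V := fun j => if j = i then h.base g else h.base (f j) with hb'
  set w' : Fin N → Fin 3 → ℤ := fun j => if j = i then h.flagDir g else h.flagDir (f j) with hw'
  have hw1 : ∀ j, w' j = 0 ∨ ∃ f, w' j = h.flagDir f := by
    intro j
    by_cases hj : j = i
    · exact Or.inr ⟨g, if_pos hj⟩
    · exact Or.inr ⟨f j, if_neg hj⟩
  have hw2 : ∀ j, ∃ a : ℝ, proj (p j) = proj (h.pos (b' j)) + a • pdir (w' j) := by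
    intro j
    by_cases hj : j = i
    · subst hj
      simp only [hb', hw', if_true]
      exact hgp
    · simp only [hb', hw', hj, if_false]
      exact hp j
  have hpar : mom (h.flagDir g) (pdir (h.flagDir (f i))) = 0 := by
    obtain ⟨P, hP, hPq⟩ := hg (fun j => h.base (f j)) b' (fun j => h.flagDir (f j)) w'
      (fun j => Or.inr ⟨_, rfl⟩) hw1 hp hw2 (Pi.single i (pdir (h.flagDir (f i))))
    have hm : ∀ j, mom (h.flagDir (f j)) (P (h.base (f j))) = 0 := by
      intro j
      obtain ⟨a, ha⟩ := (hPq j).1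
      rw [← mom_add_smul_self _ _ a, ← ha]
      by_cases hj : j = i
      · subst hj
        rw [Pi.single_eq_same, mom_pdir_self]
      · rw [Pi.single_eq_of_ne hj]
        simp [mom]
    obtain ⟨a, ha⟩ := (hPq i).2
    rw [Pi.single_eq_same] at ha
    simp only [hb', hw', if_true] at ha
    rw [ha, mom_add_smul_self]
    exact hr.mom_eq_zero hP hm hgu
  have hpf := hr.tight.pdir_ne_zero (hf i)
  have hgf : g ≠ f i := fun hc => hne (by rw [hc])
  -- The ratio is computed in a coordinate where the direction of the marked edge does not vanish.
  obtain ⟨c, hc⟩ : ∃ c : ℝ, ∀ Q, mom (h.flagDir g) Q = c * mom (h.flagDir (f i)) Q := by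
    by_cases h0 : ((h.flagDir (f i) 0 : ℤ) : ℝ) = 0
    · have h1 : ((hgt (h.flagDir (f i)) : ℤ) : ℝ) ≠ 0 := fun h1 => hpf (Prod.ext h0 h1)
      refine ⟨((hgt (h.flagDir g) : ℤ) : ℝ) / ((hgt (h.flagDir (f i)) : ℤ) : ℝ), fun Q => ?_⟩
      simp only [mom, pdir, h0] at hpar ⊢
      have h2 : ((h.flagDir g 0 : ℤ) : ℝ) = 0 := by
        rcases mul_eq_zero.1 (by linarith : ((h.flagDir g 0 : ℤ) : ℝ) *
          ((hgt (h.flagDir (f i)) : ℤ) : ℝ) = 0) with h3 | h3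
        · exact h3
        · exact absurd h3 h1
      rw [h2]
      field_simp
      ring
    · refine ⟨((h.flagDir g 0 : ℤ) : ℝ) / ((h.flagDir (f i) 0 : ℤ) : ℝ), fun Q => ?_⟩
      simp only [mom, pdir] at hpar ⊢
      field_simp
      linear_combination Q.1 * hpar
  set γ : h.Flag → ℝ := fun x => if x = g then 1 else if x = f i then -c else 0 with hγ
  have hγne : ∀ x, γ x ≠ 0 → x = g ∨ x = f i := by
    intro x hx
    by_contra hn
    push Not at hn
    exact hx (by simp [hγ, hn.1, hn.2])
  have hγF : ∀ x, γ x ≠ 0 → h.FlagInFace k x := fun x hx => by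
    rcases hγne x hx with rfl | rfl
    · exact hgk
    · exact hk
  obtain ⟨pt, p1, p2, p3⟩ := hr.exists_potential (fun P hP => hP.1)
    (hg.exists_deformation hr.tight hf hp hw1 hw2) (i := k) (γ := γ)
    (fun x hx => by
      rcases hγne x hx with rfl | rfl
      · exact hgu
      · exact hf i)
    (fun e b hx => hγF _ hx) (fun l hx => hγF _ hx)
    (fun P hP => by
      obtain ⟨hP, hPq⟩ := hP
      obtain ⟨q, ⟨a, ha⟩, ⟨a', ha'⟩⟩ := hPq i
      simp only [hb', hw', if_true] at ha'
      rw [← Finset.sum_subset (Finset.subset_univ {g, f i}), Finset.sum_pair hgf]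
      · simp only [hγ, if_true, hgf.symm, if_false]
        rw [← mom_add_smul_self (h.flagDir (f i)) _ a, ← ha,
          ← mom_add_smul_self (h.flagDir g) _ a', ← ha', hc]
        ring
      · intro x _ hx
        simp only [Finset.mem_insert, Finset.mem_singleton, not_or] at hx
        simp [hγ, hx.1, hx.2])
  have hψ : ∀ x, γ x ≠ 0 → momHom (h.flagDir (f i)) (h.flagDir x) = 0 := by
    intro x hx
    rw [momHom_eq_zero]
    rcases hγne x hx with rfl | rfl
    · rw [mom_pdir_comm, hpar, neg_zero]
    · exact mom_pdir_self _
  have hzero : ∀ v, pt v = 0 := by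
    intro v
    by_contra hv
    have hpos : ∀ u, pt u = pt v → 0 < h.ht u := by
      intro u hu
      by_contra hcon
      rw [p1 u (not_lt.1 hcon)] at hu
      exact hv hu.symm
    have hl : ∀ l, h.root l ∈ {u | pt u = pt v} → momHom (h.flagDir (f i)) (h.endDir l) = 0 := by
      intro l hl
      refine hψ (.inr l) ?_
      rw [← p3 l (hr.tight.hgt_endDir_pos (hpos _ hl)), show pt (h.root l) = pt v from hl]
      exact hv
    refine hr.not_parallel hg hp (hpos v rfl) hpf fun x hx => ?_
    rw [mom_pdir_comm, neg_eq_zero, ← momHom_eq_zero]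
    rcases x with ⟨e, b⟩ | l
    · refine h.dir_eq_zero_of_boundary hr.tight.len_pos (S := {u | pt u = pt v}) _ ?_ hl
        (e := e) (b := b) (show pt _ = pt v by rw [hx])
      intro e b h1 h2
      have h3 := p2 e b (hr.up_of_pos (f := .inl (e, b)) (hpos _ h1))
      have h1' : pt (h.base (.inl (e, b))) = pt v := h1
      by_cases hx1 : γ (.inl (e, b)) = 0
      · by_cases hx2 : γ (.inl (e, !b)) = 0
        · rw [hx1, hx2, h1', sub_zero, sub_eq_zero] at h3
          exact absurd h3.symm h2
        · have := hψ _ hx2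
          rw [h.flagDir_opp, map_neg, neg_eq_zero] at this
          exact this
      · exact hψ _ hx1
    · exact hl l (show pt (h.root l) = pt v by rw [show h.root l = v from hx])
  have hγg : γ g = 1 := if_pos rfl
  rcases g with ⟨e, b⟩ | l
  · have h3 := p2 e b hgu
    have h4 : γ (.inl (e, !b)) = 0 := by
      by_contra hx
      rcases hγne _ hx with h5 | h5
      · simp at h5
      · exact hne (by rw [← h5]; rfl)
    rw [hzero, hzero, hγg, h4] at h3
    norm_num at h3
  · have h3 := p3 l hgu
    rw [hzero, hγg] at h3
    norm_num at h3

end IsRigid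

end Marked

/-! ### Points and flags -/

/-- The flag of an interior point of an edge. -/
theorem IsRigid.exists_flag_of_point {N : ℕ} {mk : Fin N → h.UpEdge} (hr : h.IsRigid mk)
    {x : h.Point} (hx : ∀ v, x ≠ .vertex v) (hpos : 0 < hgt (h.eval x)) :
    ∃ g : h.Flag, x ∈ h.closedEdge (h.edgeOf g) ∧ h.Up (h.edgeOf g) ∧
      h.Through g (h.eval x) ∧ ∀ k, h.eval x ∈ face k → h.FlagInFace k g := by
  have hL : h.eval x ∉ lineL := fun hc => hpos.ne' (mem_lineL.1 hc).1
  rcases x with v | ⟨e, s⟩ | ⟨l, t⟩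
  · exact absurd rfl (hx v)
  · refine ⟨.inl (e, false), Or.inr ⟨s, rfl⟩,
      hr.tight.inner_up hpos (hr.flagDir_ne_zero (.inl (e, false))),
      ⟨s * h.len e, proj_line _ _ _⟩, fun k hk => ⟨hr.tight.inner_face hk hL _,
        hr.tight.inner_face hk hL _⟩⟩
  · exact ⟨.inr l, Or.inr ⟨t, rfl⟩, hr.tight.ray_up hpos, ⟨t, proj_line _ _ _⟩,
      fun k hk => (hr.tight.ray_face hk hL).1⟩

theorem IsRigid.eq_of_mem_closedEdge {N : ℕ} {mk : Fin N → h.UpEdge} (hr : h.IsRigid mk)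
    {ε : h.Edge} {x y : h.Point} (hx : ∀ v, x ≠ .vertex v) (hy : ∀ v, y ≠ .vertex v)
    (hxe : x ∈ h.closedEdge ε) (hye : y ∈ h.closedEdge ε) (hxy : h.eval x = h.eval y) :
    x = y := by
  rcases ε with e | l
  · rcases hxe with hxe | ⟨s, rfl⟩
    · rcases hxe with rfl | rfl
      · exact absurd rfl (hx _)
      · exact absurd rfl (hx _)
    rcases hye with hye | ⟨s', rfl⟩
    · rcases hye with rfl | rfl
      · exact absurd rfl (hy _)
      · exact absurd rfl (hy _)
    obtain ⟨j, hj⟩ := Function.ne_iff.1 (hr.flagDir_ne_zero (.inl (e, false)))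
    have h1 := congrFun hxy j
    simp only [eval, add_right_inj] at h1
    have h2 : (h.dir e j : ℝ) ≠ 0 := by exact_mod_cast hj
    have h3 := mul_right_cancel₀ (hr.tight.len_pos e).ne' (mul_right_cancel₀ h2 h1)
    rw [Subtype.ext h3]
  · rcases hxe with rfl | ⟨s, rfl⟩
    · exact absurd rfl (hx _)
    rcases hye with rfl | ⟨s', rfl⟩
    · exact absurd rfl (hy _)
    obtain ⟨j, hj⟩ := Function.ne_iff.1 (hr.flagDir_ne_zero (.inr l))
    have h1 := congrFun hxy j
    simp only [eval, add_right_inj] at h1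
    have h2 : (h.endDir l j : ℝ) ≠ 0 := by exact_mod_cast hj
    rw [Subtype.ext (mul_right_cancel₀ h2 h1)]

variable (h) in
/-- The point of an edge at a positive distance from a flag. -/
def PointAt : h.Flag → ℝ → h.Point → Prop
  | .inl (e, false), a, x => ∃ s, x = .inner e s ∧ a = s * h.len e
  | .inl (e, true), a, x => ∃ s, x = .inner e s ∧ a = (1 - s) * h.len e
  | .inr l, a, x => ∃ t, x = .ray l t ∧ a = t

theorem PointAt.unique (hlen : ∀ e, 0 < h.len e) {f : h.Flag} {a : ℝ} {x y : h.Point}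
    (hx : h.PointAt f a x) (hy : h.PointAt f a y) : x = y := by
  rcases f with ⟨e, _ | _⟩ | l
  · obtain ⟨s, rfl, rfl⟩ := hx
    obtain ⟨s', rfl, h1⟩ := hy
    rw [Subtype.ext (mul_right_cancel₀ (hlen e).ne' h1)]
  · obtain ⟨s, rfl, rfl⟩ := hx
    obtain ⟨s', rfl, h1⟩ := hy
    rw [Subtype.ext (sub_right_injective (mul_right_cancel₀ (hlen e).ne' h1))]
  · obtain ⟨s, rfl, rfl⟩ := hx
    obtain ⟨s', rfl, h1⟩ := hy
    rw [Subtype.ext h1]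

theorem exists_pointAt (hlen : ∀ e, 0 < h.len e) {v : h.V} {ε : ℝ} {x : h.Point}
    (hx : x ∈ h.star v ε) : x = .vertex v ∨ ∃ f a, h.base f = v ∧ 0 < a ∧ h.PointAt f a x ∧
      h.eval x = fun j => h.pos v j + a * (h.flagDir f j : ℝ) := by
  rcases hx with (hx | ⟨e, s, rfl, ⟨rfl, -⟩ | ⟨rfl, -⟩⟩) | ⟨l, t, rfl, rfl, -⟩
  · exact Or.inl hx
  · exact Or.inr ⟨.inl (e, false), s * h.len e, rfl, mul_pos s.2.1 (hlen e), ⟨s, rfl, rfl⟩, rfl⟩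
  · refine Or.inr ⟨.inl (e, true), (1 - s) * h.len e, rfl,
      mul_pos (sub_pos.2 s.2.2) (hlen e), ⟨s, rfl, rfl⟩, ?_⟩
    funext j
    simp only [eval, flagDir, PuncturedGraph.flagVec, Pi.neg_apply]
    rw [h.affine e j]
    push_cast
    ring
  · exact Or.inr ⟨.inr l, t, rfl, t.2, ⟨t, rfl, rfl⟩, rfl⟩

/-- Different flags at `v` leave along nonparallel lines and none is contracted, so their images
meet only at `h.pos v`. The radius plays no role. -/
theorem IsRigid.isEmbeddingNear {N : ℕ} {mk : Fin N → h.UpEdge} (hr : h.IsRigid mk)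
    (hmk : ∀ r : Fin N → ℝ, ∃ P, h.IsDeformation P ∧ ∀ i, h.edgeMom P (mk i).1 = r i)
    {v : h.V} (hv : 0 < h.ht v) : h.IsEmbeddingNear v := by
  have ne : ∀ (f : h.Flag) (a : ℝ), 0 < a →
      h.pos v ≠ fun j => h.pos v j + a * (h.flagDir f j : ℝ) := by
    intro f a ha hc
    obtain ⟨j, hj⟩ := Function.ne_iff.1 (hr.flagDir_ne_zero f)
    have h1 := congrFun hc j
    have h2 : a * (h.flagDir f j : ℝ) = 0 := by linarith
    rcases mul_eq_zero.1 h2 with h3 | h3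
    · exact ha.ne' h3
    · exact hj (by exact_mod_cast h3)
  refine ⟨1, one_pos, fun x hx y hy hxy => ?_⟩
  rcases exists_pointAt hr.tight.len_pos hx with rfl | ⟨f, a, hf, ha, hfx, ex⟩
  · rcases exists_pointAt hr.tight.len_pos hy with rfl | ⟨g, c, hg, hc, hgy, ey⟩
    · rfl
    · exact absurd (hxy.trans ey) (ne g c hc)
  · rcases exists_pointAt hr.tight.len_pos hy with rfl | ⟨g, c, hg, hc, hgy, ey⟩
    · exact absurd (hxy.symm.trans ex) (ne f a ha)
    · rw [ex, ey] at hxy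
      have hfg : f = g := by
        by_contra hfg
        apply hr.mom_ne_zero hmk hv hf hg hfg
        have h1 := congrArg proj hxy
        rw [proj_line, proj_line, add_right_inj] at h1
        have h2 := congrArg (mom (h.flagDir f)) h1
        rw [mom_smul, mom_smul, mom_pdir_self, mul_zero] at h2
        exact (mul_eq_zero.1 h2.symm).resolve_left hc.ne'
      subst hfg
      obtain ⟨j, hj⟩ := Function.ne_iff.1 (hr.flagDir_ne_zero f)
      have h1 := congrFun hxy j
      have h2 : (h.flagDir f j : ℝ) ≠ 0 := by exact_mod_cast hj
      have h3 : a = c := mul_right_cancel₀ h2 (add_left_cancel h1)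
      subst h3
      exact hfx.unique hr.tight.len_pos hgy

/-- A tight curve through a generic configuration is rigid. -/
theorem IsTight.exists_isRigid (ht : h.IsTight) {N : ℕ} {p : Fin N → Fin 3 → ℝ}
    (hg : h.IsGenericFor p) (hp : ∀ i, p i ∈ Set.range h.eval) (hpos : ∀ i, 0 < hgt (p i))
    (hN : (N : ℤ) = Nat.card {l : h.Λ // h.Up (.inr l)} - h.tropEulerChar) :
    ∃ mk : Fin N → h.UpEdge, h.IsRigid mk ∧
      (∀ r : Fin N → ℝ, ∃ P, h.IsDeformation P ∧ ∀ i, h.edgeMom P (mk i).1 = r i) ∧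
      ∀ i, ∃ f, ∃ a : ℝ, (mk i).1 = h.edgeOf f ∧
        p i = fun j => h.pos (h.base f) j + a * (h.flagDir f j : ℝ) := by
  classical
  choose f hf a ha using fun i => ht.exists_up_flag_through (hp i) (hpos i)
  have hm := hg.exists_deformation' ht hf (fun i => ⟨a i, by rw [ha i, proj_line]⟩)
  exact ⟨_, ht.isRigid hm (by rw [hN, Nat.card_eq_fintype_card]), hm,
    fun i => ⟨f i, a i, rfl, ha i⟩⟩

/-- The fibre over a point of a generic configuration is an interior point of an edge. -/
theorem IsTight.exists_fiber_eq (ht : h.IsTight) {N : ℕ} {p : Fin N → Fin 3 → ℝ}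
    (hg : h.IsGenericFor p) (hp : ∀ i, p i ∈ Set.range h.eval) (hpos : ∀ i, 0 < hgt (p i))
    (hN : (N : ℤ) = Nat.card {l : h.Λ // h.Up (.inr l)} - h.tropEulerChar) (i : Fin N) :
    ∃ x : h.Point, h.eval ⁻¹' {p i} = {x} ∧ ∀ v : h.V, x ≠ .vertex v := by
  classical
  choose f hf a ha using fun i => ht.exists_up_flag_through (hp i) (hpos i)
  have rigid : ∀ (f : Fin N → h.Flag) (hf : ∀ i, h.Up (h.edgeOf (f i))),
      (∀ i, h.Through (f i) (p i)) → h.IsRigid (flagMark hf) := by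
    intro f hf hfp
    exact ht.isRigid (hg.exists_deformation' ht hf hfp) (by rw [hN, Nat.card_eq_fintype_card])
  have hfp : ∀ i, h.Through (f i) (p i) := fun i => ⟨a i, by rw [ha i, proj_line]⟩
  have hr := rigid f hf hfp
  have hnv : ∀ x, h.eval x = p i → ∀ v, x ≠ .vertex v := by
    rintro x hx v rfl
    exact hr.pos_ne hg hfp (hpos i) v hx
  obtain ⟨x, hx⟩ := hp i
  refine ⟨x, Set.eq_singleton_iff_unique_mem.2 ⟨hx, fun y hy => ?_⟩, hnv x hx⟩
  have hy : h.eval y = p i := hy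
  obtain ⟨g, g1, g2, g3, g4⟩ := hr.exists_flag_of_point (hnv x hx) (by rw [hx]; exact hpos i)
  obtain ⟨g', g1', g2', g3', g4'⟩ := hr.exists_flag_of_point (hnv y hy) (by rw [hy]; exact hpos i)
  rw [hx] at g3 g4
  rw [hy] at g3' g4'
  obtain ⟨k, hk⟩ := mem_surfaceX_iff_exists_face.1 (hx ▸ ht.eval_mem x)
  -- Rigidity holds for every choice of up flags through the points, so the edge of `x` may be
  -- marked in place of `f i`; the edge of `y` must then be the same.
  have hF : ∀ j, h.Up (h.edgeOf (Function.update f i g j)) := by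
    intro j
    by_cases hj : j = i
    · subst hj
      rwa [Function.update_self]
    · rw [Function.update_of_ne hj]
      exact hf j
  have hFp : ∀ j, h.Through (Function.update f i g j) (p j) := by
    intro j
    by_cases hj : j = i
    · subst hj
      rwa [Function.update_self]
    · rw [Function.update_of_ne hj]
      exact hfp j
  have hr' := rigid _ hF hFp
  have he := hr'.edgeOf_eq hg hFp (i := i) (k := k)
    (by rw [Function.update_self]; exact g4 k hk) g2' (g4' k hk) g3'
  rw [Function.update_self] at he
  rw [he] at g1'
  exact hr.eq_of_mem_closedEdge (hnv y hy) (hnv x hx) g1' g1 (hy.trans hx.symm)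

end TropicalMorphism

/-! ### Intersection multiplicities of balanced fans -/

open Classical in
/-- The multiplicity of a vector of the third plane. -/
def tau (v : Fin 3 → ℤ) : ℤ := if v ∈ plane 2 then v 1 - v 0 else 0

theorem tau_neg (v : Fin 3 → ℤ) : tau (-v) = -tau v := by
  have h1 : -v ∈ (plane 2 : Set (Fin 3 → ℤ)) ↔ v ∈ (plane 2 : Set (Fin 3 → ℤ)) :=
    ⟨fun hv => by simpa using neg_mem_plane hv, neg_mem_plane⟩
  unfold tau
  by_cases h2 : v ∈ (plane 2 : Set (Fin 3 → ℤ))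
  · rw [if_pos h2, if_pos (h1.2 h2)]
    simp only [Pi.neg_apply]
    ring
  · rw [if_neg h2, if_neg (mt h1.1 h2), neg_zero]

theorem vecMult_of_mem_face_zero {v : Fin 3 → ℤ} (hv : v ∈ face 0) : vecMult v = v 0 - v 2 := by
  obtain ⟨h1, h2⟩ := hv
  unfold vecMult tropPoly
  simp only [Pi.neg_apply]
  grind

theorem vecMult_of_mem_face_two {v : Fin 3 → ℤ} (hv : v ∈ face 2) : vecMult v = tau v := by
  have h0 : v ∈ (plane 2 : Set (Fin 3 → ℤ)) := mem_plane_of_mem_face hv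
  obtain ⟨h1, h2⟩ := hv
  unfold tau
  rw [if_pos h0]
  unfold vecMult tropPoly
  simp only [Pi.neg_apply]
  grind

theorem hgt_of_mem_plane_two {v : Fin 3 → ℤ} (hv : v ∈ plane 2) : hgt v = -2 * tau v := by
  have h1 : v 1 = v 2 := hv
  unfold tau
  rw [if_pos hv]
  unfold hgt
  rw [← h1]
  ring

theorem mem_face_two_of_hgt_neg {v : Fin 3 → ℤ} (hv : v ∈ surfaceX) (h0 : hgt v < 0) :
    v ∈ face 2 := by
  rcases mem_surfaceX.1 hv with h1 | h1 | h1
  · linarith [h1.2]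
  · linarith [h1.2]
  · exact mem_face_two.2 h1

theorem hgt_eq_of_neg {v : Fin 3 → ℤ} (hv : v ∈ surfaceX) (h0 : hgt v < 0) :
    hgt v = -2 * tau v :=
  hgt_of_mem_plane_two (mem_plane_of_mem_face (mem_face_two_of_hgt_neg hv h0))

theorem tau_eq_zero {v : Fin 3 → ℤ} (hv : v ∈ surfaceX) (h0 : 0 ≤ hgt v) : tau v = 0 := by
  by_cases h1 : v ∈ (plane 2 : Set (Fin 3 → ℤ))
  · have h2 := hgt_of_mem_plane_two h1
    have h3 := (mem_face_two.1 (mem_face_of_mem_plane h1 hv)).2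
    linarith
  · exact if_neg h1

theorem sum_map_filter {α M : Type*} [AddCommMonoid M] (s : Multiset α) (q : α → Prop)
    [DecidablePred q] (g : α → M) :
    ((s.filter q).map g).sum = (s.map fun v => if q v then g v else 0).sum := by
  induction s using Multiset.induction with
  | empty => rfl
  | cons a s ih =>
    by_cases ha : q a
    · rw [Multiset.filter_cons_of_pos _ ha, Multiset.map_cons, Multiset.map_cons,
        Multiset.sum_cons, Multiset.sum_cons, ih, if_pos ha]
    · rw [Multiset.filter_cons_of_neg _ ha, Multiset.map_cons, Multiset.sum_cons, ih, if_neg ha,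
        zero_add]

/-- On vectors of X the multiplicity in σ₁ and `tau` differ by the linear function `v 0 - v 2`,
which sums to zero over a balanced fan; for a fan in one plane, `tau` itself is linear or zero. In
contrast to `fanMult`, `tau` is a sum over single vectors and odd, so it is conserved when edges are
contracted. -/
theorem fanMult_eq_sum_tau {s : Multiset (Fin 3 → ℤ)} (hs : s.sum = 0)
    (hX : (∀ v ∈ s, v ∈ surfaceX) ∨ ∃ i, ∀ v ∈ s, v ∈ plane i) :
    fanMult s = (s.map tau).sum := by
  classical
  unfold fanMult
  split_ifs with hp
  · obtain ⟨i, hi⟩ := hp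
    have h0 : ∀ v ∈ s, (i = 2 → tau v = v 1 - v 0) ∧ (i ≠ 2 → tau v = 0) := by
      intro v hv
      have hvi := hi v hv
      constructor
      · rintro rfl
        exact if_pos hvi
      · intro h2
        by_cases h3 : v ∈ (plane 2 : Set (Fin 3 → ℤ))
        · have h4 : v 1 = v 2 := h3
          rw [tau, if_pos h3]
          fin_cases i
          · have h5 : v 0 = v 1 := hvi
            omega
          · have h5 : v 0 = v 2 := hvi
            omega
          · exact absurd rfl h2
        · exact if_neg h3
    by_cases h2 : i = 2
    · rw [Multiset.map_congr rfl (g := fun v => (coordHom 1 - coordHom 0) v)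
        (fun v hv => (h0 v hv).1 h2)]
      have := map_multiset_sum (coordHom 1 - coordHom 0) s
      rw [hs, map_zero] at this
      exact this
    · rw [Multiset.map_congr rfl (g := fun _ => (0 : ℤ)) (fun v hv => (h0 v hv).2 h2)]
      simp
  · have hX := hX.resolve_right hp
    rw [sum_map_filter, Multiset.map_congr rfl (g := fun v => tau v + (coordHom 0 - coordHom 2) v),
      Multiset.sum_map_add]
    · have := map_multiset_sum (coordHom 0 - coordHom 2) s
      rw [hs, map_zero] at this
      rw [← this, add_zero]
    · intro v hv
      have e1 : (coordHom 0 - coordHom 2) v = v 0 - v 2 := rfl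
      rw [e1]
      rcases mem_surfaceX_iff_exists_face.1 (hX v hv) with ⟨i, hi⟩
      unfold tau
      fin_cases i
      · have hi : v ∈ face 0 := hi
        rw [if_pos hi, vecMult_of_mem_face_zero hi]
        split_ifs with h2
        · have a1 : v 0 = v 1 := hi.1
          omega
        · ring
      · have hi : v ∈ face 1 := hi
        have a1 : v 0 = v 2 := hi.1
        have e3 : (if v ∈ face 0 then vecMult v else 0) = 0 := by
          split_ifs with h2
          · rw [vecMult_of_mem_face_zero h2]
            omega
          · rfl
        rw [e3]
        split_ifs with h2
        · have a2 : v 1 = v 2 := h2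
          omega
        · omega
      · have hi : v ∈ face 2 := hi
        have a1 : v 1 = v 2 := hi.1
        rw [if_pos (mem_plane_of_mem_face hi : v ∈ plane 2)]
        split_ifs with h2
        · rw [vecMult_of_mem_face_zero h2]
          have a2 : v 0 = v 1 := h2.1
          omega
        · omega

namespace TropicalMorphism

variable {h : TropicalMorphism}

open Classical in
theorem sum_newtonFan {M : Type*} [AddCommMonoid M] (g : (Fin 3 → ℤ) → M) :
    (h.newtonFan.map g).sum = ∑ l, g (h.endDir l) := by
  rw [newtonFan, Multiset.map_map]
  rfl

theorem mem_newtonFan (l : h.Λ) : h.endDir l ∈ h.newtonFan :=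
  Multiset.mem_map.2 ⟨l, Finset.mem_univ _, rfl⟩

theorem card_newtonFan : Multiset.card h.newtonFan = Fintype.card h.Λ := by
  rw [newtonFan, Multiset.card_map]
  rfl

theorem tau_endDir {l : h.Λ} (hX : ∀ v ∈ h.newtonFan, v ∈ surfaceX)
    (hm : ∀ v ∈ fanInFace h.newtonFan 2, vecMult v = 1) (hl : hgt (h.endDir l) < 0) :
    tau (h.endDir l) = 1 := by
  classical
  have h1 := mem_face_two_of_hgt_neg (hX _ (mem_newtonFan l)) hl
  rw [← vecMult_of_mem_face_two h1]
  exact hm _ (Multiset.mem_filter.2 ⟨mem_newtonFan l, h1⟩)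

/-- The multiplicity of the Newton fan is the number of ends in the third face. -/
theorem fanMult_newtonFan (hs : h.newtonFan.sum = 0) (hX : ∀ v ∈ h.newtonFan, v ∈ surfaceX)
    (hm : ∀ v ∈ fanInFace h.newtonFan 2, vecMult v = 1) :
    fanMult h.newtonFan = Nat.card {l : h.Λ // hgt (h.endDir l) < 0} := by
  classical
  rw [fanMult_eq_sum_tau hs (Or.inl hX), sum_newtonFan, Nat.card_eq_fintype_card,
    Fintype.card_subtype, Finset.card_eq_sum_ones, Finset.sum_filter]
  push_cast
  refine Finset.sum_congr rfl fun l _ => ?_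
  split_ifs with hl
  · exact tau_endDir hX hm hl
  · exact tau_eq_zero (hX _ (mem_newtonFan l)) (not_lt.1 hl)

theorem card_up_end (hL : ∀ v ∈ h.newtonFan, v ∉ lineL) (hX : ∀ v ∈ h.newtonFan, v ∈ surfaceX) :
    Nat.card {l : h.Λ // h.Up (.inr l)} + Nat.card {l : h.Λ // hgt (h.endDir l) < 0} =
      Multiset.card h.newtonFan := by
  classical
  rw [card_newtonFan, Nat.card_eq_fintype_card, Nat.card_eq_fintype_card]
  have h1 : ∀ l, hgt (h.endDir l) < 0 ↔ ¬ h.Up (.inr l) := by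
    intro l
    show _ ↔ ¬ 0 < hgt (h.endDir l)
    have h2 : hgt (h.endDir l) ≠ 0 := fun hc => hL _ (mem_newtonFan l)
      ((mem_lineL_iff_of_mem_surfaceX (hX _ (mem_newtonFan l))).2 hc)
    omega
  have h2 := Fintype.card_subtype_compl (fun l : h.Λ => h.Up (.inr l))
  have h3 : Fintype.card {l : h.Λ // hgt (h.endDir l) < 0} =
      Fintype.card {l : h.Λ // ¬ h.Up (.inr l)} :=
    Fintype.card_congr (Equiv.subtypeEquivRight h1)
  have h4 := Fintype.card_subtype_le (fun l : h.Λ => h.Up (.inr l))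
  omega

end TropicalMorphism

namespace TropicalMorphism

variable (h : TropicalMorphism)

/-! ### Contraction of the degenerate edges -/

/-- Two vertices are glued if they are joined by a degenerate edge. -/
def Glued (u v : h.V) : Prop := ∃ e, h.len e = 0 ∧ h.src e = u ∧ h.tgt e = v

/-- The vertices of the contracted curve. -/
def Cluster : Type := Quot h.Glued

/-- The cluster of a vertex. -/
def cluster (v : h.V) : h.Cluster := Quot.mk _ v

instance : Finite h.Cluster := inferInstanceAs (Finite (Quot _))

instance : Fintype h.Cluster := Fintype.ofFinite _

theorem exists_cluster_eq (T : h.Cluster) : ∃ v, h.cluster v = T := Quot.exists_rep T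

theorem cluster_tgt {e : h.E} (he : h.len e = 0) : h.cluster (h.tgt e) = h.cluster (h.src e) :=
  (Quot.sound ⟨e, he, rfl, rfl⟩).symm

/-- The graph obtained by contraction of the degenerate edges. -/
def contractGraph : PuncturedGraph where
  V := h.Cluster
  E := {e : h.E // h.len e ≠ 0}
  Λ := h.Λ
  fintypeE := Fintype.ofFinite _
  src e := h.cluster (h.src e.1)
  tgt e := h.cluster (h.tgt e.1)
  root l := h.cluster (h.root l)

/-- The flags of the contracted graph are flags of the original graph. -/
def liftFlag : h.contractGraph.Flag → h.Flag
  | .inl (e, b) => .inl (e.1, b)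
  | .inr l => .inr l

-- Both flags of a degenerate edge belong to the same cluster; all other flags are the flags of the
-- contracted graph.
open Classical in
theorem sum_cluster {M : Type*} [AddCommMonoid M] (g : h.Flag → M) (T : h.Cluster) :
    ∑ v with h.cluster v = T, ∑ f ∈ h.flagsAt v, g f =
      ∑ f ∈ h.contractGraph.flagsAt T, g (h.liftFlag f) +
        ∑ e with h.len e = 0 ∧ h.cluster (h.src e) = T,
          (g (.inl (e, false)) + g (.inl (e, true))) := by
  have h0 : h.contractGraph.flagsAt T =
      Finset.univ.filter fun f => h.contractGraph.base f = T := rfl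
  rw [h.sum_sum_flagsAt (fun v => h.cluster v = T), Finset.sum_filter, h.sum_flag,
    h0, Finset.sum_filter, h.contractGraph.sum_flag, Finset.sum_filter]
  set F : h.E → M := fun e =>
    (if h.cluster (h.base (.inl (e, false))) = T then g (.inl (e, false)) else 0) +
      (if h.cluster (h.base (.inl (e, true))) = T then g (.inl (e, true)) else 0) with hF
  have h1 : ∑ e, F e = ∑ e : h.contractGraph.E, F e.1 + ∑ e, if h.len e = 0 then F e else 0 := by
    rw [← Finset.sum_filter_add_sum_filter_not _ (fun e => h.len e ≠ 0), ← Finset.sum_filter]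
    congr 1
    · exact Finset.sum_subtype (p := fun e => h.len e ≠ 0) _ (by simp) F
    · simp only [not_not]
  have h3 : ∀ e : h.E, (if h.len e = 0 ∧ h.cluster (h.src e) = T then
      g (.inl (e, false)) + g (.inl (e, true)) else 0) = if h.len e = 0 then F e else 0 := by
    intro e
    by_cases he : h.len e = 0
    · have h4 : h.cluster (h.base (.inl (e, true))) = h.cluster (h.src e) := h.cluster_tgt he
      have h5 : h.cluster (h.base (.inl (e, false))) = h.cluster (h.src e) := rfl
      simp only [hF]
      rw [h4, h5]
      by_cases hT : h.cluster (h.src e) = T <;> simp [he, hT]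
    · simp [he]
  rw [h1, Finset.sum_congr rfl (fun e _ => h3 e), add_right_comm]
  rfl

open Classical in
/-- The number of vertices of a cluster. -/
def clusterCard (T : h.Cluster) : ℕ := (Finset.univ.filter fun v => h.cluster v = T).card

open Classical in
/-- The number of degenerate edges in a cluster. -/
def clusterEdges (T : h.Cluster) : ℕ :=
  (Finset.univ.filter fun e => h.len e = 0 ∧ h.cluster (h.src e) = T).card

open Classical in
/-- The genus of the contraction of a cluster. -/
def clusterGenus (T : h.Cluster) : ℕ :=
  -- The first Betti number of the cluster plus its genera. The subtraction does not truncate, by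
  -- `clusterCard_le`.
  h.clusterEdges T + 1 + (∑ v with h.cluster v = T, h.genus v) - h.clusterCard T

open Classical in
/-- The graph of the degenerate edges in a cluster. -/
def clusterGraph (T : h.Cluster) : PuncturedGraph where
  V := {v : h.V // h.cluster v = T}
  E := {e : h.E // h.len e = 0 ∧ h.cluster (h.src e) = T}
  Λ := Empty
  src e := ⟨h.src e.1, e.2.2⟩
  tgt e := ⟨h.tgt e.1, (h.cluster_tgt e.2.1).trans e.2.2⟩
  root := Empty.elim

/-- The degenerate edges of a cluster form a connected graph, whose Euler characteristic is at most
1. -/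
theorem clusterCard_le (T : h.Cluster) : h.clusterCard T ≤ h.clusterEdges T + 1 := by
  classical
  have hconn : ∀ u v, Relation.EqvGen h.Glued u v → ∀ (hu : h.cluster u = T)
      (hv : h.cluster v = T),
      (h.clusterGraph T).component ⟨u, hu⟩ = (h.clusterGraph T).component ⟨v, hv⟩ := by
    intro u v huv
    induction huv with
    | rel u v huv =>
      obtain ⟨e, he, rfl, rfl⟩ := huv
      exact fun hu hv => Quot.sound ⟨⟨e, he, hu⟩, rfl, rfl⟩
    | refl u => exact fun _ _ => rfl
    | symm u v _ ih => exact fun hu hv => (ih hv hu).symm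
    | trans u v w huv _ ih1 ih2 =>
      intro hu hw
      have hv : h.cluster v = T := (Quot.eqvGen_sound huv).symm.trans hu
      exact (ih1 hu hv).trans (ih2 hv hw)
  have hsub : Subsingleton (h.clusterGraph T).Component := by
    refine ⟨fun a b => ?_⟩
    obtain ⟨⟨u, hu⟩, rfl⟩ := Quot.exists_rep a
    obtain ⟨⟨v, hv⟩, rfl⟩ := Quot.exists_rep b
    exact hconn u v (Quot.eqvGen_exact (hu.trans hv.symm)) hu hv
  have h1 := (h.clusterGraph T).eulerChar_eq
  have h2 : (h.clusterGraph T).b0 ≤ 1 := Finite.card_le_one_iff_subsingleton.2 hsub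
  have h3 : Fintype.card (h.clusterGraph T).V = h.clusterCard T := by
    rw [← Nat.card_eq_fintype_card]
    show Nat.card {v : h.V // h.cluster v = T} = _
    rw [Nat.card_eq_fintype_card, Fintype.card_subtype, clusterCard]
  have h4 : Fintype.card (h.clusterGraph T).E = h.clusterEdges T := by
    rw [← Nat.card_eq_fintype_card]
    show Nat.card {e : h.E // h.len e = 0 ∧ h.cluster (h.src e) = T} = _
    rw [Nat.card_eq_fintype_card, Fintype.card_subtype, clusterEdges]
  unfold PuncturedGraph.eulerChar at h1
  omega

open Classical in
theorem clusterGenus_cast (T : h.Cluster) : (h.clusterGenus T : ℤ) =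
    h.clusterEdges T + 1 + (∑ v with h.cluster v = T, (h.genus v : ℤ)) - h.clusterCard T := by
  have h1 := h.clusterCard_le T
  unfold clusterGenus
  rw [Nat.cast_sub (by omega)]
  push_cast
  ring

-- The quantity val - 2 + 2 · genus is additive under contraction: the flags lost with degenerate
-- edges are compensated by the Betti number in the genus. Each stable vertex contributes at least
-- 1, so the contracted curve is stable.
open Classical in
theorem sum_val_cluster (T : h.Cluster) :
    ∑ v with h.cluster v = T, ((h.val v : ℤ) - 2 + 2 * h.genus v) =
      h.contractGraph.val T - 2 + 2 * h.clusterGenus T := by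
  have h1 := h.sum_cluster (fun _ => (1 : ℤ)) T
  simp only [Finset.sum_const, nsmul_eq_mul, mul_one] at h1
  rw [Finset.sum_add_distrib, Finset.sum_sub_distrib, ← Finset.mul_sum, clusterGenus_cast]
  simp only [Finset.sum_const, nsmul_eq_mul]
  simp only [PuncturedGraph.val, clusterCard, clusterEdges] at *
  rw [h1]
  ring

theorem three_le_val_contract (T : h.Cluster) :
    3 ≤ h.contractGraph.val T + 2 * h.clusterGenus T := by
  classical
  have h1 := h.sum_val_cluster T
  obtain ⟨v, hv⟩ := h.exists_cluster_eq T
  have h2 : (1 : ℤ) ≤ ∑ v with h.cluster v = T, ((h.val v : ℤ) - 2 + 2 * h.genus v) := by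
    refine le_trans ?_ (Finset.single_le_sum (f := fun v => (h.val v : ℤ) - 2 + 2 * h.genus v)
      (fun w _ => ?_) (Finset.mem_filter.2 ⟨Finset.mem_univ v, hv⟩))
    · have := TropicalMorphism.three_le_val (h := h) v
      show (1 : ℤ) ≤ (h.val v : ℤ) - 2 + 2 * h.genus v
      omega
    · have := TropicalMorphism.three_le_val (h := h) w
      show (0 : ℤ) ≤ (h.val w : ℤ) - 2 + 2 * h.genus w
      omega
  omega

theorem pos_eq_of_glued {u v : h.V} (huv : h.Glued u v) : h.pos u = h.pos v := by
  obtain ⟨e, he, rfl, rfl⟩ := huv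
  funext i
  rw [h.affine e i, he]
  ring

/-- The curve obtained by contraction of the degenerate edges. -/
def contract : TropicalMorphism where
  toPuncturedGraph := h.contractGraph
  len e := h.len e.1
  len_nonneg e := h.len_nonneg e.1
  genus := h.clusterGenus
  no_degenerate_loop e he := absurd he e.2
  tame e _ := by
    intro hc
    have : ∀ u v, ¬ (∃ e' : h.contractGraph.E, h.len e'.1 = 0 ∧
        ((h.contractGraph.src e' = u ∧ h.contractGraph.tgt e' = v) ∨
          (h.contractGraph.src e' = v ∧ h.contractGraph.tgt e' = u))) := by
      rintro u v ⟨e', he', -⟩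
      exact e'.2 he'
    cases hc with
    | single h1 => exact this _ _ h1
    | tail _ h1 => exact this _ _ h1
  stable T := by
    have := h.three_le_val_contract T
    constructor <;> intro h1 <;> omega
  pos := Quot.lift h.pos fun _ _ => h.pos_eq_of_glued
  dir e := h.dir e.1
  endDir := h.endDir
  affine e i := h.affine e.1 i
  balanced T := by
    classical
    have h1 := h.sum_cluster h.flagDir T
    have h2 : ∀ v, ∑ f ∈ h.flagsAt v, h.flagDir f = 0 := h.balanced
    rw [Finset.sum_eq_zero (fun v _ => h2 v)] at h1
    rw [Finset.sum_eq_zero (s := Finset.univ.filter fun e => h.len e = 0 ∧ h.cluster (h.src e) = T)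
      (fun e _ => by simp [flagDir, PuncturedGraph.flagVec]), add_zero] at h1
    rw [h1]
    refine Finset.sum_congr rfl fun f _ => ?_
    rcases f with ⟨e, _ | _⟩ | l <;> rfl

theorem contract_newtonFan : h.contract.newtonFan = h.newtonFan := by
  show Multiset.map h.endDir _ = Multiset.map h.endDir _
  congr

theorem contract_tropEulerChar : h.contract.tropEulerChar = h.tropEulerChar := by
  classical
  unfold TropicalCurve.tropEulerChar
  rw [PuncturedGraph.eulerChar_eq, PuncturedGraph.eulerChar_eq]
  have h1 : ∑ T : h.contract.V, (h.contract.genus T : ℤ) =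
      ∑ T : h.Cluster, (h.clusterGenus T : ℤ) := by
    refine Fintype.sum_equiv (Equiv.refl _) _ _ fun _ => rfl
  have h0 : Fintype.card h.contract.V = Fintype.card h.Cluster := Fintype.card_congr (Equiv.refl _)
  have h2 : ∑ T : h.Cluster, (h.clusterCard T : ℤ) = Fintype.card h.V := by
    unfold clusterCard
    have := Finset.card_eq_sum_card_fiberwise (f := h.cluster) (s := Finset.univ)
      (t := Finset.univ) (fun _ _ => by simp)
    rw [← Finset.card_univ, this]
    push_cast
    rfl
  have h3 : ∑ T : h.Cluster, ∑ v with h.cluster v = T, (h.genus v : ℤ) = ∑ v, (h.genus v : ℤ) :=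
    Finset.sum_fiberwise _ _ _
  have h4 : ∑ T : h.Cluster, (h.clusterEdges T : ℤ) =
      (Finset.univ.filter fun e => h.len e = 0).card := by
    unfold clusterEdges
    have := Finset.card_eq_sum_card_fiberwise (f := fun e => h.cluster (h.src e))
      (s := Finset.univ.filter fun e => h.len e = 0) (t := Finset.univ) (fun _ _ => by simp)
    rw [this]
    push_cast
    refine Finset.sum_congr rfl fun T _ => ?_
    rw [Finset.filter_filter]
  have h5 : Fintype.card h.contract.E + (Finset.univ.filter fun e => h.len e = 0).card =
      Fintype.card h.E := by
    have h6 : Fintype.card h.contract.E = (Finset.univ.filter fun e => ¬ h.len e = 0).card := by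
      rw [← Nat.card_eq_fintype_card, ← Fintype.card_subtype, ← Nat.card_eq_fintype_card]
      rfl
    rw [h6, add_comm, Finset.card_filter_add_card_filter_not, Finset.card_univ]
  rw [h1, h0]
  simp only [clusterGenus_cast, Finset.sum_sub_distrib, Finset.sum_add_distrib, h2, h3, h4]
  simp only [Finset.sum_const, Finset.card_univ, nsmul_eq_mul, mul_one]
  rw [← h5]
  push_cast
  ring

theorem range_eval_contract : Set.range h.eval ⊆ Set.range h.contract.eval := by
  rintro _ ⟨v | ⟨e, s⟩ | ⟨l, t⟩, rfl⟩
  · exact ⟨.vertex (h.cluster v), rfl⟩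
  · by_cases he : h.len e = 0
    · refine ⟨.vertex (h.cluster (h.src e)), ?_⟩
      funext j
      simp only [eval, he]
      rw [mul_zero, zero_mul, add_zero]
      rfl
    · exact ⟨.inner ⟨e, he⟩ s, rfl⟩
  · exact ⟨.ray l t, rfl⟩

variable {h}

theorem eval_contract_mem {S : Set (Fin 3 → ℝ)} (hS : Set.range h.eval ⊆ S)
    (x : h.contract.Point) : h.contract.eval x ∈ S := by
  rcases x with T | ⟨e, s⟩ | ⟨l, t⟩
  · obtain ⟨v, rfl⟩ := h.exists_cluster_eq T
    exact hS ⟨.vertex v, rfl⟩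
  · exact hS ⟨.inner e.1 s, rfl⟩
  · exact hS ⟨.ray l t, rfl⟩

theorem exists_end_contract (hend : ∀ c : h.Component, ∃ l : h.Λ, h.component (h.root l) = c)
    (c : h.contract.Component) :
    ∃ l : h.contract.Λ, h.contract.component (h.contract.root l) = c := by
  obtain ⟨T, rfl⟩ := Quot.exists_rep c
  obtain ⟨v, rfl⟩ := h.exists_cluster_eq T
  obtain ⟨l, hl⟩ := hend (h.component v)
  refine ⟨l, ?_⟩
  have h1 := Quot.eqvGen_exact hl
  show h.contract.component (h.cluster (h.root l)) = h.contract.component (h.cluster v)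
  clear hl
  generalize h.root l = u at h1
  induction h1 with
  | rel u v huv =>
    obtain ⟨e, rfl, rfl⟩ := huv
    by_cases he : h.len e = 0
    · rw [h.cluster_tgt he]
    · exact Quot.sound ⟨⟨e, he⟩, rfl, rfl⟩
  | refl u => rfl
  | symm u v _ ih => exact ih.symm
  | trans u v w _ _ ih1 ih2 => exact ih1.trans ih2

theorem contract_isTight (hX : Set.range h.eval ⊆ surfaceX)
    (hend : ∀ c : h.Component, ∃ l : h.Λ, h.component (h.root l) = c)
    (he : ∀ v ∈ h.newtonFan, v ∈ surfaceX) (hL : ∀ v ∈ h.newtonFan, v ∉ lineL) :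
    h.contract.IsTight where
  len_pos e := lt_of_le_of_ne (h.len_nonneg e.1) (Ne.symm e.2)
  eval_mem := eval_contract_mem hX
  exists_end := exists_end_contract hend
  endDir_mem l := he _ (mem_newtonFan l)
  endDir_notMem l := hL _ (mem_newtonFan l)

end TropicalMorphism

namespace TropicalMorphism

variable {h : TropicalMorphism}

/-! ### The third face -/

/-- If all edges that enter the third face are primitive, then there is no vertex in it. -/
theorem IsRigid.ht_nonneg {N : ℕ} {mk : Fin N → h.UpEdge} (hr : h.IsRigid mk)
    (hf : ∀ f, h.ht (h.base f) = 0 → hgt (h.flagDir f) < 0 → hgt (h.flagDir f) = -2)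
    (hl : ∀ l, hgt (h.endDir l) < 0 → hgt (h.endDir l) = -2) (v : h.V) : 0 ≤ h.ht v := by
  classical
  set S : Set h.V := {v | h.ht v < 0} with hS
  have h1 := h.sum_flux S hgtHom
  have h2 : ∑ l, (if h.root l ∈ S then hgtHom (h.endDir l) else 0) =
      ∑ l, -2 * (if h.root l ∈ S then (1 : ℤ) else 0) := by
    refine Finset.sum_congr rfl fun l _ => ?_
    split_ifs with h3
    · rw [hgtHom_apply, hl l (hr.tight.hgt_endDir_neg h3)]
      rfl
    · rfl
  -- A down edge inside `S` has two flags in `S` and flux 0; one that comes from L has one such flag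
  -- and flux 2 by primitivity; any other edge contributes nothing.
  have h3 : ∀ e, 2 * ((if h.base (.inl (e, false)) ∈ S then (1 : ℤ) else 0) +
      (if h.base (.inl (e, true)) ∈ S then (1 : ℤ) else 0)) =
      4 * (if h.Down (.inl e) then (1 : ℤ) else 0) - h.edgeFlux S hgtHom e := by
    intro e
    have key : ∀ b, h.base (.inl (e, b)) ∈ S → h.base (.inl (e, !b)) ∉ S →
        h.edgeFlux S hgtHom e = 2 := by
      intro b hb1 hb2
      rw [h.edgeFlux_of_mem_of_notMem _ hb1 hb2]
      have hb1' : h.ht (h.base (.inl (e, b))) < 0 := hb1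
      have e1 : h.ht (h.base (.inl (e, !b))) = 0 :=
        le_antisymm (hr.tight.ht_opp_nonpos hb1) (not_lt.1 hb2)
      have e2 := h.ht_opp e b
      have e3 : hgt (h.flagDir (.inl (e, !b))) = -hgt (h.flagDir (.inl (e, b))) := by
        rw [h.flagDir_opp, hgt_neg]
      have e4 : 0 < hgt (h.flagDir (.inl (e, b))) := by
        by_contra hc
        push Not at hc
        have : h.len e * ((hgt (h.flagDir (.inl (e, b))) : ℤ) : ℝ) ≤ 0 :=
          mul_nonpos_of_nonneg_of_nonpos (h.len_nonneg e) (by exact_mod_cast hc)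
        linarith
      have e5 := hf (.inl (e, !b)) e1 (by omega)
      rw [hgtHom_apply]
      omega
    have hd : h.Down (.inl e) ↔ h.base (.inl (e, false)) ∈ S ∨ h.base (.inl (e, true)) ∈ S :=
      ⟨fun hd => hd.2, fun hd => ⟨hr.flagDir_ne_zero (.inl (e, false)), hd⟩⟩
    by_cases c1 : h.base (.inl (e, false)) ∈ S <;> by_cases c2 : h.base (.inl (e, true)) ∈ S
    · rw [if_pos c1, if_pos c2, if_pos (hd.2 (Or.inl c1)),
        h.edgeFlux_eq_zero _ (iff_of_true c1 c2)]
      norm_num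
    · rw [if_pos c1, if_neg c2, if_pos (hd.2 (Or.inl c1)), key false c1 c2]
      norm_num
    · rw [if_neg c1, if_pos c2, if_pos (hd.2 (Or.inr c2)), key true c2 c1]
      norm_num
    · rw [if_neg c1, if_neg c2, if_neg (fun hc => (hd.1 hc).elim c1 c2),
        h.edgeFlux_eq_zero _ (iff_of_false c1 c2)]
      norm_num
  have h4 : ∑ v with v ∈ S, (h.val v : ℤ) = ∑ e, ((if h.base (.inl (e, false)) ∈ S then (1 : ℤ)
      else 0) + (if h.base (.inl (e, true)) ∈ S then (1 : ℤ) else 0)) +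
      ∑ l, (if h.root l ∈ S then (1 : ℤ) else 0) := by
    have a1 := h.sum_sum_flagsAt (fun v => v ∈ S) (fun _ => (1 : ℤ))
    rw [Finset.sum_filter (s := Finset.univ) (p := fun f => h.base f ∈ S), h.sum_flag] at a1
    refine Eq.trans (Finset.sum_congr rfl fun v _ => ?_) a1
    simp [PuncturedGraph.val]
  have h5 := Finset.sum_congr rfl fun e (_ : e ∈ Finset.univ) => h3 e
  rw [← Finset.mul_sum, Finset.sum_sub_distrib, ← Finset.mul_sum] at h5
  rw [h2, ← Finset.mul_sum] at h1
  have h6 : ∑ e, (if h.Down (.inl e) then (1 : ℤ) else 0) =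
      Nat.card {e : h.E // h.Down (.inl e)} := by
    rw [Nat.card_eq_fintype_card, Fintype.card_subtype]
    simp
  have h7 : (Nat.card {v : h.V // h.ht v < 0} : ℤ) = (Finset.univ.filter fun v => v ∈ S).card := by
    rw [Nat.card_eq_fintype_card, Fintype.card_subtype]
    rfl
  have h8 : 3 * ((Finset.univ.filter fun v => v ∈ S).card : ℤ) ≤ ∑ v with v ∈ S, (h.val v : ℤ) := by
    have := Finset.card_nsmul_le_sum (Finset.univ.filter fun v => v ∈ S)
      (fun v => (h.val v : ℤ)) 3 (fun v _ => by exact_mod_cast hr.three_le_val v)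
    rw [nsmul_eq_mul] at this
    linarith
  have h9 := hr.card_down
  rw [h6] at h5
  -- The valencies over `S` sum to twice the number of down edges, which is twice the number of
  -- vertices in `S`, although each valency is at least 3.
  have h10 : ((Finset.univ.filter fun v => v ∈ S).card : ℤ) ≤ 0 := by
    rw [← h9, h7] at h5
    linarith
  by_contra hc
  push Not at hc
  have h11 : 0 < (Finset.univ.filter fun v => v ∈ S).card :=
    Finset.card_pos.2 ⟨v, Finset.mem_filter.2 ⟨Finset.mem_univ _, hc⟩⟩
  omega

/-! ### The Riemann-Hurwitz condition -/

/-- A direction outside X can occur at a degenerate edge; the premorphism condition then puts the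
whole fan at `v` into one plane, so `fanMult_eq_sum_tau` applies in either case. -/
theorem intMult_eq (hp : h.IsPremorphism) {v : h.V} (hv : h.pos v ∈ lineL) :
    h.intMult v = ∑ f ∈ h.flagsAt v, tau (h.flagDir f) := by
  classical
  unfold intMult
  rw [if_pos hv, fanMult_eq_sum_tau, Multiset.map_map]
  · rfl
  · exact h.balanced v
  · by_cases hX : ∃ f, h.base f = v ∧ h.flagDir f ∉ surfaceX
    · obtain ⟨f, hf, hfX⟩ := hX
      obtain ⟨i, hi⟩ := (hp.2 f).1
      refine Or.inr ⟨i, fun w hw => ?_⟩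
      obtain ⟨g, hg, rfl⟩ := Multiset.mem_map.1 hw
      exact (hp.2 f).2 i ⟨hi, hfX⟩ g ((h.mem_flagsAt.1 hg).trans hf.symm)
    · push Not at hX
      refine Or.inl fun w hw => ?_
      obtain ⟨g, hg, rfl⟩ := Multiset.mem_map.1 hw
      exact hX g (h.mem_flagsAt.1 hg)

theorem intMult_add_two_le (hm : h.IsMorphismToX) {v : h.V} (hg : h.genus v = 0)
    (h0 : 0 < h.intMult v) : h.intMult v + 2 ≤ h.val v := by
  classical
  have h1 := hm.2 v h0
  unfold overvalency at h1
  have h2 := Finset.card_filter_le (h.flagsAt v) fun f => ¬ h.TropicallyMappedToL f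
  unfold PuncturedGraph.val
  rw [hg] at h1
  push_cast at h1
  have h3 : ((((h.flagsAt v).filter fun f => ¬ h.TropicallyMappedToL f).card : ℕ) : ℤ) ≤
    (h.flagsAt v).card := by exact_mod_cast h2
  linarith

section Contracted

variable {N : ℕ} {mk : Fin N → h.contract.UpEdge} (hr : h.contract.IsRigid mk)
include hr

theorem genus_eq_zero_of_contract (v : h.V) : h.genus v = 0 := by
  classical
  have h1 : h.clusterGenus (h.cluster v) = 0 := hr.genus_eq (h.cluster v)
  have h2 := h.clusterGenus_cast (h.cluster v)
  have h3 := h.clusterCard_le (h.cluster v)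
  rw [h1] at h2
  have h4 : (h.genus v : ℤ) ≤ ∑ w with h.cluster w = h.cluster v, (h.genus w : ℤ) :=
    Finset.single_le_sum (f := fun w => (h.genus w : ℤ)) (fun w _ => Nat.cast_nonneg _)
      (Finset.mem_filter.2 ⟨Finset.mem_univ v, rfl⟩)
  push_cast at h2
  omega

open Classical in
theorem sum_val_cluster_of_contract (T : h.Cluster) :
    ∑ v with h.cluster v = T, ((h.val v : ℤ) - 2) = h.contractGraph.val T - 2 := by
  have h1 := h.sum_val_cluster T
  have h2 : h.clusterGenus T = 0 := hr.genus_eq T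
  rw [h2] at h1
  simp only [genus_eq_zero_of_contract hr] at h1
  simpa using h1

theorem three_le_val_of_contract (v : h.V) : 3 ≤ h.val v := by
  have := TropicalMorphism.three_le_val (h := h) v
  rwa [genus_eq_zero_of_contract hr] at this

/-- Over a trivalent vertex the numbers val - 2 sum to 1, and each of them is at least 1. -/
theorem eq_of_cluster_eq {v w : h.V} (h3 : h.contract.val (h.cluster v) = 3)
    (hvw : h.cluster w = h.cluster v) : w = v := by
  classical
  by_contra hne
  have h1 := sum_val_cluster_of_contract hr (h.cluster v)
  have h4 : h.contractGraph.val (h.cluster v) = 3 := h3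
  rw [h4] at h1
  have h2 : ∑ u ∈ {v, w}, ((h.val u : ℤ) - 2) ≤
      ∑ u with h.cluster u = h.cluster v, ((h.val u : ℤ) - 2) := by
    refine Finset.sum_le_sum_of_subset_of_nonneg ?_ fun u _ _ => ?_
    · intro u hu
      simp only [Finset.mem_insert, Finset.mem_singleton] at hu
      rcases hu with rfl | rfl
      · exact Finset.mem_filter.2 ⟨Finset.mem_univ _, rfl⟩
      · exact Finset.mem_filter.2 ⟨Finset.mem_univ _, hvw⟩
    · have := three_le_val_of_contract hr u
      omega
  rw [Finset.sum_pair (Ne.symm hne), h1] at h2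
  have a1 := three_le_val_of_contract hr v
  have a2 := three_le_val_of_contract hr w
  push_cast at h2
  omega

-- The contributions of the two flags of a degenerate edge cancel because `tau` is odd.
open Classical in
theorem sum_intMult_cluster (hm : h.IsMorphismToX) {T : h.Cluster}
    (hT : h.contract.pos T ∈ lineL) : ∑ v with h.cluster v = T, h.intMult v =
      ∑ f ∈ h.contract.flagsAt T, tau (h.contract.flagDir f) := by
  have h1 := h.sum_cluster (fun f => tau (h.flagDir f)) T
  have h2 : ∑ v with h.cluster v = T, h.intMult v =
      ∑ v with h.cluster v = T, ∑ f ∈ h.flagsAt v, tau (h.flagDir f) := by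
    refine Finset.sum_congr rfl fun v hv => intMult_eq hm.1 ?_
    rw [← (Finset.mem_filter.1 hv).2] at hT
    exact hT
  rw [h2, h1]
  rw [Finset.sum_eq_zero (s := Finset.univ.filter fun e => h.len e = 0 ∧ h.cluster (h.src e) = T),
    add_zero]
  · refine Finset.sum_congr rfl fun f _ => ?_
    rcases f with ⟨e, _ | _⟩ | l <;> rfl
  · intro e _
    have : h.flagDir (.inl (e, true)) = -h.flagDir (.inl (e, false)) := h.flagDir_opp e false
    rw [this, tau_neg]
    ring

/-- Two flags at the contracted vertex are up, so val - 2 counts its down flags. This is at most the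
sum of their multiplicities, which is the sum of `intMult` over the cluster. By Riemann-Hurwitz that
is at most the sum of val - 2 over the cluster, which is the first number again. Equality holds
termwise; a vertex with `intMult` at most 0 would make it strict, since its valency is at least 3.
-/
theorem line_equalities (hm : h.IsMorphismToX) {v : h.V} (hv : h.pos v ∈ lineL) :
    (0 < h.intMult v ∧ (h.val v : ℤ) = h.intMult v + 2) ∧
      ∀ f : h.contract.Flag, h.contract.base f = h.cluster v →
        hgt (h.contract.flagDir f) < 0 → hgt (h.contract.flagDir f) = -2 := by
  classical
  set T := h.cluster v with hT
  have hTL : h.contract.pos T ∈ lineL := hv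
  have h0 : h.contract.ht T = 0 := (hr.tight.mem_lineL_iff _).1 hTL
  have b0 : ∀ f ∈ h.contract.flagsAt T, h.contract.ht (h.contract.base f) = 0 := by
    intro f hf
    rw [h.contract.mem_flagsAt.1 hf]
    exact h0
  have h1 : ∀ f ∈ h.contract.flagsAt T, (if hgt (h.contract.flagDir f) < 0 then (1 : ℤ) else 0) ≤
      tau (h.contract.flagDir f) := by
    intro f hf
    have hX := hr.tight.flagDir_mem_surfaceX (b0 f hf)
    split_ifs with hc
    · have := hgt_eq_of_neg hX hc
      omega
    · rw [tau_eq_zero hX (not_lt.1 hc)]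
  have h2 : (h.contractGraph.val T : ℤ) - 2 = ∑ f ∈ h.contract.flagsAt T,
      (if hgt (h.contract.flagDir f) < 0 then (1 : ℤ) else 0) := by
    have a1 := hr.upCount_eq T h0
    unfold upCount at a1
    have a2 := Finset.card_filter_add_card_filter_not (s := h.contract.flagsAt T)
      fun f => h.contract.Up (h.contract.edgeOf f)
    have a3 : (h.contract.flagsAt T).filter (fun f => ¬ h.contract.Up (h.contract.edgeOf f)) =
        (h.contract.flagsAt T).filter (fun f => hgt (h.contract.flagDir f) < 0) := by
      refine Finset.filter_congr fun f hf => ?_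
      rw [← hr.tight.down_iff_of_ht_eq_zero (b0 f hf)]
      constructor
      · intro hu
        rcases hr.tight.up_or_down_or_silent (h.contract.edgeOf f) with hh | hh | hh
        · exact absurd hh hu
        · exact hh
        · exact absurd hh (hr.not_silent _)
      · intro hd hu
        exact hr.tight.not_down_of_up hu hd
    rw [Finset.sum_boole, ← a3]
    have a4 : h.contractGraph.val T = (h.contract.flagsAt T).card := rfl
    rw [a4]
    omega
  have h3 := sum_val_cluster_of_contract hr T
  have h4 := sum_intMult_cluster hr hm hTL
  have h5 : ∀ w, h.intMult w + 2 ≤ h.val w ∧ (h.intMult w ≤ 0 → h.intMult w + 2 < h.val w) := by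
    intro w
    by_cases hw : 0 < h.intMult w
    · exact ⟨intMult_add_two_le hm (genus_eq_zero_of_contract hr w) hw,
        fun hc => absurd hw (not_lt.2 hc)⟩
    · have := three_le_val_of_contract hr w
      push Not at hw
      constructor
      · omega
      · intro _
        omega
  have h6 : ∑ w with h.cluster w = T, h.intMult w ≤ ∑ w with h.cluster w = T, ((h.val w : ℤ) - 2) :=
    Finset.sum_le_sum fun w _ => by linarith [(h5 w).1]
  have h7 := Finset.sum_le_sum h1
  have h8 : ∑ w with h.cluster w = T, h.intMult w = ∑ w with h.cluster w = T, ((h.val w : ℤ) - 2) :=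
    le_antisymm h6 (by rw [h3, h2, h4]; exact h7)
  have h9 := (Finset.sum_eq_sum_iff_of_le (fun w _ => by linarith [(h5 w).1])).1 h8 v
    (Finset.mem_filter.2 ⟨Finset.mem_univ v, rfl⟩)
  have h10 := (Finset.sum_eq_sum_iff_of_le h1).1 (by rw [← h2, ← h3, ← h8, h4])
  refine ⟨⟨?_, by linarith⟩, fun f hf hneg => ?_⟩
  · by_contra hc
    have := (h5 v).2 (not_lt.1 hc)
    linarith
  · have hf' := h.contract.mem_flagsAt.2 hf
    have a1 := h10 f hf'
    rw [if_pos hneg] at a1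
    rw [hgt_eq_of_neg (hr.tight.flagDir_mem_surfaceX (b0 f hf')) hneg, ← a1]
    rfl

/-- There are no degenerate edges on `L`. -/
theorem len_ne_zero_of_line (hm : h.IsMorphismToX) {e : h.E} (he : h.pos (h.src e) ∈ lineL) :
    h.len e ≠ 0 := by
  classical
  intro h0
  have hbase : ∀ b, h.pos (h.base (.inl (e, b))) ∈ lineL := by
    intro b
    cases b
    · exact he
    · show h.pos (h.tgt e) ∈ lineL
      have : h.pos (h.tgt e) = h.pos (h.src e) := (h.pos_eq_of_glued ⟨e, h0, rfl, rfl⟩).symm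
      rwa [this]
  have hev : ∀ x ∈ h.closedEdge (.inl e), h.eval x = h.pos (h.src e) := by
    rintro x (hx | ⟨s, rfl⟩)
    · rcases hx with rfl | rfl
      · rfl
      · exact (h.pos_eq_of_glued ⟨e, h0, rfl, rfl⟩).symm
    · funext j
      simp [eval, h0]
  -- A direction outside X would force all directions at the vertex into one plane and make its
  -- multiplicity zero.
  have key : ∀ b, h.flagDir (.inl (e, b)) ∈ surfaceX := by
    intro b
    by_contra hc
    obtain ⟨i, hi⟩ := (hm.1.2 (.inl (e, b))).1
    have h1 := (hm.1.2 (.inl (e, b))).2 i ⟨hi, hc⟩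
    have h2 := (line_equalities hr hm (hbase b)).1.1
    unfold intMult fanMult at h2
    have h3 : ∀ w ∈ (h.flagsAt (h.base (.inl (e, b)))).val.map h.flagDir, w ∈ plane i := by
      intro w hw
      obtain ⟨g, hg, rfl⟩ := Multiset.mem_map.1 hw
      exact h1 g (h.mem_flagsAt.1 hg)
    rw [if_pos (hbase b), if_pos ⟨i, h3⟩] at h2
    exact lt_irrefl _ h2
  -- A vector that lies in X together with its negative is parallel to L.
  have hL : ∀ b, h.flagDir (.inl (e, b)) ∈ lineL := by
    intro b
    rw [mem_lineL_iff_of_mem_surfaceX (key b)]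
    by_contra hc
    have k1 := key b
    have k2 := key (!b)
    rw [h.flagDir_opp] at k2
    rcases mem_surfaceX.1 k1 with a | a | a <;> rcases mem_surfaceX.1 k2 with a' | a' | a' <;>
      simp only [hgt_neg, sid_neg] at a' <;> omega
  obtain ⟨h1, h2⟩ := (line_equalities hr hm he).1
  have h3 := hm.2 (h.src e) h1
  unfold overvalency at h3
  -- The flag of `e` is not counted in `k_V`, but val - `d_V` - 2 is already 0, so the overvalency
  -- would be negative.
  have h4 : ((h.flagsAt (h.src e)).filter fun f => ¬ h.TropicallyMappedToL f).card <
      (h.flagsAt (h.src e)).card := by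
    refine Finset.card_lt_card (Finset.filter_ssubset.2 ⟨.inl (e, false),
      h.mem_flagsAt.2 rfl, not_not.2 ⟨?_, hL false⟩⟩)
    rintro _ ⟨x, hx, rfl⟩
    rw [hev x hx]
    exact he
  rw [genus_eq_zero_of_contract hr] at h3
  unfold PuncturedGraph.val at h2
  push_cast at h3
  omega

theorem contract_ht_nonneg (hm : h.IsMorphismToX)
    (hl : ∀ l, hgt (h.endDir l) < 0 → hgt (h.endDir l) = -2) (T : h.contract.V) :
    0 ≤ h.contract.ht T := by
  refine hr.ht_nonneg (fun f hf => ?_) hl T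
  obtain ⟨v, hv⟩ := h.exists_cluster_eq (h.contract.base f)
  refine (line_equalities hr hm (v := v) ?_).2 f hv.symm
  rw [← (hr.tight.mem_lineL_iff _), ← hv] at hf
  exact hf

/-- There are no degenerate edges. -/
theorem len_ne_zero_of_contract (hm : h.IsMorphismToX)
    (hl : ∀ l, hgt (h.endDir l) < 0 → hgt (h.endDir l) = -2)
    (h3 : ∀ T, 0 < h.contract.ht T → h.contract.val T = 3) (e : h.E) : h.len e ≠ 0 := by
  intro h0
  rcases (contract_ht_nonneg hr hm hl (h.cluster (h.src e))).eq_or_lt with h1 | h1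
  · exact len_ne_zero_of_line hr hm ((hr.tight.mem_lineL_iff (h.cluster (h.src e))).2 h1.symm) h0
  · exact h.no_degenerate_loop e h0
      (eq_of_cluster_eq hr (h3 _ h1) (h.cluster_tgt h0)).symm

end Contracted

end TropicalMorphism

theorem add_smul_mem_face {p : Fin 3 → ℝ} (hp : p ∈ lineL) {v : Fin 3 → ℤ} {i : Fin 3}
    (hv : v ∈ face i) {a : ℝ} (ha : 0 ≤ a) : (fun j => p j + a * (v j : ℝ)) ∈ face i := by
  have h1 := hgt_line p (fun j => (v j : ℝ)) a
  have h2 := sid_line p (fun j => (v j : ℝ)) a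
  rw [hgt_cast, (mem_lineL.1 hp).1, zero_add] at h1
  rw [sid_cast, (mem_lineL.1 hp).2, zero_add] at h2
  fin_cases i
  · obtain ⟨e1, e2⟩ := mem_face_zero.1 hv
    refine mem_face_zero.2 ⟨?_, ?_⟩
    · rw [h1, h2, e1]
    · rw [h1]
      exact mul_nonneg ha (by exact_mod_cast e2)
  · obtain ⟨e1, e2⟩ := mem_face_one.1 hv
    refine mem_face_one.2 ⟨?_, ?_⟩
    · rw [h1, h2, e1]
      push_cast
      ring
    · rw [h1]
      exact mul_nonneg ha (by exact_mod_cast e2)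
  · obtain ⟨e1, e2⟩ := mem_face_two.1 hv
    refine mem_face_two.2 ⟨?_, ?_⟩
    · rw [h2, e1]
      simp
    · rw [h1]
      exact mul_nonpos_of_nonneg_of_nonpos ha (by exact_mod_cast e2)

theorem mem_plane_of_sub {p : Fin 3 → ℝ} {i : Fin 3} (hp : p ∈ plane i) {v : Fin 3 → ℤ} {a : ℝ}
    (ha : a ≠ 0) (hpv : (fun j => p j + a * (v j : ℝ)) ∈ plane i) : v ∈ plane i := by
  rw [← cast_mem_plane]
  fin_cases i
  · have e1 : p 0 = p 1 := hp
    have e2 : p 0 + a * (v 0 : ℝ) = p 1 + a * (v 1 : ℝ) := hpv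
    exact mul_left_cancel₀ ha (by linarith : a * (v 0 : ℝ) = a * (v 1 : ℝ))
  · have e1 : p 0 = p 2 := hp
    have e2 : p 0 + a * (v 0 : ℝ) = p 2 + a * (v 2 : ℝ) := hpv
    exact mul_left_cancel₀ ha (by linarith : a * (v 0 : ℝ) = a * (v 2 : ℝ))
  · have e1 : p 1 = p 2 := hp
    have e2 : p 1 + a * (v 1 : ℝ) = p 2 + a * (v 2 : ℝ) := hpv
    exact mul_left_cancel₀ ha (by linarith : a * (v 1 : ℝ) = a * (v 2 : ℝ))

namespace TropicalMorphism

variable {h : TropicalMorphism}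

/-! ### Images of edges -/

theorem mem_edgeImage_base (f : h.Flag) : h.pos (h.base f) ∈ h.edgeImage (h.edgeOf f) := by
  rcases f with ⟨e, _ | _⟩ | l
  · exact ⟨.vertex (h.src e), Or.inl (Or.inl rfl), rfl⟩
  · exact ⟨.vertex (h.tgt e), Or.inl (Or.inr rfl), rfl⟩
  · exact ⟨.vertex (h.root l), Or.inl rfl, rfl⟩

theorem exists_of_mem_edgeImage (f : h.Flag) {q : Fin 3 → ℝ} (hq : q ∈ h.edgeImage (h.edgeOf f)) :
    ∃ a : ℝ, 0 ≤ a ∧ (∀ e b, f = .inl (e, b) → a ≤ h.len e) ∧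
      q = fun j => h.pos (h.base f) j + a * (h.flagDir f j : ℝ) := by
  obtain ⟨x, hx, rfl⟩ := hq
  rcases f with ⟨e, b⟩ | l
  · have hl := h.len_nonneg e
    have self : ∀ b, h.pos (h.base (.inl (e, b))) = fun j => h.pos (h.base (.inl (e, b))) j +
        0 * (h.flagDir (.inl (e, b)) j : ℝ) := fun b => by simp
    have len : ∀ a, a ≤ h.len e → ∀ e' b', (.inl (e, b) : h.Flag) = .inl (e', b') → a ≤ h.len e' := by
      intro a ha e' b' hc
      rw [Sum.inl.injEq, Prod.mk.injEq] at hc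
      exact hc.1 ▸ ha
    rcases hx with hx | ⟨s, rfl⟩
    · have hx' : x = .vertex (h.base (.inl (e, b))) ∨ x = .vertex (h.base (.inl (e, !b))) := by
        cases b
        · exact hx
        · exact hx.symm
      rcases hx' with rfl | rfl
      · exact ⟨0, le_rfl, len 0 hl, self b⟩
      · exact ⟨h.len e, hl, len _ le_rfl, h.pos_opp' e b⟩
    · have s0 := s.2.1
      have s1 := s.2.2
      cases b
      · exact ⟨s * h.len e, mul_nonneg s0.le hl, len _ (by nlinarith), rfl⟩
      · refine ⟨(1 - s) * h.len e, mul_nonneg (by linarith) hl, len _ (by nlinarith), ?_⟩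
        funext j
        simp only [eval, PuncturedGraph.base, flagDir, PuncturedGraph.flagVec, Pi.neg_apply]
        rw [h.affine e j]
        push_cast
        ring
  · rcases hx with rfl | ⟨t, rfl⟩
    · exact ⟨0, le_rfl, fun e b hc => by simp at hc, by funext j; simp [eval, PuncturedGraph.base]⟩
    · exact ⟨t, le_of_lt t.2, fun e b hc => by simp at hc, rfl⟩

theorem IsTight.exists_mem_edgeImage (ht : h.IsTight) (f : h.Flag) :
    ∃ a : ℝ, 0 < a ∧ (fun j => h.pos (h.base f) j + a * (h.flagDir f j : ℝ)) ∈
      h.edgeImage (h.edgeOf f) := by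
  rcases f with ⟨e, b⟩ | l
  · refine ⟨h.len e, ht.len_pos e, ?_⟩
    rw [← h.pos_opp' e b]
    exact mem_edgeImage_base (.inl (e, !b))
  · exact ⟨1, one_pos, .ray l ⟨1, Set.mem_Ioi.2 one_pos⟩, Or.inr ⟨_, rfl⟩, rfl⟩

namespace IsTight

variable (ht : h.IsTight)
include ht

theorem flagDir_mem_plane_of_edgeImage {f : h.Flag} {i : Fin 3}
    (hf : h.edgeImage (h.edgeOf f) ⊆ face i) : h.flagDir f ∈ plane i := by
  obtain ⟨a, ha, hm⟩ := ht.exists_mem_edgeImage f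
  exact mem_plane_of_sub (mem_plane_of_mem_face (hf (mem_edgeImage_base f))) ha.ne'
    (mem_plane_of_mem_face (hf hm))

theorem edgeImage_subset_face_iff {f : h.Flag} (h0 : h.ht (h.base f) = 0) {i : Fin 3} :
    h.edgeImage (h.edgeOf f) ⊆ face i ↔ h.flagDir f ∈ face i := by
  constructor
  · exact fun hf => mem_face_of_mem_plane (ht.flagDir_mem_plane_of_edgeImage hf)
      (ht.flagDir_mem_surfaceX h0)
  · intro hf q hq
    obtain ⟨a, ha, -, rfl⟩ := exists_of_mem_edgeImage f hq
    exact add_smul_mem_face ((ht.mem_lineL_iff _).2 h0) hf ha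

theorem edgeImage_subset_face {f : h.Flag} (h0 : h.ht (h.base f) ≠ 0) {i : Fin 3}
    (hi : h.pos (h.base f) ∈ face i) : h.edgeImage (h.edgeOf f) ⊆ face i := by
  intro q hq
  have hL : h.pos (h.base f) ∉ lineL := fun hc => h0 ((ht.mem_lineL_iff _).1 hc)
  obtain ⟨a, ha, hlen, rfl⟩ := exists_of_mem_edgeImage f hq
  rcases f with ⟨e, b⟩ | l
  · exact (mem_face_of_line (ht.len_pos e) hi hL
      (fun _ h1 => ht.flag_line_mem e b h1.1 h1.2)).2 a ⟨ha, hlen e b rfl⟩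
  · exact (mem_face_of_line (T := a + 1) (by linarith) hi hL
      (fun _ h1 => ht.end_line_mem l h1.1)).2 a ⟨ha, by linarith⟩

theorem end_subset_face_iff {l : h.Λ} {i : Fin 3} :
    h.edgeImage (.inr l) ⊆ face i ↔ h.endDir l ∈ face i := by
  constructor
  · exact fun hf => mem_face_of_mem_plane (ht.flagDir_mem_plane_of_edgeImage (f := .inr l) hf)
      (ht.endDir_mem l)
  · intro hl
    by_cases h0 : h.ht (h.root l) = 0
    · exact (ht.edgeImage_subset_face_iff (f := .inr l) h0).2 hl
    · obtain ⟨k, hk⟩ := ht.exists_face (h.root l)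
      have := face_unique (ht.endDir_mem_face hk h0) hl (ht.endDir_notMem l)
      subst this
      exact ht.edgeImage_subset_face (f := .inr l) h0 hk

end IsTight

/-! ### The shape of rigid curves without vertices in the third face -/

namespace IsRigid

variable {N : ℕ} {mk : Fin N → h.UpEdge} (hr : h.IsRigid mk)
include hr

theorem not_subset_lineL (e : h.Edge) : ¬ h.edgeImage e ⊆ lineL := by
  intro hc
  rcases e with e | l
  · refine hr.not_silent (.inl e) (Or.inr ⟨?_, ?_⟩)
    · exact (hr.tight.mem_lineL_iff _).1 (hc (mem_edgeImage_base (.inl (e, false))))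
    · exact (hr.tight.mem_lineL_iff _).1 (hc (mem_edgeImage_base (.inl (e, true))))
  · have h1 := fun i => hr.tight.end_subset_face_iff (l := l) (i := i)|>.1
      fun q hq => mem_face_of_mem_lineL (hc hq) i
    have := face_unique (h1 0) (h1 1) (hr.tight.endDir_notMem l)
    exact absurd this (by decide)

theorem up_of_subset_face {ε : h.Edge} {i : Fin 3} (hi : i ≠ 2) (hε : h.edgeImage ε ⊆ face i) :
    h.Up ε := by
  have nn : ∀ {R : Type} [CommRing R] [LinearOrder R] [IsStrictOrderedRing R] (p : Fin 3 → R),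
      p ∈ face i → 0 ≤ hgt p := by
    intro R _ _ _ p hp
    fin_cases i
    · exact (mem_face_zero.1 hp).2
    · exact (mem_face_one.1 hp).2
    · exact absurd rfl hi
  rcases ε with e | l
  · refine ⟨hr.flagDir_ne_zero (.inl (e, false)), ?_⟩
    by_contra hc
    push Not at hc
    have h1 := nn _ (hε (mem_edgeImage_base (.inl (e, false))))
    have h2 := nn _ (hε (mem_edgeImage_base (.inl (e, true))))
    exact hr.not_silent (.inl e) (Or.inr ⟨le_antisymm hc.1 h1, le_antisymm hc.2 h2⟩)
  · have h1 := nn _ (hr.tight.end_subset_face_iff.1 hε)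
    exact lt_of_le_of_ne h1 (hr.tight.hgt_endDir_ne l).symm

theorem numEdgesInFace_eq_one {v : h.V} (hv : h.ht v = 0) {i : Fin 3} (hi : i ≠ 2) :
    h.numEdgesInFace i v = 1 := by
  classical
  obtain ⟨f, hf, hfi⟩ := hr.exists_up_flag hv hi
  have hf0 : h.ht (h.base f) = 0 := by rw [hf, hv]
  unfold numEdgesInFace
  rw [Finset.card_eq_one]
  refine ⟨f, Finset.ext fun g => ?_⟩
  rw [Finset.mem_filter, h.mem_flagsAt, Finset.mem_singleton]
  constructor
  · rintro ⟨hg, hgi⟩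
    have hg0 : h.ht (h.base g) = 0 := by rw [hg, hv]
    exact hr.up_flag_unique hi hg0 (hf.trans hg.symm)
      ((hr.tight.edgeImage_subset_face_iff hg0).1 hgi) hfi
  · rintro rfl
    exact ⟨hf, (hr.tight.edgeImage_subset_face_iff hf0).2 hfi⟩

theorem overvalency_eq {v : h.V} (hv : h.ht v = 0) :
    h.overvalency v = h.val v - h.intMult v - 2 := by
  classical
  unfold overvalency PuncturedGraph.val
  rw [hr.genus_eq, Finset.filter_true_of_mem]
  · push_cast
    ring
  · rintro f hf ⟨-, hL⟩
    exact hr.flagDir_notMem_lineL (by rw [h.mem_flagsAt.1 hf, hv]) hL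

/-- A vertex on L has at least three flags and only two of them are up. A flag that is not up is an
end, since a bounded down edge would have a vertex below L. -/
theorem preimage_face_two (hD : ∀ v, 0 ≤ h.ht v) [DecidablePred fun l => hgt (h.endDir l) < 0] :
    h.eval ⁻¹' face 2 =
      ⋃ l ∈ Finset.univ.filter fun l => hgt (h.endDir l) < 0, h.closedEdge (.inr l) := by
  classical
  ext x
  simp only [Set.mem_preimage, Set.mem_iUnion, Finset.mem_filter, Finset.mem_univ, true_and,
    exists_prop]
  constructor
  · intro hx
    have hx0 := (mem_face_two.1 hx).2
    rcases x with v | ⟨e, s⟩ | ⟨l, t⟩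
    · have hv : h.ht v = 0 := le_antisymm hx0 (hD v)
      have h1 := hr.upCount_eq v hv
      have h2 := hr.three_le_val v
      obtain ⟨f, hf, hfu⟩ : ∃ f ∈ h.flagsAt v, ¬ h.Up (h.edgeOf f) := by
        by_contra hc
        push Not at hc
        unfold upCount at h1
        unfold PuncturedGraph.val at h2
        rw [Finset.filter_true_of_mem hc] at h1
        omega
      have hfb := h.mem_flagsAt.1 hf
      have hfd : h.Down (h.edgeOf f) := by
        rcases hr.tight.up_or_down_or_silent (h.edgeOf f) with hh | hh | hh
        · exact absurd hh hfu
        · exact hh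
        · exact absurd hh (hr.not_silent _)
      rcases f with ⟨e, b⟩ | l
      · rcases hfd.2 with hh | hh
        · exact absurd hh (not_lt.2 (hD _))
        · exact absurd hh (not_lt.2 (hD _))
      · exact ⟨l, hfd, Or.inl (by rw [← hfb]; rfl)⟩
    · exfalso
      have hu : h.Up (.inl e) := by
        rcases hr.tight.up_or_down_or_silent (.inl e) with hh | hh | hh
        · exact hh
        · rcases hh.2 with hh | hh
          · exact absurd hh (not_lt.2 (hD _))
          · exact absurd hh (not_lt.2 (hD _))
        · exact absurd hh (hr.not_silent _)
      have h1 : hgt (h.eval (.inner e s)) = (1 - s) * h.ht (h.src e) + s * h.ht (h.tgt e) := by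
        have := h.affine e
        simp only [eval, TropicalMorphism.ht, hgt, this]
        ring
      rw [h1] at hx0
      have s0 := s.2.1
      have s1 : (0 : ℝ) < 1 - s := sub_pos.2 s.2.2
      have a1 := mul_nonneg s1.le (hD (h.src e))
      have a2 := mul_nonneg s0.le (hD (h.tgt e))
      rcases hu.2 with hh | hh
      · have := mul_pos s1 hh
        linarith
      · have := mul_pos s0 hh
        linarith
    · refine ⟨l, ?_, Or.inr ⟨t, rfl⟩⟩
      by_contra hc
      have h2 : 0 < hgt (h.endDir l) := lt_of_le_of_ne (not_lt.1 hc) (hr.tight.hgt_endDir_ne l).symm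
      have h3 := hgt_line (h.pos (h.root l)) (fun j => (h.endDir l j : ℝ)) t
      rw [hgt_cast] at h3
      have h4 : hgt (h.eval (.ray l t)) = h.ht (h.root l) + t * ((hgt (h.endDir l) : ℤ) : ℝ) := h3
      have h5 : (0 : ℝ) < t * ((hgt (h.endDir l) : ℤ) : ℝ) :=
        mul_pos t.2 (by exact_mod_cast h2)
      have := hD (h.root l)
      linarith
  · rintro ⟨l, hl, hx⟩
    have h1 : h.endDir l ∈ face 2 := mem_face_two_of_hgt_neg (hr.tight.endDir_mem l) hl
    exact hr.tight.end_subset_face_iff.2 h1 ⟨x, hx, rfl⟩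

/-! ### The part of the curve in a face without marked points -/

/-- Without an end, the vertices of the component off L would be isolated apart from edges to L,
hence have only contracted edges. A vertex on L is joined to such a vertex, or to an end, by its
edge in the face. -/
theorem exists_end_in_face {i : Fin 3} (hi : i ≠ 2) (c : (h.preimageFace i).Component) :
    ∃ l, (h.preimageFace i).component ((h.preimageFace i).root l) = c := by
  have nn : ∀ p : Fin 3 → ℝ, p ∈ face i → 0 ≤ hgt p := by
    intro p hp
    fin_cases i
    · exact (mem_face_zero.1 hp).2
    · exact (mem_face_one.1 hp).2
    · exact absurd rfl hi
  have adj : ∀ (e : h.E) (b : Bool) (hu : h.pos (h.base (.inl (e, b))) ∈ face i)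
      (hw : h.pos (h.base (.inl (e, !b))) ∈ face i) (_ : h.edgeImage (.inl e) ⊆ face i),
      (h.preimageFace i).component ⟨_, hw⟩ = (h.preimageFace i).component ⟨_, hu⟩ := by
    intro e b hu hw he
    cases b
    · exact (Quot.sound ⟨⟨e, he⟩, rfl, rfl⟩).symm
    · exact Quot.sound ⟨⟨e, he⟩, rfl, rfl⟩
  have main : ∀ (v : h.V) (hv : h.pos v ∈ face i), 0 < h.ht v →
      ∃ l, (h.preimageFace i).component ((h.preimageFace i).root l) =
        (h.preimageFace i).component ⟨v, hv⟩ := by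
    intro v hv hpos
    set S : Set h.V := {w | 0 < h.ht w ∧ ∃ hw : h.pos w ∈ face i,
      (h.preimageFace i).component ⟨w, hw⟩ = (h.preimageFace i).component ⟨v, hv⟩} with hS
    by_cases hl : ∃ l, h.root l ∈ S
    · obtain ⟨l, h1, h2, h3⟩ := hl
      exact ⟨⟨l, hr.tight.edgeImage_subset_face (f := .inr l) h1.ne' h2⟩, h3⟩
    · push Not at hl
      have key := hr.tight.flagDir_eq_zero_of_isolated (S := S) (fun w hw => hw.1) hl (by
        rintro e b ⟨h1, h2, h3⟩ h4
        right
        by_contra h5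
        have h6 := hr.tight.opp_mem_face h2 h1.ne'
        refine h4 ⟨lt_of_le_of_ne (nn _ h6) (Ne.symm h5), h6, ?_⟩
        rw [adj e b h2 h6 (hr.tight.edgeImage_subset_face (f := .inl (e, b)) h1.ne' h2)]
        exact h3)
      obtain ⟨f, hf⟩ := hr.exists_flag v
      have hvS : v ∈ S := ⟨hpos, hv, rfl⟩
      rcases f with ⟨e, b⟩ | l
      · exact absurd (key e b (by rw [hf]; exact hvS)) (hr.flagDir_ne_zero _)
      · exact absurd (by rw [show h.root l = v from hf]; exact hvS) (hl l)
  obtain ⟨⟨v, hv⟩, rfl⟩ := Quot.exists_rep c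
  rcases (nn _ hv).eq_or_lt with h0 | h0
  · obtain ⟨f, hf, hfi⟩ := hr.exists_up_flag (v := v) h0.symm hi
    subst hf
    have h1 := (hr.tight.edgeImage_subset_face_iff h0.symm).2 hfi
    rcases f with ⟨e, b⟩ | l
    · have h2 : h.pos (h.base (.inl (e, !b))) ∈ face i := h1 (mem_edgeImage_base (.inl (e, !b)))
      have h3 : h.ht (h.base (.inl (e, !b))) ≠ 0 := by
        intro hc
        exact hr.not_silent (.inl e) ((h.silent_iff e b).2 (Or.inr ⟨h0.symm, hc⟩))
      obtain ⟨l, hl⟩ := main _ h2 (lt_of_le_of_ne (nn _ h2) h3.symm)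
      exact ⟨l, hl.trans (adj e b hv h2 h1)⟩
    · exact ⟨⟨l, h1⟩, rfl⟩
  · exact main v hv h0

/-- Assign numbers to the edges in the face, balanced at all its vertices. On L the only edge of the
face then carries zero, so extension by zero solves the system with all marked moments zero. By
rigidity it vanishes: balancing is injective. -/
theorem card_edges_in_face_le {i : Fin 3} (hi : i ≠ 2)
    (hmk : ∀ j, ¬ h.edgeImage (mk j).1 ⊆ face i) :
    Fintype.card (h.preimageFace i).E + Fintype.card (h.preimageFace i).Λ ≤
      Fintype.card (h.preimageFace i).V := by
  classical
  let B := {ε : h.Edge // h.edgeImage ε ⊆ face i}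
  let ext : (B → ℝ) → h.Edge → ℝ := fun y ε => if hε : h.edgeImage ε ⊆ face i then y ⟨ε, hε⟩ else 0
  have hadd : ∀ y z ε, ext (y + z) ε = ext y ε + ext z ε := by
    intro y z ε
    simp only [ext]
    split_ifs <;> simp
  have hsmul : ∀ (c : ℝ) y ε, ext (c • y) ε = c * ext y ε := by
    intro c y ε
    simp only [ext]
    split_ifs <;> simp
  let Φ : (B → ℝ) →ₗ[ℝ] ({v : h.V // h.pos v ∈ face i} → ℝ) :=
    { toFun := fun y v => ∑ f ∈ h.flagsAt v.1, h.sgn f * ext y (h.edgeOf f)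
      map_add' := fun y z => by
        funext v
        simp [hadd, mul_add, Finset.sum_add_distrib]
      map_smul' := fun c y => by
        funext v
        simp only [hsmul, Pi.smul_apply, smul_eq_mul, RingHom.id_apply, Finset.mul_sum]
        exact Finset.sum_congr rfl fun _ _ => by ring }
  have hinj : Function.Injective Φ := by
    rw [← LinearMap.ker_eq_bot, LinearMap.ker_eq_bot']
    intro y hy
    set x : h.Unknown → ℝ := Sum.elim (fun ε => ext y ε.1) 0 with hx
    have e1 : ∀ ε, h.edgePart x ε = ext y ε := by
      intro ε
      unfold edgePart
      split_ifs with hu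
      · rfl
      · simp only [ext]
        rw [dif_neg (fun hc => hu (hr.up_of_subset_face hi hc))]
    have e2 : ∀ v, h.linePart x v = 0 := by
      intro v
      unfold linePart
      split_ifs <;> rfl
    have hbal : ∀ v, h.pos v ∈ face i →
        ∑ f ∈ h.flagsAt v, h.sgn f * ext y (h.edgeOf f) = 0 := fun v hv => congrFun hy ⟨v, hv⟩
    have hzero : h.system x = 0 := by
      funext b
      rcases b with v | f
      · show ∑ f ∈ h.flagsAt v.1, h.sgn f * h.edgePart x (h.edgeOf f) = 0
        simp only [e1]
        by_cases hv : h.pos v.1 ∈ face i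
        · exact hbal _ hv
        · refine Finset.sum_eq_zero fun f hf => ?_
          have : ext y (h.edgeOf f) = 0 := dif_neg fun hc => hv (by
            rw [← h.mem_flagsAt.1 hf]
            exact hc (mem_edgeImage_base f))
          rw [this, mul_zero]
      · show h.sgn f.1 * h.edgePart x (h.edgeOf f.1) +
          (hgt (h.flagDir f.1) : ℤ) * h.linePart x (h.base f.1) = 0
        rw [e1, e2, mul_zero, add_zero]
        by_cases hf : h.edgeImage (h.edgeOf f.1) ⊆ face i
        · have h1 := hbal _ (hf (mem_edgeImage_base f.1))
          rw [Finset.sum_eq_single f.1] at h1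
          · exact h1
          · intro g hg hgf
            have hgb := h.mem_flagsAt.1 hg
            have : ext y (h.edgeOf g) = 0 := dif_neg fun hc => hgf
              (hr.up_flag_unique hi f.2.1 hgb
                ((hr.tight.edgeImage_subset_face_iff f.2.1).1 hf)
                ((hr.tight.edgeImage_subset_face_iff (by rw [hgb]; exact f.2.1)).1 hc)).symm
            rw [this, mul_zero]
          · exact fun hc => absurd (h.mem_flagsAt.2 rfl) hc
        · have : ext y (h.edgeOf f.1) = 0 := dif_neg hf
          rw [this, mul_zero]
    have hx0 := hr.eq_zero hzero fun j => dif_neg (hmk j)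
    funext ε
    have h1 := congrFun hx0 (.inl ⟨ε.1, hr.up_of_subset_face hi ε.2⟩)
    have h2 : ext y ε.1 = y ε := dif_pos ε.2
    rw [← h2]
    exact h1
  have h1 := LinearMap.finrank_le_finrank_of_injective hinj
  rw [Module.finrank_fintype_fun_eq_card, Module.finrank_fintype_fun_eq_card] at h1
  have h2 : Fintype.card B = Fintype.card (h.preimageFace i).E +
      Fintype.card (h.preimageFace i).Λ := by
    rw [← Fintype.card_sum]
    exact Fintype.card_congr (Equiv.subtypeSum (p := fun ε => h.edgeImage ε ⊆ face i))
  have h3 : Fintype.card {v : h.V // h.pos v ∈ face i} = Fintype.card (h.preimageFace i).V :=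
    Fintype.card_congr (Equiv.refl _)
  omega

/-- With Λ ends, Λ ≤ V - E = b₀ - b₁ ≤ b₀ ≤ Λ, so all are equalities. -/
theorem isUnionOfTrees {i : Fin 3} (hi : i ≠ 2) (hmk : ∀ j, ¬ h.edgeImage (mk j).1 ⊆ face i) :
    (h.preimageFace i).IsUnionOfTrees (Multiset.card (fanInFace h.newtonFan i)) := by
  classical
  have h1 := hr.card_edges_in_face_le hi hmk
  have h2 : (h.preimageFace i).b0 ≤ Fintype.card (h.preimageFace i).Λ := by
    rw [← Nat.card_eq_fintype_card]
    exact Nat.card_le_card_of_surjective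
      (fun l => (h.preimageFace i).component ((h.preimageFace i).root l))
      (hr.exists_end_in_face hi)
  have h3 := (h.preimageFace i).eulerChar_eq
  unfold PuncturedGraph.eulerChar at h3
  have h4 : Fintype.card (h.preimageFace i).Λ = Multiset.card (fanInFace h.newtonFan i) := by
    have a1 : Fintype.card (h.preimageFace i).Λ = Fintype.card {l : h.Λ // h.endDir l ∈ face i} :=
      Fintype.card_congr (Equiv.subtypeEquivRight fun l => hr.tight.end_subset_face_iff)
    rw [a1, Fintype.card_subtype, fanInFace, newtonFan, Multiset.filter_map, Multiset.card_map]
    rfl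
  constructor <;> omega

theorem not_subset_face_one {p : Fin N → Fin 3 → ℝ} (hp : ∀ j, p j ∈ face 0)
    (hpos : ∀ j, 0 < hgt (p j))
    (hmk : ∀ j, ∃ f, ∃ a : ℝ, (mk j).1 = h.edgeOf f ∧
      p j = fun k => h.pos (h.base f) k + a * (h.flagDir f k : ℝ)) (j : Fin N) :
    ¬ h.edgeImage (mk j).1 ⊆ face 1 := by
  obtain ⟨f, a, hf, hpf⟩ := hmk j
  rw [hf]
  intro hc
  have h1 := mem_plane_one.1 (mem_plane_of_mem_face (hc (mem_edgeImage_base f)))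
  have h2 := mem_plane_one.1 (cast_mem_plane.2 (hr.tight.flagDir_mem_plane_of_edgeImage hc))
  have h3 := hgt_line (h.pos (h.base f)) (fun k => (h.flagDir f k : ℝ)) a
  have h4 := sid_line (h.pos (h.base f)) (fun k => (h.flagDir f k : ℝ)) a
  rw [← hpf] at h3 h4
  rw [h1, h2] at h4
  have h5 := (mem_face_zero.1 (hp j)).1
  have h6 := hpos j
  rw [h4] at h5
  linarith

end IsRigid

end TropicalMorphism

/-! ### Consequences of genericity for curves in `TS` -/

section

open TropicalMorphism

variable {Δ : Multiset (Fin 3 → ℤ)} {χ : ℤ} {N : ℕ}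

/-- A configuration of points off `L` in the first two faces is generic for the enumerative problem
if it is generic for all tight curves that pass through it. -/
structure IsGeneric (Δ : Multiset (Fin 3 → ℤ)) (χ : ℤ) (p : Fin N → Fin 3 → ℝ) : Prop where
  hgt_pos : ∀ i, 0 < hgt (p i)
  generic : ∀ h : TropicalMorphism, h.IsTight → h.newtonFan = Δ → h.tropEulerChar = χ →
    (∀ i, p i ∈ Set.range h.eval) → h.IsGenericFor p

namespace IsGeneric

variable (hs : Δ.sum = 0) (hX : ∀ v ∈ Δ, v ∈ surfaceX) (hL : ∀ v ∈ Δ, v ∉ lineL)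
  (hm : ∀ v ∈ fanInFace Δ 2, vecMult v = 1)
  (hN : (N : ℤ) = (Multiset.card Δ : ℤ) - χ - fanMult Δ)
  {p : Fin N → Fin 3 → ℝ} (hp : IsGeneric Δ χ p) {h : TropicalMorphism}

include hs hX hL hm hN in
theorem card_eq (hΔ : h.newtonFan = Δ) (hχ : h.tropEulerChar = χ) :
    (N : ℤ) = Nat.card {l : h.Λ // h.Up (.inr l)} - h.tropEulerChar := by
  subst hΔ
  have h1 := fanMult_newtonFan hs hX hm
  have h2 := card_up_end hL hX
  rw [hN, h1, ← h2, hχ]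
  push_cast
  ring

include hs hX hL hm hN hp

/-- Tightness is available a priori only for the contracted curve. Its rigidity and trivalence off L
show that there was no degenerate edge to contract. -/
theorem isTight (hh : h ∈ TS Δ χ (Set.range p)) :
    h.IsTight ∧ (∀ v, 0 ≤ h.ht v) ∧
      ∀ v, h.pos v ∈ lineL → (h.val v : ℤ) = h.intMult v + 2 := by
  obtain ⟨hmor, hΔ, hχ, hω, hend⟩ := hh
  have ht : h.contract.IsTight := contract_isTight hmor.1.1 hend (by rw [hΔ]; exact hX)
    (by rw [hΔ]; exact hL)
  have hΔ' : h.contract.newtonFan = Δ := h.contract_newtonFan.trans hΔ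
  have hχ' : h.contract.tropEulerChar = χ := h.contract_tropEulerChar.trans hχ
  have hpr : ∀ i, p i ∈ Set.range h.contract.eval := fun i =>
    h.range_eval_contract (hω ⟨i, rfl⟩)
  obtain ⟨mk, hr, hmk, -⟩ := ht.exists_isRigid (hp.generic _ ht hΔ' hχ' hpr) hpr hp.hgt_pos
    (card_eq hs hX hL hm hN hΔ' hχ')
  have hl : ∀ l, hgt (h.endDir l) < 0 → hgt (h.endDir l) = -2 := by
    intro l hl
    subst hΔ
    rw [hgt_eq_of_neg (hX _ (mem_newtonFan l)) hl, tau_endDir hX hm hl]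
    rfl
  have hlen := len_ne_zero_of_contract hr hmor hl fun T hT => hr.val_eq_three hmk hT
  refine ⟨⟨fun e => lt_of_le_of_ne (h.len_nonneg e) (hlen e).symm, fun x => hmor.1.1 ⟨x, rfl⟩,
    hend, fun l => ?_, fun l => ?_⟩, fun v => contract_ht_nonneg hr hmor hl (h.cluster v),
    fun v hv => (line_equalities hr hmor hv).1.2⟩
  · exact hX _ (hΔ ▸ mem_newtonFan l)
  · exact hL _ (hΔ ▸ mem_newtonFan l)

theorem exists_isRigid (hh : h ∈ TS Δ χ (Set.range p)) :
    ∃ mk : Fin N → h.UpEdge, h.IsRigid mk ∧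
      (∀ r : Fin N → ℝ, ∃ P, h.IsDeformation P ∧ ∀ i, h.edgeMom P (mk i).1 = r i) ∧
      ∀ i, ∃ f, ∃ a : ℝ, (mk i).1 = h.edgeOf f ∧
        p i = fun j => h.pos (h.base f) j + a * (h.flagDir f j : ℝ) := by
  have ht := (hp.isTight hs hX hL hm hN hh).1
  obtain ⟨-, hΔ, hχ, hω, -⟩ := hh
  have hpr : ∀ i, p i ∈ Set.range h.eval := fun i => hω ⟨i, rfl⟩
  exact ht.exists_isRigid (hp.generic _ ht hΔ hχ hpr) hpr hp.hgt_pos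
    (card_eq hs hX hL hm hN hΔ hχ)

theorem shape (hh : h ∈ TS Δ χ (Set.range p)) :
    (∀ e : h.Edge, ¬ h.edgeImage e ⊆ lineL) ∧
    (∀ v : h.V, h.pos v ∉ lineL → h.val v = 3 ∧ h.IsEmbeddingNear v) ∧
    h.IsExplicit ∧
    (∀ q ∈ Set.range p, ∃ x : h.Point, h.eval ⁻¹' {q} = {x} ∧ ∀ v : h.V, x ≠ .vertex v) ∧
    (∃ S : Finset h.Λ, (S.card : ℤ) = fanMult Δ ∧
      h.eval ⁻¹' face 2 = ⋃ l ∈ S, h.closedEdge (.inr l)) ∧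
    (∀ v : h.V, h.pos v ∈ lineL →
      h.overvalency v = 0 ∧ h.numEdgesInFace 0 v = 1 ∧ h.numEdgesInFace 1 v = 1) ∧
    (Set.range p ⊆ face 0 →
      (h.preimageFace 1).IsUnionOfTrees (Multiset.card (fanInFace Δ 1))) := by
  classical
  obtain ⟨ht, hD, hval⟩ := hp.isTight hs hX hL hm hN hh
  obtain ⟨mk, hr, hmk, hthrough⟩ := hp.exists_isRigid hs hX hL hm hN hh
  obtain ⟨-, hΔ, hχ, hω, -⟩ := hh
  have hpr : ∀ i, p i ∈ Set.range h.eval := fun i => hω ⟨i, rfl⟩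
  refine ⟨hr.not_subset_lineL, fun v hv => ?_, hr.genus_eq, ?_, ?_, fun v hv => ?_, fun hf => ?_⟩
  · have hv0 : 0 < h.ht v := lt_of_le_of_ne (hD v) fun hc => hv ((ht.mem_lineL_iff v).2 hc.symm)
    exact ⟨hr.val_eq_three hmk hv0, hr.isEmbeddingNear hmk hv0⟩
  · rintro q ⟨i, rfl⟩
    exact ht.exists_fiber_eq (hp.generic _ ht hΔ hχ hpr) hpr hp.hgt_pos
      (card_eq hs hX hL hm hN hΔ hχ) i
  · refine ⟨Finset.univ.filter fun l => hgt (h.endDir l) < 0, ?_, hr.preimage_face_two hD⟩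
    subst hΔ
    rw [fanMult_newtonFan hs hX hm, Nat.card_eq_fintype_card, Fintype.card_subtype]
  · have hv0 := (ht.mem_lineL_iff v).1 hv
    refine ⟨?_, hr.numEdgesInFace_eq_one hv0 (by decide), hr.numEdgesInFace_eq_one hv0 (by decide)⟩
    rw [hr.overvalency_eq hv0, hval v hv]
    ring
  · rw [← hΔ]
    exact hr.isUnionOfTrees (by decide)
      (hr.not_subset_face_one (fun j => hf ⟨j, rfl⟩) hp.hgt_pos hthrough)

end IsGeneric

end

section

open TropicalMorphism

/-! ### Combinatorial types -/

/-- Combinatorial types of curves, with direction vectors bounded by `M`. -/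
structure CombType (M : ℤ) (n k m : ℕ) where
  src : Fin k → Fin n
  tgt : Fin k → Fin n
  root : Fin m → Fin n
  dir : Fin k → Fin 3 → Set.Icc (-M) M
  endDir : Fin m → Fin 3 → Set.Icc (-M) M
  onL : Fin n → Prop
  -- Recorded because `proj` identifies points of different faces.
  side : Fin n → Fin 3

instance (M : ℤ) (n k m : ℕ) : Finite (CombType M n k m) := by
  refine Finite.of_injective (fun c => (c.src, c.tgt, c.root, c.dir, c.endDir, c.onL, c.side)) ?_
  rintro ⟨⟩ ⟨⟩ hc
  simp only [Prod.mk.injEq] at hc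
  simp only [CombType.mk.injEq]
  exact hc

/-- A curve has a given combinatorial type. -/
structure HasType (h : TropicalMorphism) {M : ℤ} {n k m : ℕ} (c : CombType M n k m) where
  onV : h.V ≃ Fin n
  onE : h.E ≃ Fin k
  onΛ : h.Λ ≃ Fin m
  src_eq : ∀ e, c.src (onE e) = onV (h.src e)
  tgt_eq : ∀ e, c.tgt (onE e) = onV (h.tgt e)
  root_eq : ∀ l, c.root (onΛ l) = onV (h.root l)
  dir_eq : ∀ e j, (c.dir (onE e) j : ℤ) = h.dir e j
  endDir_eq : ∀ l j, (c.endDir (onΛ l) j : ℤ) = h.endDir l j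
  onL_iff : ∀ v, c.onL (onV v) ↔ h.ht v = 0
  mem_face : ∀ v, h.pos v ∈ face (c.side (onV v))

/-- A bound for the direction vectors of curves with a given Newton fan. -/
def dirBound (Δ : Multiset (Fin 3 → ℤ)) : ℤ := (Δ.map fun v => ∑ j, |v j|).sum

/-- A bound for the number of vertices and edges. -/
def sizeBound (Δ : Multiset (Fin 3 → ℤ)) (χ : ℤ) : ℕ := Multiset.card Δ + 3 * χ.natAbs

variable {h : TropicalMorphism}

theorem dirBound_newtonFan : dirBound h.newtonFan = ∑ l, ∑ j, |h.endDir l j| := sum_newtonFan _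

theorem TropicalMorphism.IsTight.flagDir_le_dirBound (ht : h.IsTight) (f : h.Flag) (j : Fin 3) :
    h.flagDir f j ≤ dirBound h.newtonFan := by
  rw [dirBound_newtonFan]
  have h1 : ∀ l, |h.endDir l j| ≤ ∑ j, |h.endDir l j| := fun l =>
    Finset.single_le_sum (f := fun j => |h.endDir l j|) (fun _ _ => abs_nonneg _) (Finset.mem_univ j)
  rcases f with ⟨e, b⟩ | l
  · exact (h.flagDir_le ht.len_pos (coordHom j) e b).trans (Finset.sum_le_sum fun l _ => h1 l)
  · exact (le_abs_self _).trans ((h1 l).trans (Finset.single_le_sum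
      (f := fun l => ∑ j, |h.endDir l j|) (fun _ _ => Finset.sum_nonneg fun _ _ => abs_nonneg _)
      (Finset.mem_univ l)))

theorem dirBound_nonneg (Δ : Multiset (Fin 3 → ℤ)) : 0 ≤ dirBound Δ := by
  refine Multiset.sum_nonneg fun x hx => ?_
  obtain ⟨v, -, rfl⟩ := Multiset.mem_map.1 hx
  exact Finset.sum_nonneg fun _ _ => abs_nonneg _

theorem TropicalMorphism.IsTight.flagDir_mem_Icc (ht : h.IsTight) (f : h.Flag) (j : Fin 3) :
    h.flagDir f j ∈ Set.Icc (-dirBound h.newtonFan) (dirBound h.newtonFan) := by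
  refine ⟨?_, ht.flagDir_le_dirBound f j⟩
  rcases f with ⟨e, b⟩ | l
  · have h1 := ht.flagDir_le_dirBound (.inl (e, !b)) j
    rw [h.flagDir_opp, Pi.neg_apply] at h1
    linarith
  · have h1 : |h.endDir l j| ≤ dirBound h.newtonFan := by
      rw [dirBound_newtonFan]
      exact (Finset.single_le_sum (f := fun j => |h.endDir l j|) (fun _ _ => abs_nonneg _)
        (Finset.mem_univ j)).trans (Finset.single_le_sum (f := fun l => ∑ j, |h.endDir l j|)
          (fun _ _ => Finset.sum_nonneg fun _ _ => abs_nonneg _) (Finset.mem_univ l))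
    have h2 := neg_abs_le (h.endDir l j)
    show _ ≤ h.endDir l j
    linarith

/-- Each vertex contributes at least 1 to the sum of val - 2 + 2 · genus, which equals #Λ - 2χ. Then
E = V - χ - genera is at most #Λ - 3χ. -/
theorem card_le_sizeBound (h : TropicalMorphism) :
    Fintype.card h.V ≤ sizeBound h.newtonFan h.tropEulerChar ∧
      Fintype.card h.E ≤ sizeBound h.newtonFan h.tropEulerChar ∧
      Fintype.card h.Λ ≤ sizeBound h.newtonFan h.tropEulerChar := by
  have h1 := h.sum_val
  have h2 : (Fintype.card h.V : ℤ) ≤ ∑ v, ((h.val v : ℤ) - 2 + 2 * h.genus v) := by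
    have := Finset.card_nsmul_le_sum Finset.univ (fun v => (h.val v : ℤ) - 2 + 2 * h.genus v) 1
      (fun v _ => by
        have := TropicalMorphism.three_le_val (h := h) v
        show (1 : ℤ) ≤ (h.val v : ℤ) - 2 + 2 * h.genus v
        omega)
    simpa using this
  rw [Finset.sum_add_distrib, Finset.sum_sub_distrib, ← Finset.mul_sum, h1, Finset.sum_const,
    Finset.card_univ, nsmul_eq_mul] at h2
  have h3 : h.tropEulerChar = Fintype.card h.V - Fintype.card h.E - ∑ v, (h.genus v : ℤ) := by
    unfold TropicalCurve.tropEulerChar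
    rw [PuncturedGraph.eulerChar_eq]
  have h4 : (0 : ℤ) ≤ ∑ v, (h.genus v : ℤ) := Finset.sum_nonneg fun _ _ => Nat.cast_nonneg _
  unfold sizeBound
  rw [card_newtonFan]
  generalize h.tropEulerChar = χ at *
  refine ⟨?_, ?_, ?_⟩ <;> omega

theorem TropicalMorphism.IsTight.exists_hasType (ht : h.IsTight) :
    ∃ (n k m : Fin (sizeBound h.newtonFan h.tropEulerChar + 1))
      (c : CombType (dirBound h.newtonFan) n k m), Nonempty (HasType h c) := by
  classical
  obtain ⟨h1, h2, h3⟩ := card_le_sizeBound h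
  let eV := Fintype.equivFin h.V
  let eE := Fintype.equivFin h.E
  let eΛ := Fintype.equivFin h.Λ
  choose i hi using ht.exists_face
  refine ⟨⟨_, Nat.lt_succ_of_le h1⟩, ⟨_, Nat.lt_succ_of_le h2⟩, ⟨_, Nat.lt_succ_of_le h3⟩,
    { src := fun e => eV (h.src (eE.symm e))
      tgt := fun e => eV (h.tgt (eE.symm e))
      root := fun l => eV (h.root (eΛ.symm l))
      dir := fun e j => ⟨h.dir (eE.symm e) j, ht.flagDir_mem_Icc (.inl (eE.symm e, false)) j⟩
      endDir := fun l j => ⟨h.endDir (eΛ.symm l) j, ht.flagDir_mem_Icc (.inr (eΛ.symm l)) j⟩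
      onL := fun v => h.ht (eV.symm v) = 0
      side := fun v => i (eV.symm v) }, ⟨⟨eV, eE, eΛ, ?_, ?_, ?_, ?_, ?_, ?_, ?_⟩⟩⟩
  · intro e; simp
  · intro e; simp
  · intro l; simp
  · intro e j; simp
  · intro e j; simp
  · intro v; simp
  · intro v; simpa using hi v

/-! ### Spaces of incidence conditions -/

/-- The space of configurations that can be reached by deformations of a combinatorial type
subject to two families of incidence conditions. -/
def incidenceSpace {M : ℤ} {n k m N : ℕ} (c : CombType M n k m) (b b' : Fin N → Fin n)
    (w w' : Fin N → Fin 3 → Set.Icc (-M) M) : Submodule ℝ (Fin N → ℝ × ℝ) where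
  carrier := {q | ∃ P : Fin n → ℝ × ℝ, (∀ v, c.onL v → (P v).2 = 0) ∧
    (∀ e, ∃ a : ℝ, P (c.tgt e) = P (c.src e) + a • pdir (fun j => c.dir e j)) ∧
    ∀ i, (∃ a : ℝ, q i = P (b i) + a • pdir (fun j => w i j)) ∧
      ∃ a : ℝ, q i = P (b' i) + a • pdir (fun j => w' i j)}
  zero_mem' := ⟨0, fun _ _ => rfl, fun _ => ⟨0, by simp⟩, fun _ => ⟨⟨0, by simp⟩, ⟨0, by simp⟩⟩⟩
  add_mem' := by
    rintro q q' ⟨P, h1, h2, h3⟩ ⟨P', h1', h2', h3'⟩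
    refine ⟨P + P', fun v hv => ?_, fun e => ?_, fun i => ⟨?_, ?_⟩⟩
    · rw [Pi.add_apply, Prod.snd_add, h1 v hv, h1' v hv, add_zero]
    · obtain ⟨a, ha⟩ := h2 e
      obtain ⟨a', ha'⟩ := h2' e
      exact ⟨a + a', by simp only [Pi.add_apply]; rw [ha, ha', add_smul]; abel⟩
    · obtain ⟨a, ha⟩ := (h3 i).1
      obtain ⟨a', ha'⟩ := (h3' i).1
      exact ⟨a + a', by simp only [Pi.add_apply]; rw [ha, ha', add_smul]; abel⟩
    · obtain ⟨a, ha⟩ := (h3 i).2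
      obtain ⟨a', ha'⟩ := (h3' i).2
      exact ⟨a + a', by simp only [Pi.add_apply]; rw [ha, ha', add_smul]; abel⟩
  smul_mem' := by
    rintro r q ⟨P, h1, h2, h3⟩
    refine ⟨r • P, fun v hv => ?_, fun e => ?_, fun i => ⟨?_, ?_⟩⟩
    · rw [Pi.smul_apply, Prod.smul_snd, h1 v hv, smul_zero]
    · obtain ⟨a, ha⟩ := h2 e
      exact ⟨r * a, by simp only [Pi.smul_apply]; rw [ha, smul_add, mul_smul]⟩
    · obtain ⟨a, ha⟩ := (h3 i).1
      exact ⟨r * a, by simp only [Pi.smul_apply]; rw [ha, smul_add, mul_smul]⟩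
    · obtain ⟨a, ha⟩ := (h3 i).2
      exact ⟨r * a, by simp only [Pi.smul_apply]; rw [ha, smul_add, mul_smul]⟩

/-- The data of an incidence space. -/
abbrev IncidenceData (M : ℤ) (B N : ℕ) : Type :=
  Σ n : Fin (B + 1), Σ k : Fin (B + 1), Σ m : Fin (B + 1), CombType M n k m ×
    (Fin N → Fin n) × (Fin N → Fin n) × (Fin N → Fin 3 → Set.Icc (-M) M) ×
    (Fin N → Fin 3 → Set.Icc (-M) M)

instance (M : ℤ) (B N : ℕ) : Finite (IncidenceData M B N) := by
  have h1 : Finite (Fin N → Fin 3 → Set.Icc (-M) M) := inferInstance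
  have h2 : ∀ n k m : ℕ, Finite (CombType M n k m × (Fin N → Fin n) × (Fin N → Fin n) ×
      (Fin N → Fin 3 → Set.Icc (-M) M) × (Fin N → Fin 3 → Set.Icc (-M) M)) := fun n k m =>
    have := h1
    have : Finite ((Fin N → Fin n) × (Fin N → Fin n) ×
      (Fin N → Fin 3 → Set.Icc (-M) M) × (Fin N → Fin 3 → Set.Icc (-M) M)) := inferInstance
    inferInstance
  unfold IncidenceData
  infer_instance

/-- The incidence space defined by the data. -/
def IncidenceData.space {M : ℤ} {B N : ℕ} (s : IncidenceData M B N) :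
    Submodule ℝ (Fin N → ℝ × ℝ) :=
  incidenceSpace s.2.2.2.1 s.2.2.2.2.1 s.2.2.2.2.2.1 s.2.2.2.2.2.2.1 s.2.2.2.2.2.2.2

/-- The vertex positions of a curve with the given incidences show that the configuration lies in
the corresponding incidence space. That space is therefore everything, so each displacement of the
points is induced by a deformation. -/
theorem isGeneric_of_space {Δ : Multiset (Fin 3 → ℤ)} {χ : ℤ} {N : ℕ} {p : Fin N → Fin 3 → ℝ}
    (hpos : ∀ i, 0 < hgt (p i))
    (hp : ∀ s : IncidenceData (dirBound Δ) (sizeBound Δ χ) N,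
      (fun i => proj (p i)) ∈ s.space → s.space = ⊤) : IsGeneric Δ χ p := by
  refine ⟨hpos, fun h ht hΔ hχ _ b b' w w' hw hw' hi hi' q => ?_⟩
  subst hΔ hχ
  obtain ⟨n, k, m, c, ⟨H⟩⟩ := ht.exists_hasType
  have bound : ∀ w : Fin N → Fin 3 → ℤ, (∀ i, w i = 0 ∨ ∃ f, w i = h.flagDir f) → ∀ i j,
      w i j ∈ Set.Icc (-dirBound h.newtonFan) (dirBound h.newtonFan) := by
    intro w hw i j
    rcases hw i with h1 | ⟨f, hf⟩
    · rw [h1]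
      have := dirBound_nonneg h.newtonFan
      exact ⟨by simpa using this, by simpa using this⟩
    · rw [hf]
      exact ht.flagDir_mem_Icc f j
  have hdir : ∀ e, (fun j => (c.dir (H.onE e) j : ℤ)) = h.dir e := fun e => funext (H.dir_eq e)
  have htop := hp ⟨n, k, m, c, fun i => H.onV (b i), fun i => H.onV (b' i),
    fun i j => ⟨w i j, bound w hw i j⟩, fun i j => ⟨w' i j, bound w' hw' i j⟩⟩
    ⟨fun v => proj (h.pos (H.onV.symm v)), fun v hv => ?_, fun e => ?_, fun i => ⟨?_, ?_⟩⟩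
  · have hq : q ∈ (⊤ : Submodule ℝ (Fin N → ℝ × ℝ)) := Submodule.mem_top
    rw [← htop] at hq
    obtain ⟨P, h1, h2, h3⟩ := hq
    refine ⟨fun v => P (H.onV v), ⟨fun v hv => h1 _ ((H.onL_iff v).2 hv), fun e => ?_⟩, h3⟩
    have := h2 (H.onE e)
    simp only [H.src_eq, H.tgt_eq, hdir] at this
    exact this
  · have := (H.onL_iff (H.onV.symm v)).1 (by rw [Equiv.apply_symm_apply]; exact hv)
    exact this
  · obtain ⟨e, rfl⟩ := H.onE.surjective e
    refine ⟨h.len e, ?_⟩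
    simp only [H.src_eq, H.tgt_eq, hdir, Equiv.symm_apply_apply]
    rw [← proj_line]
    exact congrArg proj (funext (h.affine e))
  · simpa using hi i
  · simpa using hi' i

/-! ### Finiteness -/

theorem eq_of_proj_eq {p q : Fin 3 → ℝ} {i : Fin 3} (hp : p ∈ face i) (hq : q ∈ face i)
    (hpq : proj p = proj q) : p = q := by
  have h0 : p 0 = q 0 := congrArg Prod.fst hpq
  have h1 : hgt p = hgt q := congrArg Prod.snd hpq
  have h2 : sid p = sid q := by
    fin_cases i
    · rw [(mem_face_zero.1 hp).1, (mem_face_zero.1 hq).1, h1]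
    · rw [(mem_face_one.1 hp).1, (mem_face_one.1 hq).1, h1]
    · rw [(mem_face_two.1 hp).1, (mem_face_two.1 hq).1]
  simp only [hgt, sid] at h1 h2
  funext j
  fin_cases j
  · exact h0
  · show p 1 = q 1
    linarith
  · show p 2 = q 2
    linarith

theorem finiteUpToIso_of_code {S : Set TropicalMorphism} {C : Type} [Finite C]
    (R : TropicalMorphism → C → Prop) (h1 : ∀ h ∈ S, ∃ c, R h c)
    (h2 : ∀ h ∈ S, ∀ h' ∈ S, ∀ c, R h c → R h' c → Nonempty (Iso h h')) : FiniteUpToIso S := by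
  classical
  let D := {c : C // ∃ h ∈ S, R h c}
  let rep : D → TropicalMorphism := fun c => c.2.choose
  have hrep : ∀ c : D, rep c ∈ S ∧ R (rep c) c.1 := fun c => c.2.choose_spec
  refine ⟨Set.range rep, Set.finite_range rep, ?_, fun h hh => ?_⟩
  · rintro _ ⟨c, rfl⟩
    exact (hrep c).1
  · obtain ⟨c, hc⟩ := h1 h hh
    exact ⟨_, ⟨⟨c, h, hh, hc⟩, rfl⟩, h2 h hh _ (hrep _).1 c hc (hrep ⟨c, h, hh, hc⟩).2⟩

/-- Transport of flags to a combinatorial type. -/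
def HasType.onFlag {M : ℤ} {n k m : ℕ} {c : CombType M n k m} (H : HasType h c) :
    h.Flag ≃ (Fin k × Bool) ⊕ Fin m :=
  Equiv.sumCongr (Equiv.prodCongr H.onE (Equiv.refl _)) H.onΛ

section Compare

variable {h' : TropicalMorphism} {M : ℤ} {n k m : ℕ} {c : CombType M n k m} (H : HasType h c)
  (H' : HasType h' c)

/-- The vertices of curves of the same type correspond. -/
def HasType.equivV : h.V ≃ h'.V := H.onV.trans H'.onV.symm

/-- The edges of curves of the same type correspond. -/
def HasType.equivE : h.E ≃ h'.E := H.onE.trans H'.onE.symm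

/-- The ends of curves of the same type correspond. -/
def HasType.equivΛ : h.Λ ≃ h'.Λ := H.onΛ.trans H'.onΛ.symm

theorem HasType.src_equivE (e : h.E) : h'.src (H.equivE H' e) = H.equivV H' (h.src e) := by
  apply H'.onV.injective
  rw [← H'.src_eq]
  simp [equivE, equivV, H.src_eq]

theorem HasType.tgt_equivE (e : h.E) : h'.tgt (H.equivE H' e) = H.equivV H' (h.tgt e) := by
  apply H'.onV.injective
  rw [← H'.tgt_eq]
  simp [equivE, equivV, H.tgt_eq]

theorem HasType.root_equivΛ (l : h.Λ) : h'.root (H.equivΛ H' l) = H.equivV H' (h.root l) := by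
  apply H'.onV.injective
  rw [← H'.root_eq]
  simp [equivΛ, equivV, H.root_eq]

theorem HasType.dir_equivE (e : h.E) : h'.dir (H.equivE H' e) = h.dir e := by
  funext j
  rw [← H'.dir_eq, ← H.dir_eq]
  simp [equivE]

theorem HasType.endDir_equivΛ (l : h.Λ) : h'.endDir (H.equivΛ H' l) = h.endDir l := by
  funext j
  rw [← H'.endDir_eq, ← H.endDir_eq]
  simp [equivΛ]

theorem HasType.ht_equivV (v : h.V) : h'.ht (H.equivV H' v) = 0 ↔ h.ht v = 0 := by
  rw [← H'.onL_iff, ← H.onL_iff]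
  simp [equivV]

theorem HasType.flag_eq {f : h.Flag} {f' : h'.Flag} (hf : H.onFlag f = H'.onFlag f') :
    h'.flagDir f' = h.flagDir f ∧ h'.base f' = H.equivV H' (h.base f) := by
  rcases f with ⟨e, b⟩ | l <;> rcases f' with ⟨e', b'⟩ | l'
  · simp only [onFlag, Equiv.sumCongr_apply, Sum.map_inl, Equiv.prodCongr_apply, Prod.map_apply,
      Equiv.refl_apply, Sum.inl.injEq, Prod.mk.injEq] at hf
    obtain ⟨h1, rfl⟩ := hf
    have h2 : e' = H.equivE H' e := by simp [equivE, h1]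
    subst h2
    cases b
    · exact ⟨H.dir_equivE H' e, H.src_equivE H' e⟩
    · exact ⟨congrArg Neg.neg (H.dir_equivE H' e), H.tgt_equivE H' e⟩
  · simp [onFlag] at hf
  · simp [onFlag] at hf
  · simp only [onFlag, Equiv.sumCongr_apply, Sum.map_inr, Sum.inr.injEq] at hf
    have h2 : l' = H.equivΛ H' l := by simp [equivΛ, hf]
    subst h2
    exact ⟨H.endDir_equivΛ H' l, H.root_equivΛ H' l⟩

/-- The difference of the positions of curves of the same type. -/
def HasType.diff (v : h.V) : ℝ × ℝ := proj (h'.pos (H.equivV H' v)) - proj (h.pos v)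

theorem HasType.isDeformation_diff : h.IsDeformation (H.diff H') where
  line v hv := by
    have h1 : hgt (h'.pos (H.equivV H' v)) = 0 := (H.ht_equivV H' v).2 hv
    have h2 : hgt (h.pos v) = 0 := hv
    simp [diff, proj, h1, h2]
  edge e := by
    refine ⟨h'.len (H.equivE H' e) - h.len e, ?_⟩
    have h1 : proj (h.pos (h.tgt e)) = proj (h.pos (h.src e)) + h.len e • pdir (h.dir e) := by
      rw [← proj_line]
      exact congrArg proj (funext (h.affine e))
    have h2 : proj (h'.pos (h'.tgt (H.equivE H' e))) = proj (h'.pos (h'.src (H.equivE H' e))) +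
        h'.len (H.equivE H' e) • pdir (h'.dir (H.equivE H' e)) := by
      rw [← proj_line]
      exact congrArg proj (funext (h'.affine _))
    rw [H.tgt_equivE, H.src_equivE, H.dir_equivE] at h2
    unfold diff
    rw [h1, h2, sub_smul]
    abel

theorem HasType.iso (hpos : ∀ v, h'.pos (H.equivV H' v) = h.pos v) (hg : ∀ v, h.genus v = 0)
    (hg' : ∀ v, h'.genus v = 0) (hdir : ∀ e, h.dir e ≠ 0) : Nonempty (Iso h h') := by
  refine ⟨⟨H.equivV H', H.equivE H', H.equivΛ H', fun v => by rw [hg, hg'], hpos, fun e => ?_,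
    fun e => Or.inl ⟨H.src_equivE H' e, H.tgt_equivE H' e, H.dir_equivE H' e⟩,
    H.root_equivΛ H', H.endDir_equivΛ H'⟩⟩
  obtain ⟨j, hj⟩ := Function.ne_iff.1 (hdir e)
  have h1 := h.affine e j
  have h2 := h'.affine (H.equivE H' e) j
  rw [H.tgt_equivE, H.src_equivE, H.dir_equivE, hpos, hpos, h1] at h2
  have h3 : (h.dir e j : ℝ) ≠ 0 := by exact_mod_cast hj
  exact (mul_right_cancel₀ h3 (add_left_cancel h2)).symm

end Compare

namespace IsGeneric

variable {Δ : Multiset (Fin 3 → ℤ)} {χ : ℤ} {N : ℕ}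
  (hs : Δ.sum = 0) (hX : ∀ v ∈ Δ, v ∈ surfaceX) (hL : ∀ v ∈ Δ, v ∉ lineL)
  (hm : ∀ v ∈ fanInFace Δ 2, vecMult v = 1)
  (hN : (N : ℤ) = (Multiset.card Δ : ℤ) - χ - fanMult Δ)
  {p : Fin N → Fin 3 → ℝ} (hp : IsGeneric Δ χ p)
include hs hX hL hm hN hp

/-- The difference of the two curves is a deformation with zero marked moments, so by rigidity all
its moments and its positions on L vanish. A nonzero displacement off L would be parallel to all
edges at the vertex. -/
theorem nonempty_iso {h' : TropicalMorphism} (hh : h ∈ TS Δ χ (Set.range p))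
    (hh' : h' ∈ TS Δ χ (Set.range p)) {M : ℤ} {n k m : ℕ} {c : CombType M n k m}
    (H : HasType h c) (H' : HasType h' c) {f : Fin N → h.Flag} {f' : Fin N → h'.Flag}
    (hf : ∀ i, h.Up (h.edgeOf (f i))) (hfp : ∀ i, h.Through (f i) (p i))
    (hfp' : ∀ i, h'.Through (f' i) (p i)) (hff : ∀ i, H.onFlag (f i) = H'.onFlag (f' i)) :
    Nonempty (Iso h h') := by
  classical
  obtain ⟨ht, hD, -⟩ := hp.isTight hs hX hL hm hN hh
  obtain ⟨_, hr', -⟩ := hp.exists_isRigid hs hX hL hm hN hh'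
  obtain ⟨-, hΔ, hχ, hω, -⟩ := hh
  have hpr : ∀ i, p i ∈ Set.range h.eval := fun i => hω ⟨i, rfl⟩
  have hg := hp.generic _ ht hΔ hχ hpr
  have hr : h.IsRigid (flagMark hf) := ht.isRigid (hg.exists_deformation' ht hf hfp)
    (by rw [card_eq hs hX hL hm hN hΔ hχ, Nat.card_eq_fintype_card])
  have hP := H.isDeformation_diff H'
  have hmark : ∀ i, mom (h.flagDir (f i)) (H.diff H' (h.base (f i))) = 0 := by
    intro i
    obtain ⟨a, ha⟩ := hfp i
    obtain ⟨a', ha'⟩ := hfp' i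
    obtain ⟨e1, e2⟩ := H.flag_eq H' (hff i)
    rw [e1, e2] at ha'
    unfold HasType.diff
    rw [mom_sub, ← mom_add_smul_self _ _ a', ← ha',
      ← mom_add_smul_self (h.flagDir (f i)) (proj (h.pos (h.base (f i)))) a, ← ha, sub_self]
  have hdiff : ∀ v, H.diff H' v = 0 := by
    intro v
    rcases (hD v).eq_or_lt with h0 | h0
    · refine Prod.ext ?_ (hP.line v h0.symm)
      have h1 := hr.eq_zero (hP.system_moments ht) (fun i => by
        show h.edgeMom _ (h.edgeOf (f i)) = 0
        rw [hP.edgeMom_eq, hmark, mul_zero])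
      exact congrFun h1 (.inr ⟨v, h0.symm, hr.active v⟩)
    · by_contra hne
      refine hr.not_parallel hg hfp h0 hne fun g hgv => ?_
      have := hr.mom_eq_zero hP hmark (g := g) (hr.up_of_pos (by rw [hgv]; exact h0))
      rwa [hgv] at this
  refine H.iso H' (fun v => ?_) hr.genus_eq hr'.genus_eq
    (fun e => hr.flagDir_ne_zero (.inl (e, false)))
  have h1 := H'.mem_face (H.equivV H' v)
  have h2 : H'.onV (H.equivV H' v) = H.onV v := by simp [HasType.equivV]
  rw [h2] at h1
  exact eq_of_proj_eq h1 (H.mem_face v) (sub_eq_zero.1 (hdiff v))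

/-- The combinatorial type together with the flags through the points is a finite invariant that
determines the curve. -/
theorem finiteUpToIso : FiniteUpToIso (TS Δ χ (Set.range p)) := by
  refine finiteUpToIso_of_code
    (C := Σ n : Fin (sizeBound Δ χ + 1), Σ k : Fin (sizeBound Δ χ + 1),
      Σ m : Fin (sizeBound Δ χ + 1),
      CombType (dirBound Δ) n k m × (Fin N → (Fin k × Bool) ⊕ Fin m))
    (fun h C => ∃ (H : HasType h C.2.2.2.1) (f : Fin N → h.Flag),
      (∀ i, h.Up (h.edgeOf (f i))) ∧ (∀ i, h.Through (f i) (p i)) ∧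
      ∀ i, H.onFlag (f i) = C.2.2.2.2 i) (fun h hh => ?_) ?_
  · obtain ⟨ht, -⟩ := hp.isTight hs hX hL hm hN hh
    obtain ⟨-, rfl, rfl, hω, -⟩ := hh
    choose f hf a ha using fun i => ht.exists_up_flag_through (hω ⟨i, rfl⟩) (hp.hgt_pos i)
    obtain ⟨n, k, m, c, ⟨H⟩⟩ := ht.exists_hasType
    refine ⟨⟨n, k, m, c, fun i => H.onFlag (f i)⟩, H, f, hf, fun i => ⟨a i, ?_⟩, fun _ => rfl⟩
    rw [ha i, proj_line]
  · rintro h hh h' hh' ⟨n, k, m, c, g⟩ ⟨H, f, hf, hfp, hg⟩ ⟨H', f', -, hfp', hg'⟩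
    exact hp.nonempty_iso hs hX hL hm hN hh hh' H H' hf hfp hfp'
      fun i => (hg i).trans (hg' i).symm

end IsGeneric

end

section

open Filter Topology

/-! ### Generic configurations form a dense open set -/

/-- The union of the first two faces. -/
abbrev UpperFaces : Type := ↥(face 0 ∪ face 1 : Set (Fin 3 → ℝ))

theorem UpperFaces.hgt_nonneg (p : UpperFaces) : 0 ≤ hgt (p : Fin 3 → ℝ) := by
  rcases p.2 with h | h
  · exact (mem_face_zero.1 h).2
  · exact (mem_face_one.1 h).2

theorem continuous_hgt : Continuous (hgt : (Fin 3 → ℝ) → ℝ) := by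
  unfold hgt
  fun_prop

/-- The projection of a configuration to the plane. -/
def projAll {N : ℕ} (p : Fin N → UpperFaces) (i : Fin N) : ℝ × ℝ := proj (p i)

theorem continuous_projAll {N : ℕ} : Continuous (projAll (N := N)) := by
  refine continuous_pi fun i => ?_
  have h1 : Continuous fun p : Fin N → UpperFaces => ((p i : UpperFaces) : Fin 3 → ℝ) :=
    continuous_subtype_val.comp (continuous_apply i)
  exact ((continuous_apply 0).comp h1).prodMk (continuous_hgt.comp h1)

/-- A section of the projection over a face: the points with positive height can be moved freely
in the first two faces. -/
theorem UpperFaces.exists_section (p : UpperFaces) : ∃ F : ℝ × ℝ → Fin 3 → ℝ, Continuous F ∧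
    F (proj p) = p ∧ (∀ q, proj (F q) = q) ∧ ∀ q, 0 ≤ q.2 → F q ∈ (face 0 ∪ face 1) := by
  have c0 : Continuous fun q : ℝ × ℝ => (![q.1, q.1, q.1 - q.2] : Fin 3 → ℝ) :=
    continuous_pi fun j => by fin_cases j <;> simp <;> fun_prop
  have c1 : Continuous fun q : ℝ × ℝ => (![q.1, q.1 - q.2, q.1] : Fin 3 → ℝ) :=
    continuous_pi fun j => by fin_cases j <;> simp <;> fun_prop
  have m0 : ∀ q : ℝ × ℝ, 0 ≤ q.2 → (![q.1, q.1, q.1 - q.2] : Fin 3 → ℝ) ∈ face 0 := by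
    intro q hq
    refine mem_face_zero.2 ⟨?_, ?_⟩
    · simp [sid, hgt]; ring
    · simp [hgt]; linarith
  have m1 : ∀ q : ℝ × ℝ, 0 ≤ q.2 → (![q.1, q.1 - q.2, q.1] : Fin 3 → ℝ) ∈ face 1 := by
    intro q hq
    refine mem_face_one.2 ⟨?_, ?_⟩
    · simp [sid, hgt]; ring
    · simp [hgt]; linarith
  have p0 : ∀ q : ℝ × ℝ, proj (![q.1, q.1, q.1 - q.2] : Fin 3 → ℝ) = q := by
    intro q
    refine Prod.ext rfl ?_
    simp [proj, hgt]; ring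
  have p1 : ∀ q : ℝ × ℝ, proj (![q.1, q.1 - q.2, q.1] : Fin 3 → ℝ) = q := by
    intro q
    refine Prod.ext rfl ?_
    simp [proj, hgt]; ring
  rcases p.2 with h | h
  · exact ⟨_, c0, eq_of_proj_eq (m0 _ p.hgt_nonneg) h (p0 _), p0, fun q hq => Or.inl (m0 q hq)⟩
  · exact ⟨_, c1, eq_of_proj_eq (m1 _ p.hgt_nonneg) h (p1 _), p1, fun q hq => Or.inr (m1 q hq)⟩

/-- The configurations off `L` that avoid a subspace, unless it is the whole space. -/
def avoiding {N : ℕ} (W : Submodule ℝ (Fin N → ℝ × ℝ)) : Set (Fin N → UpperFaces) :=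
  {p | (∀ i, 0 < hgt (p i : Fin 3 → ℝ)) ∧ (projAll p ∈ W → W = ⊤)}

variable {N : ℕ} (W : Submodule ℝ (Fin N → ℝ × ℝ))

theorem isOpen_avoiding : IsOpen (avoiding W) := by
  have h1 : IsOpen {p : Fin N → UpperFaces | ∀ i, 0 < hgt (p i : Fin 3 → ℝ)} := by
    rw [Set.ofPred_forall]
    exact isOpen_iInter_of_finite fun i => isOpen_lt continuous_const
      (continuous_hgt.comp (continuous_subtype_val.comp (continuous_apply i)))
  by_cases hW : W = ⊤
  · have : avoiding W = {p : Fin N → UpperFaces | ∀ i, 0 < hgt (p i : Fin 3 → ℝ)} := by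
      ext p
      simp [avoiding, hW]
    rw [this]
    exact h1
  · have : avoiding W = {p : Fin N → UpperFaces | ∀ i, 0 < hgt (p i : Fin 3 → ℝ)} ∩
        projAll ⁻¹' (W : Set (Fin N → ℝ × ℝ))ᶜ := by
      ext p
      simp [avoiding, hW]
    rw [this]
    exact h1.inter (W.closed_of_finiteDimensional.isOpen_compl.preimage continuous_projAll)

/-- A proper subspace does not contain all configurations of positive height. -/
theorem exists_pos_notMem (hW : W ≠ ⊤) : ∃ q : Fin N → ℝ × ℝ, (∀ i, 0 < (q i).2) ∧ q ∉ W := by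
  by_contra hc
  push Not at hc
  refine hW (Submodule.eq_top_iff'.2 fun q => ?_)
  set K : ℝ := ∑ i, |(q i).2| + 1 with hK
  have hKi : ∀ i, |(q i).2| < K := fun i => by
    have := Finset.single_le_sum (f := fun i => |(q i).2|) (fun _ _ => abs_nonneg _)
      (Finset.mem_univ i)
    linarith
  -- Every vector is a difference of two configurations of positive height.
  have h1 := hc (fun _ => (0, K)) fun i => (abs_nonneg _).trans_lt (hKi i)
  have h2 := hc (q + fun _ => (0, K)) fun i => by
    have := neg_abs_le (q i).2
    have := hKi i
    show 0 < (q i).2 + K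
    linarith
  simpa using W.sub_mem h2 h1

/-- Push `p` in a direction `q` of positive heights outside `W`. The heights become positive at
once, and the path meets a proper `W` for at most one positive parameter. -/
theorem dense_avoiding : Dense (avoiding W) := by
  intro p
  obtain ⟨q, hq, hqW⟩ : ∃ q : Fin N → ℝ × ℝ, (∀ i, 0 < (q i).2) ∧ (W ≠ ⊤ → q ∉ W) := by
    by_cases hW : W = ⊤
    · exact ⟨fun _ => (0, 1), fun _ => one_pos, fun hc => absurd hW hc⟩
    · obtain ⟨q, h1, h2⟩ := exists_pos_notMem W hW
      exact ⟨q, h1, fun _ => h2⟩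
  choose F hF1 hF2 hF3 hF4 using fun i => (p i).exists_section
  have hpos : ∀ i, 0 ≤ (proj (p i)).2 := fun i => (p i).hgt_nonneg
  have hnn : ∀ (ε : ℝ) i, 0 ≤ (proj (p i) + |ε| • q i).2 := fun ε i =>
    add_nonneg (hpos i) (mul_nonneg (abs_nonneg ε) (hq i).le)
  -- The absolute value keeps the heights nonnegative, so the path is defined and continuous on the
  -- whole line.
  let path : ℝ → Fin N → UpperFaces := fun ε i => ⟨F i (proj (p i) + |ε| • q i), hF4 i _ (hnn ε i)⟩
  have hcont : Continuous path := by
    refine continuous_pi fun i => Continuous.subtype_mk ?_ _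
    exact (hF1 i).comp (continuous_const.add (continuous_abs.smul continuous_const))
  have h0 : path 0 = p := by
    funext i
    refine Subtype.ext ?_
    show F i (proj (p i) + |(0 : ℝ)| • q i) = p i
    rw [abs_zero, zero_smul, add_zero, hF2]
  have hproj : ∀ ε, projAll (path ε) = projAll p + |ε| • q := fun ε =>
    funext fun i => hF3 i _
  have hev : ∀ᶠ ε in 𝓝[>] (0 : ℝ), path ε ∈ avoiding W := by
    have h1 : ∀ ε : ℝ, 0 < ε → ∀ i, 0 < hgt (path ε i : Fin 3 → ℝ) := by
      intro ε hε i
      have : hgt (path ε i : Fin 3 → ℝ) = (proj (p i) + |ε| • q i).2 :=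
        congrArg Prod.snd (hF3 i _)
      rw [this]
      exact add_pos_of_nonneg_of_pos (hpos i) (mul_pos (abs_pos.2 hε.ne') (hq i))
    -- If `ε₀` is a bad parameter, a smaller bad one would put a nonzero multiple of `q` into `W`;
    -- so all parameters below `ε₀` are good.
    by_cases hex : ∃ ε₀ : ℝ, 0 < ε₀ ∧ projAll (path ε₀) ∈ W
    · obtain ⟨ε₀, hε₀, hm₀⟩ := hex
      filter_upwards [Ioo_mem_nhdsGT hε₀] with ε hε
      refine ⟨h1 ε hε.1, fun hm => ?_⟩
      by_contra hW
      apply hqW hW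
      have h2 := W.sub_mem hm₀ hm
      rw [hproj, hproj, add_sub_add_left_eq_sub, ← sub_smul, abs_of_pos hε₀, abs_of_pos hε.1] at h2
      exact (W.smul_mem_iff (sub_pos.2 hε.2).ne').1 h2
    · push Not at hex
      filter_upwards [self_mem_nhdsWithin] with ε hε
      exact ⟨h1 ε hε, fun hm => absurd hm (hex ε hε)⟩
  have hlim : Tendsto path (𝓝[>] (0 : ℝ)) (𝓝 p) := by
    have := (hcont.tendsto 0).mono_left (nhdsWithin_le_nhds (s := Set.Ioi 0))
    rwa [h0] at this
  exact mem_closure_of_tendsto hlim hev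

theorem isOpen_dense_iInter {X ι : Type*} [TopologicalSpace X] [Finite ι] {U : ι → Set X}
    (ho : ∀ i, IsOpen (U i)) (hd : ∀ i, Dense (U i)) : IsOpen (⋂ i, U i) ∧ Dense (⋂ i, U i) := by
  classical
  have := Fintype.ofFinite ι
  have key : ∀ s : Finset ι, Dense (⋂ i ∈ s, U i) := by
    intro s
    induction s using Finset.induction with
    | empty => simp
    | insert a s _ ih =>
      rw [Finset.set_biInter_insert]
      exact (hd a).inter_of_isOpen_left ih (ho a)
  refine ⟨isOpen_iInter_of_finite ho, ?_⟩
  simpa using key Finset.univ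

end

end TropicalX

end

theorem proposition4p2
    (Δ : Multiset (Fin 3 → ℤ)) (χ : ℤ)
    (hbalanced : Δ.sum = 0)
    (hX : ∀ v ∈ Δ, v ∈ TropicalX.surfaceX)
    (hL : ∀ v ∈ Δ, v ∉ TropicalX.lineL)
    (hΔ₃ : ∀ v ∈ TropicalX.fanInFace Δ 2, TropicalX.vecMult v = 1)
    (N : ℕ)
    (hN : (N : ℤ) = (Multiset.card Δ : ℤ) - χ - TropicalX.fanMult Δ) :
    ∃ U : Set (Fin N →
        ↥(TropicalX.face 0 ∪ TropicalX.face 1 : Set (Fin 3 → ℝ))),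
      IsOpen U ∧ Dense U ∧
      ∀ p ∈ U, ∀ ω : Set (Fin 3 → ℝ), ω = Set.range (fun i => (p i : Fin 3 → ℝ)) →
        TropicalX.FiniteUpToIso (TropicalX.TS Δ χ ω) ∧
        ∀ h ∈ TropicalX.TS Δ χ ω,
          -- no edge is mapped into `L`
          (∀ e : h.Edge, ¬ h.edgeImage e ⊆ TropicalX.lineL) ∧
          -- vertices off `L` are trivalent, and `h` is an embedding near them
          (∀ v : h.V, h.pos v ∉ TropicalX.lineL → h.val v = 3 ∧ h.IsEmbeddingNear v) ∧
          -- the curve is explicit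
          h.IsExplicit ∧
          -- the fibre over a point of `ω` is one point, in the interior of an edge
          (∀ q ∈ ω, ∃ x : h.Point, h.eval ⁻¹' {q} = {x} ∧ ∀ v : h.V, x ≠ .vertex v) ∧
          -- the preimage of the third face is a union of `d` ends
          (∃ S : Finset h.Λ, (S.card : ℤ) = TropicalX.fanMult Δ ∧
            h.eval ⁻¹' TropicalX.face 2 = ⋃ l ∈ S, h.closedEdge (.inr l)) ∧
          -- vertices on `L` have overvalency `0` and one edge in each of the first two faces
          (∀ v : h.V, h.pos v ∈ TropicalX.lineL →
            h.overvalency v = 0 ∧ h.numEdgesInFace 0 v = 1 ∧ h.numEdgesInFace 1 v = 1) ∧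
          -- if `ω` lies in the first face, its second-face part consists of trees
          (ω ⊆ TropicalX.face 0 →
            (h.preimageFace 1).IsUnionOfTrees (Multiset.card (TropicalX.fanInFace Δ 1))) := by
  -- the whole space is added to the family of incidence spaces, which might be empty
  obtain ⟨ho, hd⟩ := TropicalX.isOpen_dense_iInter
    (fun s : Option (TropicalX.IncidenceData (TropicalX.dirBound Δ) (TropicalX.sizeBound Δ χ) N) =>
      TropicalX.isOpen_avoiding (s.elim ⊤ TropicalX.IncidenceData.space))
    (fun s => TropicalX.dense_avoiding (s.elim ⊤ TropicalX.IncidenceData.space))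
  refine ⟨_, ho, hd, fun p hp ω hω => ?_⟩
  subst hω
  have hp := Set.mem_iInter.1 hp
  have hgen : TropicalX.IsGeneric Δ χ (fun i => (p i : Fin 3 → ℝ)) :=
    TropicalX.isGeneric_of_space (hp none).1 fun s hs => (hp (some s)).2 hs
  exact ⟨hgen.finiteUpToIso hbalanced hX hL hΔ₃ hN, fun h hh => hgen.shape hbalanced hX hL hΔ₃ hN hh⟩
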